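/- Let $M$ be a set with two functions $r:M\times M\to[0,\pi/2]$ and $\theta:M\times M\to[0,\pi]$, where $r$ is a pseudo-metric, $\theta$ is symmetric with $\theta(x,x)=0$, and $\delta(x,y)=\arccos(\cos r(x,y)\cos\theta(x,y))$ is a metric on $M$ for which $M$ is complete. (All this holds if $r\in[0,\pi/2)$ and $\theta\in[0,\pi)$ are pseudo-metrics, $r(x,y)=\theta(x,y)=0$ implies $x=y$, and every sequence that is Cauchy for both $r$ and $\theta$ converges for both to a common limit.) Let $\mu$ be a regular $\sigma$-finite Borel measure on $(M,\delta)$. A *heat kernel* on a measure space $(X,m)$ is a family $(h_t)_{t>0}$ of measurable functions on $X\times X$ such that for $m$-almost all $x,y$ and all $s,t>0$: (i) $h_t(x,y)\ge0$; (ii) $h_t(x,y)=h_t(y,x)$; (iii) $\int_X h_t(x,z)\,dm(z)=1$; (iv) $h_{s+t}(x,y)=\int_X h_s(x,z)h_t(z,y)\,dm(z)$; and (v) for all $f\in L^2(X,m)$, $\int_X f(y)h_t(\cdot,y)\,dm(y)\to f$ in $L^2(X,m)$ as $t\to0^+$ (all these integrals converging absolutely). With the Jacobi polynomials $P_k^{0,n}(x)=\frac{(-1)^k}{2^kk!(1+x)^{n}}\frac{d^k}{dx^k}\big((1+x)^{n}(1-x^2)^k\big)$,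 assume that $p_t(x,y)=p(t,r(x,y),\theta(x,y))$ is a heat kernel on $(M,\mu)$, where $$p(t,r,\theta)=\sum_{n=-\infty}^{\infty}\sum_{k=0}^\infty(2k+|n|+1)e^{-(4k(k+|n|+1)+2|n|)t}e^{in\theta}(\cos r)^{|n|}P_k^{0,|n|}(\cos 2r).$$ Let $q_t(x,y)=q(t,\cos\delta(x,y))$, where $$q(t,x)=\frac{\sqrt\pi\,e^t}{4t^{3/2}}\frac1{\sqrt{1-x^2}}\sum_{k\in\mathbb Z}(\arccos x+2k\pi)e^{-(\arccos x+2k\pi)^2/(4t)},\qquad -1<x<1,$$ extended continuously to $[-1,1]$. Let $\mathbf B=M/\!\sim$, where $x\sim y$ iff $r(x,y)=0$, with projection $\pi:M\to\mathbf B$, the metric induced by $r$ (again written $r$), its Borel $\sigma$-algebra, and $\tilde\mu=\mu\circ\pi^{-1}$. A *disintegration* of $\mu$ is a family $(\mu_{\mathbf x})_{\mathbf x\in\mathbf B}$ of probability measures on $M$ such that $\mathbf x\mapsto\mu_{\mathbf x}(A)$ is measurable for every Borel $A\subset M$, $\mu_{\mathbf x}(M\setminus\pi^{-1}(\mathbf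 x))=0$ for $\tilde\mu$-a.e. $\mathbf x$, and $\int_M f\,d\mu=\int_{\mathbf B}\int_{\pi^{-1}(\mathbf x)}f\,d\mu_{\mathbf x}\,d\tilde\mu(\mathbf x)$ for every Borel $f:M\to[0,\infty]$. Then a disintegration of $\mu$ exists, and for every disintegration $(\mu_{\mathbf x})$ the following hold. 1. $\tilde q_t(\mathbf x,\mathbf y)=\int\!\int q_t(x,y)\,d\mu_{\mathbf y}(y)\,d\mu_{\mathbf x}(x)$, $t>0$, is a heat kernel on $(\mathbf B,r,\tilde\mu)$. 2. Put $\Theta_0=1$ and, for $n\ge1$, $\Theta_n(x,\mathbf y)=2\int\cos(n\theta(x,y))\,d\mu_{\mathbf y}(y)$ and $\Theta_n(\mathbf x,\mathbf y)=2\int\!\int\cos(n\theta(x,y))\,d\mu_{\mathbf y}(y)\,d\mu_{\mathbf x}(x)$. Then $\Theta_n(x,\mathbf y)=\delta_0(n)$ for all $n\ge0$ and $\mu\otimes\tilde\mu$-a.e. $(x,\mathbf y)$, and $\Theta_n(\mathbf x,\mathbf y)=\delta_0(n)$ for all $n\ge0$ and $\tilde\mu\otimes\tilde\mu$-a.e.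 $(\mathbf x,\mathbf y)$, where $\delta_0(0)=1$ and $\delta_0(n)=0$ for $n\ge1$. 3. For $\tilde\mu\otimes\tilde\mu$-a.e. $(\mathbf x,\mathbf y)$ and all $t>0$, $$\tilde q_t(\mathbf x,\mathbf y)=\sum_{k=0}^\infty e^{-4k(k+1)t}(2k+1)P_k^{0,0}(\cos 2r(\mathbf x,\mathbf y)).$$ -/

import Mathlib

open Real MeasureTheory Filter Topology
open scoped ENNReal Nat

noncomputable section

/-! ### The space `(M, r, θ)` with its metric `δ = arccos (cos r cos θ)` -/

/-- A set with a pseudo-metric `r ∈ [0, π/2]` and a semi-metric `θ ∈ [0, π]` for which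
`δ = arccos (cos r cos θ)` is a metric; `δ` is the distance of the metric space `M`.
The triangle inequality of `θ` is not asked for: together with the other fields it would imply
that of `δ` (see `SemimetricPair.ofPseudoMetrics`), and it fails for the Hopf fibration of the
three-sphere, where `cos r * exp (± i θ)` is the Hermitian product of two unit vectors of `ℂ²`. -/
class SemimetricPair (M : Type*) extends MetricSpace M where
  r : M → M → ℝ
  theta : M → M → ℝ
  r_nonneg : ∀ x y, 0 ≤ r x y
  r_le : ∀ x y, r x y ≤ π / 2
  r_self : ∀ x, r x x = 0
  r_comm : ∀ x y, r x y = r y x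
  r_triangle : ∀ x y z, r x z ≤ r x y + r y z
  theta_nonneg : ∀ x y, 0 ≤ theta x y
  theta_le : ∀ x y, theta x y ≤ π
  theta_self : ∀ x, theta x x = 0
  theta_comm : ∀ x y, theta x y = theta y x
  dist_eq : ∀ x y, dist x y = arccos (cos (r x y) * cos (theta x y))

/-- The spherical comparison behind the triangle inequality of `arccos (cos r cos θ)`. -/
theorem arccos_mul_cos_triangle_aux {r₁ r₂ r₃ t₁ t₂ t₃ : ℝ}
    (h₁ : 0 ≤ r₁) (h₁' : r₁ ≤ π / 2) (h₂ : 0 ≤ r₂) (h₂' : r₂ ≤ π / 2)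
    (h₃ : 0 ≤ r₃) (h₃' : r₃ ≤ π / 2)
    (hr : r₃ ≤ r₁ + r₂) (hr₁ : r₁ ≤ r₃ + r₂) (hr₂ : r₂ ≤ r₃ + r₁)
    (k₁ : 0 ≤ t₁) (k₁' : t₁ ≤ π) (k₂ : 0 ≤ t₂) (k₂' : t₂ ≤ π) (k₃ : 0 ≤ t₃)
    (ht : t₃ ≤ t₁ + t₂) (hπ : t₁ + t₂ ≤ π) :
    arccos (cos r₃ * cos t₃) ≤ arccos (cos r₁ * cos t₁) + arccos (cos r₂ * cos t₂) := by
  have c₁ : 0 ≤ cos r₁ := cos_nonneg_of_mem_Icc ⟨by linarith, h₁'⟩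
  have c₂ : 0 ≤ cos r₂ := cos_nonneg_of_mem_Icc ⟨by linarith, h₂'⟩
  have c₃ : 0 ≤ cos r₃ := cos_nonneg_of_mem_Icc ⟨by linarith, h₃'⟩
  have s₁ : 0 ≤ sin r₁ := sin_nonneg_of_nonneg_of_le_pi h₁ (by linarith)
  have s₂ : 0 ≤ sin r₂ := sin_nonneg_of_nonneg_of_le_pi h₂ (by linarith)
  have u₁ : 0 ≤ sin t₁ := sin_nonneg_of_nonneg_of_le_pi k₁ k₁'
  have u₂ : 0 ≤ sin t₂ := sin_nonneg_of_nonneg_of_le_pi k₂ k₂'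
  have bound : ∀ a b : ℝ, -1 ≤ cos a * cos b ∧ cos a * cos b ≤ 1 := fun a b =>
    abs_le.1 (by
      rw [abs_mul]
      exact mul_le_one₀ (abs_cos_le_one a) (abs_nonneg _) (abs_cos_le_one b))
  set A := arccos (cos r₁ * cos t₁) with hA
  set B := arccos (cos r₂ * cos t₂) with hB
  have A0 : 0 ≤ A := arccos_nonneg _
  have B0 : 0 ≤ B := arccos_nonneg _
  rcases le_total π (A + B) with hAB | hAB
  · exact (arccos_le_pi _).trans hAB
  rw [← arccos_cos (by positivity : 0 ≤ A + B) hAB]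
  apply arccos_le_arccos
  have e : ∀ a b : ℝ, √(1 - (cos a * cos b) ^ 2) ^ 2 = sin a ^ 2 + (cos a * sin b) ^ 2 := by
    intro a b
    rw [sq_sqrt (by nlinarith [bound a b])]
    nlinarith [sin_sq_add_cos_sq a, sin_sq_add_cos_sq b]
  have cs : sin r₁ * sin r₂ + cos r₁ * sin t₁ * (cos r₂ * sin t₂) ≤ sin A * sin B := by
    rw [hA, hB, sin_arccos, sin_arccos]
    apply le_of_sq_le_sq _ (by positivity)
    rw [mul_pow, e, e]
    nlinarith [sq_nonneg (sin r₁ * (cos r₂ * sin t₂) - sin r₂ * (cos r₁ * sin t₁))]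
  have step : cos (A + B) ≤ cos r₁ * cos r₂ * cos (t₁ + t₂) - sin r₁ * sin r₂ := by
    rw [cos_add A B, hA, hB, cos_arccos (bound _ _).1 (bound _ _).2,
      cos_arccos (bound _ _).1 (bound _ _).2, cos_add t₁ t₂, ← hA, ← hB]
    nlinarith
  have ct : cos (t₁ + t₂) ≤ cos t₃ := cos_le_cos_of_nonneg_of_le_pi k₃ hπ ht
  have mono : cos r₁ * cos r₂ * cos (t₁ + t₂) ≤ cos r₁ * cos r₂ * cos t₃ :=
    mul_le_mul_of_nonneg_left ct (mul_nonneg c₁ c₂)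
  have ss : 0 ≤ sin r₁ * sin r₂ := mul_nonneg s₁ s₂
  rcases le_total 0 (cos t₃) with h | h
  · have : cos (r₁ + r₂) ≤ cos r₃ := cos_le_cos_of_nonneg_of_le_pi h₃ (by linarith) hr
    rw [cos_add] at this
    nlinarith [mul_le_mul_of_nonneg_right this h, cos_le_one t₃]
  · have : cos r₃ ≤ cos (r₁ - r₂) := by
      rw [← cos_abs (r₁ - r₂)]
      exact cos_le_cos_of_nonneg_of_le_pi (abs_nonneg _) (by linarith)
        (abs_le.2 ⟨by linarith, by linarith⟩)
    rw [cos_sub] at this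
    nlinarith [mul_le_mul_of_nonpos_right this h, neg_one_le_cos t₃]

theorem arccos_mul_cos_triangle {r₁ r₂ r₃ t₁ t₂ t₃ : ℝ}
    (h₁ : 0 ≤ r₁) (h₁' : r₁ ≤ π / 2) (h₂ : 0 ≤ r₂) (h₂' : r₂ ≤ π / 2)
    (h₃ : 0 ≤ r₃) (h₃' : r₃ ≤ π / 2)
    (hr : r₃ ≤ r₁ + r₂) (hr₁ : r₁ ≤ r₃ + r₂) (hr₂ : r₂ ≤ r₃ + r₁)
    (k₁ : 0 ≤ t₁) (k₁' : t₁ ≤ π) (k₂ : 0 ≤ t₂) (k₂' : t₂ ≤ π) (k₃ : 0 ≤ t₃) (k₃' : t₃ ≤ π)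
    (ht : t₃ ≤ t₁ + t₂) :
    arccos (cos r₃ * cos t₃) ≤ arccos (cos r₁ * cos t₁) + arccos (cos r₂ * cos t₂) := by
  rcases le_total (t₁ + t₂) π with hπ | hπ
  · exact arccos_mul_cos_triangle_aux h₁ h₁' h₂ h₂' h₃ h₃' hr hr₁ hr₂ k₁ k₁' k₂ k₂' k₃ ht hπ
  · refine (arccos_mul_cos_triangle_aux h₁ h₁' h₂ h₂' h₃ h₃' hr hr₁ hr₂ (t₁ := π - t₂)
      (by linarith) (by linarith) k₂ k₂' k₃ (by linarith) (by linarith)).trans ?_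
    gcongr
    · exact cos_nonneg_of_mem_Icc ⟨by linarith, h₁'⟩
    · exact cos_le_cos_of_nonneg_of_le_pi (by linarith) k₁' (by linarith)

/-- Two pseudo-metrics `r ∈ [0, π/2)`, `θ ∈ [0, π)` that jointly separate points form a
`SemimetricPair`. -/
@[reducible]
def SemimetricPair.ofPseudoMetrics {M : Type*} (r theta : M → M → ℝ)
    (r_nonneg : ∀ x y, 0 ≤ r x y) (r_lt : ∀ x y, r x y < π / 2) (r_self : ∀ x, r x x = 0)
    (r_comm : ∀ x y, r x y = r y x) (r_triangle : ∀ x y z, r x z ≤ r x y + r y z)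
    (theta_nonneg : ∀ x y, 0 ≤ theta x y) (theta_lt : ∀ x y, theta x y < π)
    (theta_self : ∀ x, theta x x = 0) (theta_comm : ∀ x y, theta x y = theta y x)
    (theta_triangle : ∀ x y z, theta x z ≤ theta x y + theta y z)
    (separated : ∀ x y, r x y = 0 → theta x y = 0 → x = y) : SemimetricPair M where
  dist x y := arccos (cos (r x y) * cos (theta x y))
  dist_self x := by simp [r_self, theta_self]
  dist_comm x y := by rw [r_comm, theta_comm]
  dist_triangle x y z := by
    refine arccos_mul_cos_triangle (r_nonneg x y) (r_lt x y).le (r_nonneg y z) (r_lt y z).le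
      (r_nonneg x z) (r_lt x z).le (r_triangle x y z) ?_ ?_ (theta_nonneg x y) (theta_lt x y).le
      (theta_nonneg y z) (theta_lt y z).le (theta_nonneg x z) (theta_lt x z).le
      (theta_triangle x y z)
    · rw [r_comm y z]; exact r_triangle x z y
    · have := r_triangle y x z
      rw [r_comm y x] at this
      linarith
  eq_of_dist_eq_zero {x y} h := by
    have hp := pi_pos
    have h1 : 1 ≤ cos (r x y) * cos (theta x y) := arccos_eq_zero.1 h
    have hc : 0 ≤ cos (r x y) :=
      cos_nonneg_of_mem_Icc ⟨by linarith [r_nonneg x y], (r_lt x y).le⟩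
    have hr : cos (r x y) = 1 := le_antisymm (cos_le_one _)
      (by nlinarith [cos_le_one (theta x y)])
    have ht : cos (theta x y) = 1 := le_antisymm (cos_le_one _) (by rw [hr] at h1; linarith)
    refine separated x y
      ((cos_eq_one_iff_of_lt_of_lt (by linarith [r_nonneg x y]) (by linarith [r_lt x y])).1 hr)
      ((cos_eq_one_iff_of_lt_of_lt (by linarith [theta_nonneg x y])
        (by linarith [theta_lt x y])).1 ht)
  r := r
  theta := theta
  r_nonneg := r_nonneg
  r_le x y := (r_lt x y).le
  r_self := r_self
  r_comm := r_comm
  r_triangle := r_triangle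
  theta_nonneg := theta_nonneg
  theta_le x y := (theta_lt x y).le
  theta_self := theta_self
  theta_comm := theta_comm
  dist_eq _ _ := rfl

/-! ### The quotient space `(B, r)` -/

/-- `x ∼ y` iff `r x y = 0`. -/
def fiberSetoid (M : Type*) [SemimetricPair M] : Setoid M where
  r x y := SemimetricPair.r x y = 0
  iseqv :=
    { refl := fun x => SemimetricPair.r_self x
      symm := fun {x y} h => by rw [SemimetricPair.r_comm]; exact h
      trans := fun {x y z} h h' => le_antisymm
        ((SemimetricPair.r_triangle x y z).trans (by rw [h, h', add_zero]))
        (SemimetricPair.r_nonneg x z) }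

/-- The quotient `B = M / ∼`. -/
def Base (M : Type*) [SemimetricPair M] : Type _ := Quotient (fiberSetoid M)

/-- The projection `M → B`. -/
def Base.proj {M : Type*} [SemimetricPair M] (x : M) : Base M := Quotient.mk (fiberSetoid M) x

/-- The function induced by `r` on `B`. -/
def Base.r {M : Type*} [SemimetricPair M] (a b : Base M) : ℝ :=
  Quotient.liftOn₂ a b SemimetricPair.r (by
    have key : ∀ x y x' y' : M, SemimetricPair.r x x' = 0 → SemimetricPair.r y y' = 0 →
        SemimetricPair.r x y ≤ SemimetricPair.r x' y' := by
      intro x y x' y' hx hy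
      have h1 := SemimetricPair.r_triangle x x' y
      have h2 := SemimetricPair.r_triangle x' y' y
      rw [SemimetricPair.r_comm y' y] at h2
      linarith
    intro x y x' y' hx hy
    refine le_antisymm (key _ _ _ _ hx hy) (key _ _ _ _ ?_ ?_)
    · rw [SemimetricPair.r_comm]; exact hx
    · rw [SemimetricPair.r_comm]; exact hy)

instance (M : Type*) [SemimetricPair M] : MetricSpace (Base M) where
  dist := Base.r
  dist_self a := Quotient.inductionOn a SemimetricPair.r_self
  dist_comm a b := Quotient.inductionOn₂ a b SemimetricPair.r_comm
  dist_triangle a b c := Quotient.inductionOn₃ a b c SemimetricPair.r_triangle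
  eq_of_dist_eq_zero {a b} := Quotient.inductionOn₂ a b fun _ _ h => Quotient.sound h

instance (M : Type*) [SemimetricPair M] : MeasurableSpace (Base M) := borel _

instance (M : Type*) [SemimetricPair M] : BorelSpace (Base M) := ⟨rfl⟩

/-- The push-forward `μ̃ = μ ∘ π⁻¹` of `μ` to `B`. -/
def baseMeasure {M : Type*} [SemimetricPair M] [MeasurableSpace M] (μ : Measure M) :
    Measure (Base M) :=
  μ.map Base.proj

/-! ### Heat kernels -/

/-- Abstract heat kernels `p t x y`, `t > 0`, on a measure space `(X, μ)`. -/
structure IsHeatKernel {X : Type*} [MeasurableSpace X] (μ : Measure X)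
    (p : ℝ → X → X → ℝ) : Prop where
  measurable : ∀ t > 0, Measurable fun z : X × X => p t z.1 z.2
  nonneg : ∀ᵐ z ∂(μ.prod μ), ∀ t > 0, 0 ≤ p t z.1 z.2
  symm : ∀ᵐ z ∂(μ.prod μ), ∀ t > 0, p t z.1 z.2 = p t z.2 z.1
  conservative : ∀ᵐ x ∂μ, ∀ t > 0, Integrable (fun y => p t x y) μ ∧ ∫ y, p t x y ∂μ = 1
  semigroup : ∀ᵐ z ∂(μ.prod μ), ∀ s > 0, ∀ t > 0,
    Integrable (fun w => p s z.1 w * p t w z.2) μ ∧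
      p (s + t) z.1 z.2 = ∫ w, p s z.1 w * p t w z.2 ∂μ
  approx_identity : ∀ f : X → ℝ, MemLp f 2 μ →
    (∀ t > 0, ∀ᵐ x ∂μ, Integrable (fun y => f y * p t x y) μ) ∧
      Tendsto (fun t => eLpNorm (fun x => (∫ y, f y * p t x y ∂μ) - f x) 2 μ) (𝓝[>] 0) (𝓝 0)

/-- The Jacobi polynomial `P_k^{0,n}`, by Rodrigues' formula. -/
def jacobi (n k : ℕ) (x : ℝ) : ℝ :=
  (-1) ^ k / (2 ^ k * k ! * (1 + x) ^ n) *
    iteratedDeriv k (fun y : ℝ => (1 + y) ^ n * (1 - y ^ 2) ^ k) x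

/-- The sub-Riemannian kernel
`∑_{n ∈ ℤ} ∑_{k ≥ 0} (2k+|n|+1) e^{-(4k(k+|n|+1)+2|n|)t} e^{inθ} (cos r)^{|n|} P_k^{0,|n|}(cos 2r)`
(a real number, since the terms of `n` and `-n` are conjugate). -/
def subRiemannianKernel (t r θ : ℝ) : ℝ :=
  (∑' n : ℤ, ∑' k : ℕ,
    (((2 * k + n.natAbs + 1) * exp (-(4 * k * (k + n.natAbs + 1) + 2 * n.natAbs) * t) : ℝ) : ℂ) *
      Complex.exp (Complex.I * n * θ) *
      ((cos r ^ n.natAbs * jacobi n.natAbs k (cos (2 * r)) : ℝ) : ℂ)).re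

/-- The kernel `p_t(x, y) = p(t, r(x, y), θ(x, y))` on `M`. -/
def kernelP {M : Type*} [SemimetricPair M] (t : ℝ) (x y : M) : ℝ :=
  subRiemannianKernel t (SemimetricPair.r x y) (SemimetricPair.theta x y)

/-- The function `q(t, x)` for `-1 < x < 1`. -/
def qFormula (t x : ℝ) : ℝ :=
  √π * exp t / (4 * t ^ (3 / 2 : ℝ)) * (1 / √(1 - x ^ 2)) *
    ∑' k : ℤ, (arccos x + 2 * k * π) * exp (-(arccos x + 2 * k * π) ^ 2 / (4 * t))

/-- The function `q(t, ·)` on `[-1, 1]`; its values at `±1` are the limits from inside. -/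
def qFunction (t x : ℝ) : ℝ := extendFrom (Set.Ioo (-1) 1) (qFormula t) x

/-- The kernel `q_t(x, y) = q(t, cos δ(x, y))` on `(M, δ, μ)`. -/
def kernelQ {M : Type*} [SemimetricPair M] (t : ℝ) (x y : M) : ℝ := qFunction t (cos (dist x y))

/-! ### Disintegration over the fibres and averaged kernels -/

/-- `κ` is a disintegration of `μ` along `M → B`: a measurable family of probability measures on
`M`, almost all of which are carried by the fibre, that integrates to `μ` against `μ̃`. -/
structure IsDisintegration {M : Type*} [SemimetricPair M] [MeasurableSpace M] (μ : Measure M)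
    (κ : Base M → Measure M) : Prop where
  isProbabilityMeasure : ∀ b, IsProbabilityMeasure (κ b)
  measurable : ∀ A : Set M, MeasurableSet A → Measurable fun b => κ b A
  fiber : ∀ᵐ b ∂(baseMeasure μ), κ b (Base.proj ⁻¹' {b})ᶜ = 0
  lintegral_eq : ∀ f : M → ℝ≥0∞, Measurable f →
    ∫⁻ x, f x ∂μ = ∫⁻ b, ∫⁻ x in Base.proj ⁻¹' {b}, f x ∂(κ b) ∂(baseMeasure μ)

/-- The fibre-averaged kernel `q̃_t(a, b) = ∫∫ q_t(x, y) dκ_b(y) dκ_a(x)`; the measures `κ_a`,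
`κ_b` live on the fibres over `a`, `b`. -/
def averagedKernelQ {M : Type*} [SemimetricPair M] [MeasurableSpace M]
    (κ : Base M → Measure M) (t : ℝ) (a b : Base M) : ℝ :=
  ∫ x, ∫ y, kernelQ t x y ∂(κ b) ∂(κ a)

/-- `Θ_n(x, b) = 2 ∫ cos (n θ(x, y)) dκ_b(y)` for `n ≥ 1`, and `Θ_0 = 1`. -/
def averagedTheta {M : Type*} [SemimetricPair M] [MeasurableSpace M]
    (κ : Base M → Measure M) (n : ℕ) (x : M) (b : Base M) : ℝ :=
  if n = 0 then 1 else 2 * ∫ y, cos (n * SemimetricPair.theta x y) ∂(κ b)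

/-- `Θ_n(a, b) = 2 ∫∫ cos (n θ(x, y)) dκ_b(y) dκ_a(x)` for `n ≥ 1`, and `Θ_0 = 1`. -/
def averagedTheta₂ {M : Type*} [SemimetricPair M] [MeasurableSpace M]
    (κ : Base M → Measure M) (n : ℕ) (a b : Base M) : ℝ :=
  if n = 0 then 1 else
    2 * ∫ x, ∫ y, cos (n * SemimetricPair.theta x y) ∂(κ b) ∂(κ a)

end

/-!
Put `ζ(x, y) = cos r(x, y) * exp (i θ(x, y))`, a point of the closed unit disc (`zeta`). In terms of
the disc polynomials `H(i,l)` (`discPoly`), both kernels are series at `ζ`,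
`p_t = ∑ (i+l+1) e^{-2(i+l+2il)t} H(i,l)(ζ)` and `q_t = ∑ (i+l+1) e^{-(i+l)(i+l+2)t} H(i,l)(ζ)`; the
first is a rewriting of the Jacobi polynomials (`subRiemannianKernel_eq_discSum`), the second
combines Poisson summation with the addition theorem `∑_{i+l=m} H(i,l) = U_m(Re ζ)`
(`qFunction_eq_chebyshevSum`, `chebyshevSum_re`). The diagonal terms `i = l` depend on `r` only, and
have the same weights in `p` and `q`. Hence the theorem follows once the angular moments
`∫ Re ζ(x, y)^n dμ_b(y)`, `n ≥ 1`, vanish: then `p_t` and `q_t` have the same fibre average, a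
function of the base points (`radialKernel`), which inherits the heat kernel properties of `p_t`.

The angular moments are found from the semigroup property. Grouping the terms of equal exponent,
`p_t = ∑_j e^{-2jt} Φ_j(ζ)` (`levelVal`), and uniqueness of the coefficients gives
`∫ Φ_i(x, w) Φ_j(w, y) dμ(w) = δ_{ij} Φ_i(x, y)` for almost all `(x, y)`
(`ae_integral_levelVal_mul`), and by continuity also for `y = x`. This determines all moments of the
law of `ζ(x, ·)` that are invariant under conjugation: they are those of the uniform distribution
on the disc (`eq_discIntegral`, `ae_hasDiscMoments`). In particular `(m+1) cos^{2m} r` is an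
approximate identity on the base (`tendsto_baseApprox`). Let `E_j(w, x)` be the average of
`Φ_j(w, ·)` over the fibre of `x`, and `N_j` the diagonal part of `Φ_j`, with `‖N_j‖² = d_j`. The
approximate identity, applied to `∫ Φ_j(x, w) Φ_j(w, y) dμ(w) = Φ_j(x, y)`, gives `‖E_j‖² ≤ d_j`,
while `⟨E_j, N_j⟩ = d_j` by orthogonality. Therefore `E_j = N_j`
(`IsDisintegration.ae_levelAverage_eq`). Since `Φ_n` contains `2 (n+1) Re ζ^n` and otherwise only
smaller angular frequencies, the moments of order `n` vanish by induction
(`integral_pow_re_eq_zero`).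

A disintegration exists because a regular probability measure on a complete metric space is carried
by a Polish subspace, on which conditional laws exist. If `μ ≠ 0`, then `μ` is a probability measure
(`isProbabilityMeasure_of_isHeatKernel`); if `μ = 0`, a constant point mass
is a disintegration, and only the measurability of the averaged kernel is left to prove.
-/

noncomputable section

/-! ### Disc polynomials -/

/-- The disc (Zernike) polynomials `H(i,l)` in two commuting variables `z` and `w`, normalized to
the value `1` at `z = w = 1`, with generating function
`∑ H(i,l) xⁱ yˡ = 1 / (1 - x z - y w + x y)`. Only the values at `w = conj z` matter for the
kernels; two variables make the recursion and the moments algebraic. -/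
def discPoly {R : Type*} [CommRing R] (z w : R) : ℕ → ℕ → R
  | i, 0 => z ^ i
  | 0, l + 1 => w ^ (l + 1)
  | i + 1, l + 1 => z * discPoly z w i (l + 1) + w * discPoly z w (i + 1) l - discPoly z w i l
termination_by i l => i + l

section Algebra

variable {R : Type*} [CommRing R] (z w : R)

@[simp] theorem discPoly_zero_right (i : ℕ) : discPoly z w i 0 = z ^ i := by
  simp [discPoly]

@[simp] theorem discPoly_zero_left (l : ℕ) : discPoly z w 0 l = w ^ l := by
  cases l <;> simp [discPoly]

theorem discPoly_succ_succ (i l : ℕ) : discPoly z w (i + 1) (l + 1) =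
    z * discPoly z w i (l + 1) + w * discPoly z w (i + 1) l - discPoly z w i l := by
  rw [discPoly]

/-- Induction along the defining recursion of `discPoly`. -/
theorem disc_induction {P : ℕ → ℕ → Prop} (h0 : ∀ i, P i 0) (h1 : ∀ l, P 0 l)
    (hs : ∀ i l, P i (l + 1) → P (i + 1) l → P i l → P (i + 1) (l + 1)) (i l : ℕ) : P i l := by
  suffices ∀ n i l, i + l = n → P i l from this _ i l rfl
  intro n
  induction n using Nat.strong_induction_on with
  | _ n ih =>
    intro i l h
    rcases i with _ | i
    · exact h1 l
    rcases l with _ | l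
    · exact h0 _
    · exact hs i l (ih _ (by omega) _ _ rfl) (ih _ (by omega) _ _ rfl) (ih _ (by omega) _ _ rfl)

theorem discPoly_swap (i l : ℕ) : discPoly z w i l = discPoly w z l i := by
  refine disc_induction (P := fun i l => discPoly z w i l = discPoly w z l i)
    (fun i => by simp) (fun l => by simp) (fun i l h1 h2 h3 => ?_) i l
  rw [discPoly_succ_succ, discPoly_succ_succ, h1, h2, h3]; ring

theorem discPoly_one_one (i l : ℕ) : discPoly (1 : R) 1 i l = 1 := by
  refine disc_induction (P := fun i l => discPoly (1 : R) 1 i l = 1)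
    (fun i => by simp) (fun l => by simp) (fun i l h1 h2 h3 => ?_) i l
  rw [discPoly_succ_succ, h1, h2, h3]; ring

theorem map_discPoly {S : Type*} [CommRing S] (f : R →+* S) (i l : ℕ) :
    f (discPoly z w i l) = discPoly (f z) (f w) i l := by
  refine disc_induction (P := fun i l => f (discPoly z w i l) = discPoly (f z) (f w) i l)
    (fun i => by simp) (fun l => by simp) (fun i l h1 h2 h3 => ?_) i l
  rw [discPoly_succ_succ, discPoly_succ_succ, map_sub, map_add, map_mul, map_mul, h1, h2, h3]

theorem discPoly_smul {u v : R} (huv : u * v = 1) (i l : ℕ) :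
    discPoly (u * z) (v * w) i l = u ^ i * v ^ l * discPoly z w i l := by
  refine disc_induction
    (P := fun i l => discPoly (u * z) (v * w) i l = u ^ i * v ^ l * discPoly z w i l)
    (fun i => by simp [mul_pow]) (fun l => by simp [mul_pow]) (fun i l h1 h2 h3 => ?_) i l
  rw [discPoly_succ_succ, discPoly_succ_succ, h1, h2, h3]
  have : u ^ i * v ^ l * discPoly z w i l
      = (u * v) * (u ^ i * v ^ l * discPoly z w i l) := by rw [huv, one_mul]
  rw [this]; ring

theorem discPoly_eq_sum (i l : ℕ) : discPoly z w i l =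
    ∑ s ∈ Finset.range (l + 1), (-1) ^ s * (l.choose s * (i + l - s).choose l : ℕ) *
      (z ^ (i - s) * w ^ (l - s)) := by
  refine disc_induction (P := fun i l => discPoly z w i l =
    ∑ s ∈ Finset.range (l + 1), (-1) ^ s * (l.choose s * (i + l - s).choose l : ℕ) *
      (z ^ (i - s) * w ^ (l - s))) (fun i => by simp) (fun l => ?_) (fun i l h1 h2 h3 => ?_) i l
  · rw [Finset.sum_range_succ', Finset.sum_eq_zero]
    · simp
    · intro s hs
      rw [Finset.mem_range] at hs
      rw [Nat.choose_eq_zero_of_lt (by omega : 0 + l - (s + 1) < l)]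
      simp
  · rw [discPoly_succ_succ, h1, h2, h3]
    -- the three terms of the recursion, reindexed to a common range
    have e1 : z * ∑ s ∈ Finset.range (l + 1 + 1), (-1 : R) ^ s *
        ((l + 1).choose s * (i + (l + 1) - s).choose (l + 1) : ℕ) *
          (z ^ (i - s) * w ^ (l + 1 - s)) =
        ∑ s ∈ Finset.range (l + 1 + 1), (-1 : R) ^ s *
          ((l + 1).choose s * (i + (l + 1) - s).choose (l + 1) : ℕ) *
          (z ^ (i + 1 - s) * w ^ (l + 1 - s)) := by
      rw [Finset.mul_sum]
      refine Finset.sum_congr rfl fun s hs => ?_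
      rw [Finset.mem_range] at hs
      by_cases h : s ≤ i
      · rw [show i + 1 - s = (i - s) + 1 by omega]; ring
      · rw [Nat.choose_eq_zero_of_lt (by omega : i + (l + 1) - s < l + 1)]; simp
    have e2 : w * ∑ s ∈ Finset.range (l + 1), (-1 : R) ^ s *
        (l.choose s * (i + 1 + l - s).choose l : ℕ) *
          (z ^ (i + 1 - s) * w ^ (l - s)) =
        ∑ s ∈ Finset.range (l + 1 + 1), (-1 : R) ^ s *
          (l.choose s * (i + 1 + l - s).choose l : ℕ) *
          (z ^ (i + 1 - s) * w ^ (l + 1 - s)) := by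
      rw [Finset.sum_range_succ _ (l + 1), Nat.choose_succ_self, Finset.mul_sum]
      simp only [Nat.cast_zero, zero_mul, mul_zero, add_zero]
      refine Finset.sum_congr rfl fun s hs => ?_
      rw [Finset.mem_range] at hs
      rw [show l + 1 - s = (l - s) + 1 by omega]; ring
    have e3 : ∑ s ∈ Finset.range (l + 1), (-1 : R) ^ s *
        (l.choose s * (i + l - s).choose l : ℕ) * (z ^ (i - s) * w ^ (l - s)) =
        - ∑ s ∈ Finset.range (l + 1 + 1), (-1 : R) ^ s *
          ((if s = 0 then 0 else l.choose (s - 1)) * (i + 1 + l - s).choose l : ℕ) *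
          (z ^ (i + 1 - s) * w ^ (l + 1 - s)) := by
      rw [Finset.sum_range_succ' _ (l + 1)]
      simp only [if_true, Nat.cast_zero, zero_mul, mul_zero, add_zero]
      rw [← Finset.sum_neg_distrib]
      refine Finset.sum_congr rfl fun s hs => ?_
      rw [if_neg (by omega), show i + 1 + l - (s + 1) = i + l - s by omega,
        show i + 1 - (s + 1) = i - s by omega, show l + 1 - (s + 1) = l - s by omega,
        Nat.add_sub_cancel]
      ring
    rw [e1, e2, e3, sub_neg_eq_add, ← Finset.sum_add_distrib, ← Finset.sum_add_distrib]
    refine Finset.sum_congr rfl fun s hs => ?_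
    rw [Finset.mem_range] at hs
    have key : (l + 1).choose s * (i + (l + 1) - s).choose (l + 1)
        + l.choose s * (i + 1 + l - s).choose l
        + (if s = 0 then 0 else l.choose (s - 1)) * (i + 1 + l - s).choose l
        = (l + 1).choose s * (i + 1 + (l + 1) - s).choose (l + 1) := by
      rw [show i + 1 + (l + 1) - s = (i + 1 + l - s) + 1 by omega,
        show i + (l + 1) - s = i + 1 + l - s by omega, Nat.choose_succ_succ (i + 1 + l - s) l]
      rcases s with _ | s
      · simp; ring
      · rw [Nat.choose_succ_succ l s, if_neg (by omega), Nat.add_sub_cancel]; ring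
    rw [← key]; push_cast; ring

/-- The radial part of the disc polynomial `H(n + k, k)`; it is the Jacobi polynomial
`P_k^{0,n}(2 b - 1)`. -/
def radialPoly (n k : ℕ) (b : R) : R :=
  ∑ s ∈ Finset.range (k + 1), (-1) ^ s * (k.choose s * (n + 2 * k - s).choose k : ℕ) * b ^ (k - s)

/-- Every disc polynomial is a power of `z` (or, after `discPoly_swap`, of `w`) times a radial
polynomial. -/
theorem discPoly_add (n k : ℕ) : discPoly z w (n + k) k = z ^ n * radialPoly n k (z * w) := by
  rw [discPoly_eq_sum, radialPoly, Finset.mul_sum]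
  refine Finset.sum_congr rfl fun s hs => ?_
  rw [Finset.mem_range] at hs
  rw [show n + k - s = n + (k - s) by omega, show n + k + k - s = n + 2 * k - s by omega, mul_pow,
    pow_add]
  ring

/-- The addition theorem: the disc polynomials of degree `m` add up to the Chebyshev polynomial
`U_m`. -/
theorem sum_antidiagonal_discPoly (x : R) (h : z + w = 2 * x) (m : ℕ) :
    ∑ q ∈ Finset.HasAntidiagonal.antidiagonal m, discPoly z w q.1 q.2 =
      (Polynomial.Chebyshev.U R m).eval x := by
  induction m using Nat.strong_induction_on with
  | _ m ih =>
  rcases m with _ | _ | m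
  · simp
  · rw [Finset.Nat.sum_antidiagonal_succ]
    simp [← h, add_comm]
  · have hU : (Polynomial.Chebyshev.U R ((m + 1 + 1 : ℕ) : ℤ)).eval x =
        2 * x * (Polynomial.Chebyshev.U R ((m + 1 : ℕ) : ℤ)).eval x
          - (Polynomial.Chebyshev.U R (m : ℤ)).eval x := by
      have := Polynomial.Chebyshev.U_add_two R (m : ℤ)
      rw [show ((m + 1 + 1 : ℕ) : ℤ) = (m : ℤ) + 2 by push_cast; ring, this]
      simp
    rw [hU, ← ih (m + 1) (by omega), ← ih m (by omega), ← h, add_mul]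
    -- split off the two boundary terms of each antidiagonal
    rw [Finset.Nat.antidiagonal_succ_succ', Finset.sum_cons, Finset.sum_cons, Finset.sum_map]
    simp only [Function.Embedding.prodMap, Function.Embedding.coeFn_mk, Prod.map,
      Nat.succ_eq_add_one, discPoly_succ_succ]
    rw [Finset.sum_sub_distrib, Finset.sum_add_distrib, ← Finset.mul_sum, ← Finset.mul_sum]
    have e1 : ∑ q ∈ Finset.HasAntidiagonal.antidiagonal (m + 1), discPoly z w q.1 q.2
        = ∑ q ∈ Finset.HasAntidiagonal.antidiagonal m, discPoly z w q.1 (q.2 + 1)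
          + z ^ (m + 1) := by
      rw [Finset.Nat.sum_antidiagonal_succ']; simp [add_comm]
    have e2 : ∑ q ∈ Finset.HasAntidiagonal.antidiagonal (m + 1), discPoly z w q.1 q.2
        = ∑ q ∈ Finset.HasAntidiagonal.antidiagonal m, discPoly z w (q.1 + 1) q.2
          + w ^ (m + 1) := by
      rw [Finset.Nat.sum_antidiagonal_succ]; simp [add_comm]
    have e3 : z * ∑ q ∈ Finset.HasAntidiagonal.antidiagonal (m + 1), discPoly z w q.1 q.2 =
        z * (∑ q ∈ Finset.HasAntidiagonal.antidiagonal m, discPoly z w q.1 (q.2 + 1)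
          + z ^ (m + 1)) := by rw [e1]
    rw [e3, e2]
    simp
    ring

/-! ### The level decomposition -/

/-- The exponent of the sub-Riemannian kernel at the disc polynomial `H(i,l)`, halved. -/
def discLevel (q : ℕ × ℕ) : ℕ := q.1 + q.2 + 2 * q.1 * q.2

/-- The indices of a given level. -/
def levelSet (j : ℕ) : Finset (ℕ × ℕ) :=
  (Finset.range (j + 1) ×ˢ Finset.range (j + 1)).filter fun q => discLevel q = j

theorem mem_levelSet {j : ℕ} {q : ℕ × ℕ} : q ∈ levelSet j ↔ discLevel q = j := by
  simp only [levelSet, Finset.mem_filter, Finset.mem_product, Finset.mem_range,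
    and_iff_right_iff_imp]
  intro h
  rw [← h, discLevel]
  constructor <;> nlinarith [Nat.zero_le (q.1 * q.2)]

/-- The coefficient of `e^{-2jt}` in the sub-Riemannian kernel. -/
def levelPoly (j : ℕ) : R := ∑ q ∈ levelSet j, (q.1 + q.2 + 1 : ℕ) * discPoly z w q.1 q.2

theorem map_levelPoly {S : Type*} [CommRing S] (f : R →+* S) (j : ℕ) :
    f (levelPoly z w j) = levelPoly (f z) (f w) j := by
  simp [levelPoly, map_sum, map_discPoly]

theorem levelPoly_zero : levelPoly z w 0 = 1 := by
  have : levelSet 0 = {(0, 0)} := by decide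
  simp [levelPoly, this]

theorem swap_mem_levelSet {j : ℕ} {q : ℕ × ℕ} : q.swap ∈ levelSet j ↔ q ∈ levelSet j := by
  rw [mem_levelSet, mem_levelSet, discLevel, discLevel]
  simp only [Prod.fst_swap, Prod.snd_swap]
  rw [show q.2 + q.1 + 2 * q.2 * q.1 = q.1 + q.2 + 2 * q.1 * q.2 by ring]

theorem levelPoly_swap (j : ℕ) : levelPoly z w j = levelPoly w z j := by
  unfold levelPoly
  refine Finset.sum_bij' (fun q _ => q.swap) (fun q _ => q.swap)
    (fun q h => swap_mem_levelSet.2 h) (fun q h => swap_mem_levelSet.2 h) (by simp) (by simp) ?_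
  intro q _
  rw [discPoly_swap z w]
  simp only [Prod.fst_swap, Prod.snd_swap]
  rw [show q.2 + q.1 + 1 = q.1 + q.2 + 1 by ring]

theorem levelSet_succ_eq (j : ℕ) : levelSet (j + 1) =
    insert (j + 1, 0) (insert (0, j + 1)
      ((levelSet (j + 1)).filter fun q => q.1 ≠ 0 ∧ q.2 ≠ 0)) := by
  ext ⟨a, b⟩
  simp only [Finset.mem_insert, Finset.mem_filter, mem_levelSet, discLevel, Prod.mk.injEq]
  constructor
  · intro h
    rcases Nat.eq_zero_or_pos a with rfl | ha
    · right; left; simpa using h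
    rcases Nat.eq_zero_or_pos b with rfl | hb
    · left; simpa using h
    · right; right; exact ⟨h, by omega, by omega⟩
  · rintro (⟨rfl, rfl⟩ | ⟨rfl, rfl⟩ | ⟨h, -⟩)
    · simp
    · simp
    · exact h

/-- The leading part of `levelPoly` is `(j + 1) (zʲ + wʲ)`; the indices of the other terms have
smaller degree. -/
theorem sum_levelSet_succ {A : Type*} [AddCommMonoid A] (f : ℕ × ℕ → A) (j : ℕ) :
    ∑ q ∈ levelSet (j + 1), f q = f (j + 1, 0) + (f (0, j + 1) +
      ∑ q ∈ (levelSet (j + 1)).filter (fun q => q.1 ≠ 0 ∧ q.2 ≠ 0), f q) := by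
  conv_lhs => rw [levelSet_succ_eq]
  rw [Finset.sum_insert (by simp), Finset.sum_insert (by simp)]

theorem degree_lt_of_mem_levelSet {j : ℕ} {q : ℕ × ℕ}
    (h : q ∈ (levelSet j).filter fun q => q.1 ≠ 0 ∧ q.2 ≠ 0) : q.1 + q.2 < j := by
  rw [Finset.mem_filter, mem_levelSet, discLevel] at h
  have := Nat.mul_pos (Nat.pos_of_ne_zero h.2.1) (Nat.pos_of_ne_zero h.2.2)
  nlinarith [h.1]

end Algebra

/-! ### The uniform moments of the disc -/

/-- The polynomial ring `ℝ[z, w]`. -/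
abbrev DiscRing := MvPolynomial (Fin 2) ℝ

/-- The variable `z`. -/
abbrev dz : DiscRing := MvPolynomial.X 0
/-- The variable `w`, which stands for the conjugate of `z`. -/
abbrev dw : DiscRing := MvPolynomial.X 1

/-- The integral against the normalized area of the unit disc, as a functional on `ℝ[z, w]`. -/
def discIntegral : DiscRing →ₗ[ℝ] ℝ :=
  (MvPolynomial.basisMonomials (Fin 2) ℝ).constr ℝ
    fun m => if m 0 = m 1 then 1 / (m 0 + 1 : ℝ) else 0

theorem dz_pow_mul_dw_pow (a b : ℕ) : dz ^ a * dw ^ b =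
    MvPolynomial.monomial (Finsupp.single 0 a + Finsupp.single 1 b) (1 : ℝ) := by
  rw [dz, dw, MvPolynomial.X_pow_eq_monomial, MvPolynomial.X_pow_eq_monomial,
    MvPolynomial.monomial_mul, one_mul]

theorem discIntegral_monomial (a b : ℕ) :
    discIntegral (dz ^ a * dw ^ b) = if a = b then 1 / (a + 1 : ℝ) else 0 := by
  have := (MvPolynomial.basisMonomials (Fin 2) ℝ).constr_basis ℝ
    (fun m => if m 0 = m 1 then 1 / (m 0 + 1 : ℝ) else 0) (Finsupp.single 0 a + Finsupp.single 1 b)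
  rw [MvPolynomial.coe_basisMonomials] at this
  rw [dz_pow_mul_dw_pow, discIntegral, this]
  simp

/-- Two functionals on `ℝ[z, w]` that agree on monomials are equal. -/
theorem disc_functional_ext {L L' : DiscRing →ₗ[ℝ] ℝ}
    (h : ∀ a b, L (dz ^ a * dw ^ b) = L' (dz ^ a * dw ^ b)) : L = L' := by
  refine (MvPolynomial.basisMonomials (Fin 2) ℝ).ext fun m => ?_
  have := h (m 0) (m 1)
  rw [dz_pow_mul_dw_pow] at this
  rw [MvPolynomial.coe_basisMonomials]
  convert this using 3 <;>
  · ext i; fin_cases i <;> simp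

theorem discIntegral_discPoly_mul (i l : ℕ) : ∀ a b,
    discIntegral (discPoly dz dw i l * (dz ^ a * dw ^ b)) =
      if i + a = l + b then (a.descFactorial l * b ! : ℕ) / ((i + a + 1)! : ℝ) else 0 := by
  refine disc_induction (P := fun i l => ∀ a b,
    discIntegral (discPoly dz dw i l * (dz ^ a * dw ^ b)) =
      if i + a = l + b then (a.descFactorial l * b ! : ℕ) / ((i + a + 1)! : ℝ) else 0)
    (fun i a b => ?_) (fun l a b => ?_) (fun i l h1 h2 h3 a b => ?_) i l
  · rw [discPoly_zero_right, ← mul_assoc, ← pow_add, discIntegral_monomial, zero_add]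
    split_ifs with h
    · subst h
      rw [Nat.descFactorial_zero, one_mul, Nat.factorial_succ]
      have : ((i + a)! : ℝ) ≠ 0 := by positivity
      push_cast
      field_simp
    · rfl
  · rw [discPoly_zero_left, show dw ^ l * (dz ^ a * dw ^ b) = dz ^ a * dw ^ (l + b) by ring,
      discIntegral_monomial, zero_add]
    split_ifs with h
    · subst h
      have := Nat.factorial_mul_descFactorial (Nat.le_add_right l b)
      rw [Nat.add_sub_cancel_left] at this
      rw [mul_comm, this, Nat.factorial_succ]
      have : ((l + b)! : ℝ) ≠ 0 := by positivity
      push_cast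
      field_simp
    · rfl
  · rw [discPoly_succ_succ, show (dz * discPoly dz dw i (l + 1) + dw * discPoly dz dw (i + 1) l
        - discPoly dz dw i l) * (dz ^ a * dw ^ b) =
        discPoly dz dw i (l + 1) * (dz ^ (a + 1) * dw ^ b)
        + discPoly dz dw (i + 1) l * (dz ^ a * dw ^ (b + 1))
        - discPoly dz dw i l * (dz ^ a * dw ^ b) by ring, map_sub, map_add, h1, h2, h3]
    by_cases h : i + a = l + b
    · rw [if_pos (by omega), if_pos (by omega), if_pos h, if_pos (by omega),
        show i + (a + 1) + 1 = i + a + 1 + 1 by ring, show i + 1 + a + 1 = i + a + 1 + 1 by ring,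
        Nat.factorial_succ (i + a + 1), Nat.succ_descFactorial_succ, Nat.factorial_succ b]
      have hf : ((i + a + 1)! : ℝ) ≠ 0 := by positivity
      have hd : ((a.descFactorial (l + 1) : ℕ) : ℝ) = (a - l) * (a.descFactorial l : ℕ) := by
        rw [Nat.descFactorial_succ]
        rcases le_or_gt l a with hl | hl
        · push_cast [Nat.cast_sub hl]; ring
        · simp [Nat.descFactorial_of_lt hl]
      have hr : (i : ℝ) + a = l + b := by exact_mod_cast h
      push_cast
      rw [hd]
      field_simp
      linear_combination (-(a.descFactorial l : ℝ)) * hr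
    · rw [if_neg (by omega), if_neg (by omega), if_neg h, if_neg (by omega)]; simp

/-- Orthogonality of the disc polynomials for the uniform distribution; `H(l,i)` is the conjugate of
`H(i,l)`. -/
theorem discIntegral_discPoly_mul_discPoly (i l i' l' : ℕ) :
    discIntegral (discPoly dz dw i l * discPoly dz dw i' l') =
      if i = l' ∧ l = i' then 1 / (i + l + 1 : ℝ) else 0 := by
  -- by symmetry the second factor may be assumed to have the smaller degree
  wlog hd : i' + l' ≤ i + l generalizing i l i' l'
  · rw [mul_comm, this i' l' i l (by omega)]
    by_cases h : i = l' ∧ l = i'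
    · rw [if_pos h, if_pos ⟨h.2.symm, h.1.symm⟩, h.1, h.2, add_comm (i' : ℝ)]
    · rw [if_neg h, if_neg fun h' => h ⟨h'.2.symm, h'.1.symm⟩]
  have hcast : ∀ m : ℕ, ∀ s : ℕ, ((-1 : DiscRing) ^ s * (m : DiscRing)) =
      MvPolynomial.C ((-1) ^ s * (m : ℝ)) := by intro m s; simp
  rw [discPoly_eq_sum (i := i'), Finset.mul_sum, map_sum]
  have hterm : ∀ s ∈ Finset.range (l' + 1), discIntegral (discPoly dz dw i l *
      ((-1) ^ s * (l'.choose s * (i' + l' - s).choose l' : ℕ) * (dz ^ (i' - s) * dw ^ (l' - s)))) =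
      if s = 0 ∧ i = l' ∧ l = i' then 1 / (i + l + 1 : ℝ) else 0 := by
    intro s hs
    rw [Finset.mem_range] at hs
    rw [hcast, mul_left_comm, ← MvPolynomial.smul_eq_C_mul, map_smul, discIntegral_discPoly_mul,
      smul_eq_mul]
    rcases le_or_gt s i' with hsi | hsi
    swap
    · rw [Nat.choose_eq_zero_of_lt (by omega : i' + l' - s < l')]
      simp
      intros; omega
    split_ifs with h1 h2 h2
    · obtain ⟨rfl, rfl, rfl⟩ := h2
      simp only [Nat.choose_zero_right, Nat.sub_zero, pow_zero, Nat.descFactorial_self, one_mul]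
      have := Nat.add_choose_mul_factorial_mul_factorial l i
      rw [Nat.factorial_succ, add_comm i l, ← this]
      have c : (((l + i).choose i : ℕ) : ℝ) ≠ 0 := by
        exact_mod_cast (Nat.choose_pos (by omega)).ne'
      have f1 : (l ! : ℝ) ≠ 0 := by positivity
      have f2 : (i ! : ℝ) ≠ 0 := by positivity
      have : (i : ℝ) + l + 1 ≠ 0 := by positivity
      have : (l : ℝ) + i + 1 ≠ 0 := by positivity
      push_cast
      field_simp
      ring
    · rcases Nat.lt_or_ge (i' - s) l with h3 | h3
      · rw [Nat.descFactorial_of_lt h3]; simp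
      · omega
    · omega
    · simp
  rw [Finset.sum_congr rfl hterm]
  by_cases h : i = l' ∧ l = i'
  · rw [if_pos h, Finset.sum_eq_single 0] <;> simp [h]
    intros; omega
  · rw [if_neg h, Finset.sum_eq_zero]
    intro s _
    rw [if_neg fun h' => h h'.2]

theorem discIntegral_levelPoly_mul (a b : ℕ) :
    discIntegral (levelPoly dz dw a * levelPoly dz dw b) =
      if a = b then ∑ q ∈ levelSet a, (q.1 + q.2 + 1 : ℝ) else 0 := by
  have hc : ∀ m : ℕ, (m : DiscRing) = MvPolynomial.C (m : ℝ) := by simp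
  unfold levelPoly
  rw [Finset.sum_mul, map_sum]
  have hq : ∀ q ∈ levelSet a, discIntegral ((q.1 + q.2 + 1 : ℕ) * discPoly dz dw q.1 q.2 *
      ∑ p ∈ levelSet b, (p.1 + p.2 + 1 : ℕ) * discPoly dz dw p.1 p.2) =
      if a = b then (q.1 + q.2 + 1 : ℝ) else 0 := by
    intro q hq
    rw [Finset.mul_sum, map_sum]
    have hp : ∀ p ∈ levelSet b, discIntegral ((q.1 + q.2 + 1 : ℕ) * discPoly dz dw q.1 q.2 *
        ((p.1 + p.2 + 1 : ℕ) * discPoly dz dw p.1 p.2)) =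
        if p = q.swap then (q.1 + q.2 + 1 : ℝ) else 0 := by
      intro p _
      rw [hc, hc, mul_mul_mul_comm, ← map_mul, ← MvPolynomial.smul_eq_C_mul, map_smul,
        discIntegral_discPoly_mul_discPoly, smul_eq_mul]
      by_cases h : p = q.swap
      · subst h
        simp
        have : (q.1 : ℝ) + q.2 + 1 ≠ 0 := by positivity
        field_simp
        ring
      · rw [if_neg h, if_neg, mul_zero]
        rintro ⟨h1, h2⟩
        exact h (Prod.ext h2.symm h1.symm)
    rw [Finset.sum_congr rfl hp, Finset.sum_ite_eq' (levelSet b)]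
    by_cases hab : a = b
    · subst hab
      rw [if_pos (swap_mem_levelSet.2 hq), if_pos rfl]
    · rw [if_neg hab, if_neg]
      rw [swap_mem_levelSet, mem_levelSet]
      rw [mem_levelSet] at hq
      omega
  rw [Finset.sum_congr rfl hq]
  split_ifs with h <;> simp

/-- The span of the monomials of degree less than `m`. -/
def degreeLTSpan (m : ℕ) : Submodule ℝ DiscRing :=
  Submodule.span ℝ {p | ∃ a b : ℕ, a + b < m ∧ p = dz ^ a * dw ^ b}

theorem monomial_mem_degreeLTSpan {a b m : ℕ} (h : a + b < m) :
    dz ^ a * dw ^ b ∈ degreeLTSpan m := Submodule.subset_span ⟨a, b, h, rfl⟩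

theorem degreeLTSpan_mono {m n : ℕ} (h : m ≤ n) : degreeLTSpan m ≤ degreeLTSpan n :=
  Submodule.span_mono fun _ ⟨a, b, hab, e⟩ => ⟨a, b, by omega, e⟩

theorem mul_mem_degreeLTSpan {m n : ℕ} {p q : DiscRing} (hp : p ∈ degreeLTSpan m)
    (hq : q ∈ degreeLTSpan (n + 1)) : p * q ∈ degreeLTSpan (m + n) := by
  have := Submodule.mul_mem_mul hp hq
  rw [degreeLTSpan, degreeLTSpan, Submodule.span_mul_span] at this
  refine Submodule.span_mono ?_ this
  rintro _ ⟨_, ⟨a, b, h, rfl⟩, _, ⟨c, d, h', rfl⟩, rfl⟩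
  exact ⟨a + c, b + d, by omega, by simp only; ring⟩

theorem discPoly_mem_degreeLTSpan (i l : ℕ) : discPoly dz dw i l ∈ degreeLTSpan (i + l + 1) := by
  rw [discPoly_eq_sum]
  refine Submodule.sum_mem _ fun s hs => ?_
  rw [Finset.mem_range] at hs
  rw [show ((-1) ^ s * ((l.choose s * (i + l - s).choose l : ℕ) : DiscRing)) =
    MvPolynomial.C ((-1) ^ s * ((l.choose s * (i + l - s).choose l : ℕ) : ℝ)) by simp,
    ← MvPolynomial.smul_eq_C_mul]
  exact Submodule.smul_mem _ _ (monomial_mem_degreeLTSpan (by omega))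

theorem natCast_mul_mem_degreeLTSpan {m : ℕ} {p : DiscRing} (c : ℕ) (hp : p ∈ degreeLTSpan m) :
    (c : DiscRing) * p ∈ degreeLTSpan m := by
  rw [← nsmul_eq_mul]
  exact Submodule.smul_of_tower_mem _ c hp

theorem levelPoly_succ_sub_mem (j : ℕ) : levelPoly dz dw (j + 1) -
    (j + 2 : ℕ) * (dz ^ (j + 1) + dw ^ (j + 1)) ∈ degreeLTSpan (j + 1) := by
  rw [levelPoly, sum_levelSet_succ]
  have : ∑ q ∈ (levelSet (j + 1)).filter (fun q => q.1 ≠ 0 ∧ q.2 ≠ 0),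
      ((q.1 + q.2 + 1 : ℕ) : DiscRing) * discPoly dz dw q.1 q.2 ∈ degreeLTSpan (j + 1) := by
    refine Submodule.sum_mem _ fun q hq => natCast_mul_mem_degreeLTSpan _ ?_
    exact degreeLTSpan_mono (degree_lt_of_mem_levelSet hq) (discPoly_mem_degreeLTSpan _ _)
  convert this using 1
  simp
  ring

theorem levelPoly_mem (j : ℕ) : levelPoly dz dw j ∈ degreeLTSpan (j + 1) := by
  unfold levelPoly
  refine Submodule.sum_mem _ fun q hq => natCast_mul_mem_degreeLTSpan _ ?_
  refine degreeLTSpan_mono ?_ (discPoly_mem_degreeLTSpan _ _)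
  rw [mem_levelSet, discLevel] at hq
  have := Nat.zero_le (2 * q.1 * q.2)
  omega

/-- A conjugation-invariant functional on `ℝ[z, w]` for which the level polynomials are orthogonal
with the norms of the uniform distribution is the uniform distribution: the products
`levelPoly a * levelPoly b` have, up to lower degree, leading parts that determine all moments. -/
theorem eq_discIntegral {L : DiscRing →ₗ[ℝ] ℝ}
    (hsymm : ∀ a b, L (dz ^ a * dw ^ b) = L (dz ^ b * dw ^ a))
    (hL : ∀ a b, L (levelPoly dz dw a * levelPoly dz dw b) =
      if a = b then ∑ q ∈ levelSet a, (q.1 + q.2 + 1 : ℝ) else 0) : L = discIntegral := by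
  have hL' : ∀ a b, L (levelPoly dz dw a * levelPoly dz dw b) =
      discIntegral (levelPoly dz dw a * levelPoly dz dw b) := fun a b => by
    rw [hL, discIntegral_levelPoly_mul]
  have hsymm' : ∀ a b, discIntegral (dz ^ a * dw ^ b) = discIntegral (dz ^ b * dw ^ a) := by
    intro a b
    rw [discIntegral_monomial, discIntegral_monomial]
    by_cases h : a = b
    · rw [h]
    · rw [if_neg h, if_neg (Ne.symm h)]
  refine disc_functional_ext fun a b => ?_
  suffices ∀ m a b, b ≤ a → a + b = m → L (dz ^ a * dw ^ b) = discIntegral (dz ^ a * dw ^ b) by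
    rcases le_total b a with h | h
    · exact this _ a b h rfl
    · rw [hsymm, hsymm', this _ b a h rfl]
  intro m
  induction m using Nat.strong_induction_on with
  | _ m ih =>
  intro a b hba hab
  have hlow : ∀ p ∈ degreeLTSpan m, L p = discIntegral p := by
    intro p hp
    refine LinearMap.eqOn_span (f := L) (g := discIntegral) ?_ hp
    rintro _ ⟨c, d, hcd, rfl⟩
    rcases le_total d c with h | h
    · exact ih _ hcd c d h rfl
    · rw [hsymm, hsymm']; exact ih _ hcd d c h (by omega)
  have cancel : ∀ (c : ℕ) (p : DiscRing), c ≠ 0 → L ((c : DiscRing) * p) = discIntegral (c * p) →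
      L p = discIntegral p := by
    intro c p hc h
    rw [← nsmul_eq_mul, map_nsmul, map_nsmul, nsmul_eq_mul, nsmul_eq_mul] at h
    exact mul_left_cancel₀ (Nat.cast_ne_zero.2 hc) h
  rcases b with _ | b
  · rcases a with _ | a
    · have := hL' 0 0
      simpa [levelPoly_zero] using this
    · have h1 := hL' (a + 1) 0
      rw [levelPoly_zero, mul_one] at h1
      have h2 := hlow _ (by subst hab; exact levelPoly_succ_sub_mem a)
      rw [map_sub, map_sub, h1, sub_right_inj] at h2
      have h3 := cancel _ _ (by omega) h2
      have e1 := hsymm 0 (a + 1)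
      have e2 := hsymm' 0 (a + 1)
      simp only [pow_zero, one_mul, mul_one] at e1 e2 ⊢
      rw [map_add, map_add, e1, e2] at h3
      linarith
  · rcases a with _ | a
    · omega
    have hmem : levelPoly dz dw (a + 1) * levelPoly dz dw (b + 1) -
        ((a + 2 : ℕ) * (dz ^ (a + 1) + dw ^ (a + 1))) *
          ((b + 2 : ℕ) * (dz ^ (b + 1) + dw ^ (b + 1))) ∈ degreeLTSpan m := by
      have hlead : ((a + 2 : ℕ) * (dz ^ (a + 1) + dw ^ (a + 1)) : DiscRing) ∈
          degreeLTSpan (a + 1 + 1) := by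
        refine natCast_mul_mem_degreeLTSpan _ (Submodule.add_mem _ ?_ ?_)
        · simpa using monomial_mem_degreeLTSpan (a := a + 1) (b := 0) (m := a + 1 + 1) (by omega)
        · simpa using monomial_mem_degreeLTSpan (a := 0) (b := a + 1) (m := a + 1 + 1) (by omega)
      have h1 := mul_mem_degreeLTSpan (levelPoly_succ_sub_mem a) (levelPoly_mem (b + 1))
      have h2 := mul_mem_degreeLTSpan (levelPoly_succ_sub_mem b) hlead
      rw [show b + 1 + (a + 1) = a + 1 + (b + 1) by ring] at h2
      have := Submodule.add_mem _ h1 h2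
      rw [hab] at this
      convert this using 1
      ring
    have h2 := hlow _ hmem
    rw [map_sub, map_sub, hL', sub_right_inj] at h2
    rw [show ((a + 2 : ℕ) * (dz ^ (a + 1) + dw ^ (a + 1)) : DiscRing) *
          ((b + 2 : ℕ) * (dz ^ (b + 1) + dw ^ (b + 1))) = (((a + 2) * (b + 2) : ℕ) : DiscRing) *
        ((dz ^ (a + 1 + (b + 1)) * dw ^ 0 + dz ^ 0 * dw ^ (a + 1 + (b + 1))) +
          (dz ^ (a + 1) * dw ^ (b + 1) + dz ^ (b + 1) * dw ^ (a + 1))) by push_cast; ring] at h2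
    have h3 := cancel _ _ (by positivity) h2
    -- the pure power of the same degree is covered by the case of the product with level zero
    have hpure : L (dz ^ (a + 1 + (b + 1)) * dw ^ 0) =
        discIntegral (dz ^ (a + 1 + (b + 1)) * dw ^ 0) := by
      have h1 := hL' (a + 1 + b + 1) 0
      rw [levelPoly_zero, mul_one] at h1
      have h2 := hlow _ (by rw [← hab]; exact levelPoly_succ_sub_mem (a + 1 + b))
      rw [map_sub, map_sub, h1, sub_right_inj] at h2
      have h3 := cancel _ _ (by omega) h2
      have e1 := hsymm 0 (a + 1 + b + 1)
      have e2 := hsymm' 0 (a + 1 + b + 1)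
      simp only [pow_zero, one_mul, mul_one] at e1 e2 ⊢
      rw [map_add, map_add, e1, e2] at h3
      rw [← add_assoc]
      linarith
    rw [map_add, map_add, map_add, map_add, map_add, map_add, hpure, hsymm 0, hsymm' 0, hpure,
      hsymm (b + 1), hsymm' (b + 1)] at h3
    linarith

/-! ### Disc polynomials on the unit disc -/

/-- The real part of the disc polynomial `H(i,l)` at `(ζ, conj ζ)`. -/
def discVal (q : ℕ × ℕ) (ζ : ℂ) : ℝ := (discPoly ζ (starRingEnd ℂ ζ) q.1 q.2).re

theorem conj_discPoly (ζ : ℂ) (i l : ℕ) :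
    starRingEnd ℂ (discPoly ζ (starRingEnd ℂ ζ) i l) = discPoly ζ (starRingEnd ℂ ζ) l i := by
  rw [map_discPoly, Complex.conj_conj, discPoly_swap]

theorem discVal_swap (q : ℕ × ℕ) (ζ : ℂ) : discVal q.swap ζ = discVal q ζ := by
  unfold discVal
  rw [Prod.fst_swap, Prod.snd_swap, ← conj_discPoly, Complex.conj_re]

theorem discVal_add (n k : ℕ) (ζ : ℂ) :
    discVal (n + k, k) ζ = (ζ ^ n).re * radialPoly n k (‖ζ‖ ^ 2) := by
  unfold discVal
  rw [discPoly_add, Complex.mul_conj', show ((‖ζ‖ : ℂ)) ^ 2 = ((‖ζ‖ ^ 2 : ℝ) : ℂ) by push_cast; rfl]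
  have : radialPoly n k ((‖ζ‖ ^ 2 : ℝ) : ℂ) = ((radialPoly n k (‖ζ‖ ^ 2) : ℝ) : ℂ) := by
    simp [radialPoly]
  rw [this, Complex.re_mul_ofReal]

theorem continuous_discVal (q : ℕ × ℕ) : Continuous (discVal q) := by
  unfold discVal
  simp only [discPoly_eq_sum]
  fun_prop

theorem abs_chebyshevU_le {x : ℝ} (hx : |x| ≤ 1) (m : ℕ) :
    |(Polynomial.Chebyshev.U ℝ (m : ℤ)).eval x| ≤ m + 1 := by
  have hsin : ∀ (m : ℕ) (s : ℝ), |sin ((m + 1) * s)| ≤ (m + 1) * |sin s| := by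
    intro m s
    induction m with
    | zero => simp
    | succ m ih =>
      rw [show ((m + 1 : ℕ) + 1 : ℝ) * s = (m + 1) * s + s by push_cast; ring, sin_add]
      refine (abs_add_le _ _).trans ?_
      rw [abs_mul, abs_mul]
      have h1 := mul_le_mul_of_nonneg_left (abs_cos_le_one s) (abs_nonneg (sin ((m + 1) * s)))
      have h2 := mul_le_mul_of_nonneg_right (abs_cos_le_one ((m + 1) * s)) (abs_nonneg (sin s))
      push_cast
      nlinarith
  rw [abs_le] at hx
  have hcos := cos_arccos hx.1 hx.2
  rcases eq_or_ne (sin (arccos x)) 0 with h0 | h0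
  · have : x = 1 ∨ x = -1 := by
      rw [sin_arccos] at h0
      have h1 : 1 - x ^ 2 = 0 := le_antisymm (sqrt_eq_zero'.1 h0) (by nlinarith)
      have : (1 - x) * (1 + x) = 0 := by linarith
      rcases mul_eq_zero.1 this with h | h
      · left; linarith
      · right; linarith
    rcases this with rfl | rfl
    · rw [Polynomial.Chebyshev.U_eval_one, abs_le]
      constructor <;> push_cast <;> linarith [(Nat.cast_nonneg m : (0 : ℝ) ≤ m)]
    · rw [Polynomial.Chebyshev.U_eval_neg_one, abs_mul]
      have h1 : |(((m : ℤ).negOnePow : ℤ) : ℝ)| = 1 := by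
        rcases Int.units_eq_one_or (m : ℤ).negOnePow with h | h <;> rw [h] <;> simp
      rw [h1, one_mul, abs_of_nonneg (by positivity)]
      push_cast; rfl
  · have h1 := Polynomial.Chebyshev.U_real_cos (arccos x) (m : ℤ)
    rw [hcos] at h1
    have h2 := hsin m (arccos x)
    push_cast at h1
    rw [← h1, abs_mul] at h2
    exact le_of_mul_le_mul_right h2 (abs_pos.2 h0)

theorem integral_cexp_int (n : ℤ) :
    ∫ θ in (0 : ℝ)..2 * π, Complex.exp (n * Complex.I * θ) = if n = 0 then 2 * π else 0 := by
  split_ifs with h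
  · subst h; simp
  · have hn : (n : ℂ) * Complex.I ≠ 0 := mul_ne_zero (Int.cast_ne_zero.2 h) Complex.I_ne_zero
    rw [integral_exp_mul_complex hn]
    have : Complex.exp (n * Complex.I * (2 * π : ℝ)) = 1 := by
      rw [← Complex.exp_int_mul_two_pi_mul_I n]; congr 1; push_cast; ring
    rw [this]; simp

/-- On the unit disc `H(i,l)` is, up to a phase, a Fourier coefficient of the Chebyshev polynomial
`U_{i+l}(ρ cos θ)`, which gives the bound. -/
theorem norm_discPoly_le {ζ : ℂ} (hζ : ‖ζ‖ ≤ 1) (i l : ℕ) :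
    ‖discPoly ζ (starRingEnd ℂ ζ) i l‖ ≤ i + l + 1 := by
  set ρ : ℝ := ‖ζ‖ with hρ
  have hρ0 : 0 ≤ ρ := norm_nonneg _
  have polar : ∀ (θ : ℝ) (i l : ℕ), discPoly (Complex.exp (θ * Complex.I) * ρ)
      (Complex.exp (-(θ * Complex.I)) * ρ) i l =
      Complex.exp (((i : ℤ) - (l : ℤ) : ℤ) * Complex.I * θ) * discPoly (ρ : ℂ) ρ i l := by
    intro θ i l
    rw [discPoly_smul _ _ (by rw [← Complex.exp_add]; simp), ← Complex.exp_nat_mul,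
      ← Complex.exp_nat_mul, ← Complex.exp_add]
    congr 2
    push_cast; ring
  have hnorm : ‖discPoly ζ (starRingEnd ℂ ζ) i l‖ = ‖discPoly (ρ : ℂ) ρ i l‖ := by
    have h1 : ζ = Complex.exp (ζ.arg * Complex.I) * ρ := by
      rw [mul_comm]; exact (Complex.norm_mul_exp_arg_mul_I ζ).symm
    have h2 : starRingEnd ℂ ζ = Complex.exp (-(ζ.arg * Complex.I)) * ρ := by
      conv_lhs => rw [h1]
      rw [map_mul, ← Complex.exp_conj, map_mul, Complex.conj_ofReal, Complex.conj_ofReal,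
        Complex.conj_I, mul_neg]
    rw [h2]
    conv_lhs => arg 1; arg 1; rw [h1]
    rw [polar, norm_mul]
    have : ((((i : ℤ) - (l : ℤ) : ℤ) : ℂ) * Complex.I * ζ.arg) =
        ((((i : ℤ) - (l : ℤ) : ℤ) * ζ.arg : ℝ) : ℂ) * Complex.I := by push_cast; ring
    rw [this, Complex.norm_exp_ofReal_mul_I, one_mul]
  rw [hnorm]
  set m := i + l with hm
  -- the Fourier expansion of `U_m (ρ cos θ)`
  have expand : ∀ θ : ℝ, (((Polynomial.Chebyshev.U ℝ (m : ℤ)).eval (ρ * cos θ) : ℝ) : ℂ) =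
      ∑ q ∈ Finset.HasAntidiagonal.antidiagonal m,
        Complex.exp (((q.1 : ℤ) - (q.2 : ℤ) : ℤ) * Complex.I * θ) * discPoly (ρ : ℂ) ρ q.1 q.2 := by
    intro θ
    rw [Polynomial.Chebyshev.complex_ofReal_eval_U, ← sum_antidiagonal_discPoly
      (Complex.exp (θ * Complex.I) * ρ) (Complex.exp (-(θ * Complex.I)) * ρ)]
    · exact Finset.sum_congr rfl fun q _ => polar θ q.1 q.2
    · push_cast
      rw [Complex.cos]
      ring_nf
  have coeff : ∫ θ in (0 : ℝ)..2 * π, Complex.exp (((l : ℤ) - (i : ℤ) : ℤ) * Complex.I * θ) *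
      (((Polynomial.Chebyshev.U ℝ (m : ℤ)).eval (ρ * cos θ) : ℝ) : ℂ) =
      2 * π * discPoly (ρ : ℂ) ρ i l := by
    have : ∀ θ : ℝ, Complex.exp (((l : ℤ) - (i : ℤ) : ℤ) * Complex.I * θ) *
        (((Polynomial.Chebyshev.U ℝ (m : ℤ)).eval (ρ * cos θ) : ℝ) : ℂ) =
        ∑ q ∈ Finset.HasAntidiagonal.antidiagonal m,
          Complex.exp (((q.1 : ℤ) - q.2 + l - i : ℤ) * Complex.I * θ) *
            discPoly (ρ : ℂ) ρ q.1 q.2 := by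
      intro θ
      rw [expand, Finset.mul_sum]
      refine Finset.sum_congr rfl fun q _ => ?_
      rw [← mul_assoc, ← Complex.exp_add]
      congr 2; push_cast; ring
    simp_rw [this]
    rw [intervalIntegral.integral_finsetSum]
    · simp_rw [intervalIntegral.integral_mul_const, integral_cexp_int]
      rw [Finset.sum_eq_single (i, l)]
      · simp
      · intro q hq hne
        rw [Finset.HasAntidiagonal.mem_antidiagonal] at hq
        rw [if_neg, Complex.ofReal_zero, zero_mul]
        intro h
        exact hne (Prod.ext (by simp only; omega) (by simp only; omega))
      · intro h; exact absurd (Finset.HasAntidiagonal.mem_antidiagonal.2 hm.symm) h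
    · intro q _
      exact (Continuous.intervalIntegrable (by fun_prop) _ _)
  have hbound := intervalIntegral.norm_integral_le_of_norm_le_const (a := 0) (b := 2 * π)
    (C := (m : ℝ) + 1) (f := fun θ : ℝ => Complex.exp (((l : ℤ) - (i : ℤ) : ℤ) * Complex.I * θ) *
      (((Polynomial.Chebyshev.U ℝ (m : ℤ)).eval (ρ * cos θ) : ℝ) : ℂ)) (by
    intro θ _
    have : ((((l : ℤ) - (i : ℤ) : ℤ) : ℂ) * Complex.I * θ) =
        ((((l : ℤ) - (i : ℤ) : ℤ) * θ : ℝ) : ℂ) * Complex.I := by push_cast; ring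
    rw [norm_mul, this, Complex.norm_exp_ofReal_mul_I, one_mul, Complex.norm_real, norm_eq_abs]
    refine abs_chebyshevU_le ?_ m
    rw [abs_mul, abs_of_nonneg hρ0]
    exact mul_le_one₀ hζ (abs_nonneg _) (abs_cos_le_one θ))
  rw [coeff, norm_mul, sub_zero, abs_of_pos (by positivity)] at hbound
  have h2 : ‖(2 * π : ℂ)‖ = 2 * π := by
    rw [show (2 * π : ℂ) = ((2 * π : ℝ) : ℂ) by push_cast; rfl, Complex.norm_real,
      norm_eq_abs, abs_of_pos (by positivity)]
  rw [h2, mul_comm] at hbound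
  have := le_of_mul_le_mul_right hbound (by positivity : (0 : ℝ) < 2 * π)
  rw [hm] at this
  push_cast at this
  exact this

theorem abs_discVal_le {ζ : ℂ} (hζ : ‖ζ‖ ≤ 1) (q : ℕ × ℕ) : |discVal q ζ| ≤ q.1 + q.2 + 1 :=
  (Complex.abs_re_le_norm _).trans (norm_discPoly_le hζ _ _)

/-! ### Series of disc polynomials -/

/-- Weights for which the series of disc polynomials converges uniformly on the unit disc. -/
def IsDiscWeight (c : ℕ × ℕ → ℝ) : Prop := Summable fun q => |c q| * (q.1 + q.2 + 1)

/-- The sum of a series of disc polynomials. -/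
def discSum (c : ℕ × ℕ → ℝ) (ζ : ℂ) : ℝ := ∑' q, c q * discVal q ζ

theorem norm_mul_discVal_le (c : ℕ × ℕ → ℝ) {ζ : ℂ} (hζ : ‖ζ‖ ≤ 1) (q : ℕ × ℕ) :
    ‖c q * discVal q ζ‖ ≤ |c q| * (q.1 + q.2 + 1) := by
  rw [norm_mul, norm_eq_abs, norm_eq_abs]
  exact mul_le_mul_of_nonneg_left (abs_discVal_le hζ q) (abs_nonneg _)

theorem IsDiscWeight.hasSum {c : ℕ × ℕ → ℝ} (hc : IsDiscWeight c) {ζ : ℂ} (hζ : ‖ζ‖ ≤ 1) :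
    HasSum (fun q => c q * discVal q ζ) (discSum c ζ) :=
  (Summable.of_norm_bounded hc (norm_mul_discVal_le c hζ)).hasSum

theorem IsDiscWeight.abs_discSum_le {c : ℕ × ℕ → ℝ} (hc : IsDiscWeight c) {ζ : ℂ} (hζ : ‖ζ‖ ≤ 1) :
    |discSum c ζ| ≤ ∑' q : ℕ × ℕ, |c q| * (q.1 + q.2 + 1) :=
  tsum_of_norm_bounded (Summable.hasSum hc) (norm_mul_discVal_le c hζ)

theorem measurable_discSum (c : ℕ × ℕ → ℝ) : Measurable (discSum c) := by
  unfold discSum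
  exact Measurable.tsum fun q => ((continuous_discVal q).measurable.const_mul _)

theorem summable_disc_geometric {v : ℝ} (h0 : 0 < v) (h1 : v < 1) :
    Summable fun q : ℕ × ℕ => ((q.1 + q.2 + 1 : ℝ) * v ^ (q.1 + q.2)) * (q.1 + q.2 + 1) := by
  have h := summable_pow_mul_geometric_of_norm_lt_one 2
    (r := v) (by rwa [norm_eq_abs, abs_of_pos h0])
  have h' : Summable fun n : ℕ => ((n : ℝ) + 1) ^ 2 * v ^ n := by
    have := ((summable_nat_add_iff 1).2 h).mul_left v⁻¹
    refine this.congr fun n => ?_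
    push_cast
    field_simp
    ring
  have hs := h'.mul_of_nonneg h' (fun _ => by positivity) (fun _ => by positivity)
  refine Summable.of_nonneg_of_le (fun q => by positivity) (fun q => ?_) hs
  have h3 : (q.1 + q.2 + 1 : ℝ) ≤ (q.1 + 1) * (q.2 + 1) := by
    have := mul_nonneg (q.1.cast_nonneg (α := ℝ)) (q.2.cast_nonneg (α := ℝ))
    nlinarith
  have h4 : (q.1 + q.2 + 1 : ℝ) ^ 2 ≤ ((q.1 + 1) * (q.2 + 1)) ^ 2 :=
    pow_le_pow_left₀ (by positivity) h3 2
  have h5 : (0 : ℝ) ≤ v ^ (q.1 + q.2) := by positivity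
  calc ((q.1 + q.2 + 1 : ℝ) * v ^ (q.1 + q.2)) * (q.1 + q.2 + 1)
      = (q.1 + q.2 + 1 : ℝ) ^ 2 * v ^ (q.1 + q.2) := by ring
    _ ≤ ((q.1 + 1) * (q.2 + 1)) ^ 2 * v ^ (q.1 + q.2) := mul_le_mul_of_nonneg_right h4 h5
    _ = _ := by rw [pow_add]; ring

/-- The weights of the sub-Riemannian kernel. -/
def pWeight (t : ℝ) (q : ℕ × ℕ) : ℝ := (q.1 + q.2 + 1) * exp (-2 * t) ^ discLevel q

/-- The weights of the Riemannian kernel of the three-sphere. -/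
def qWeight (t : ℝ) (q : ℕ × ℕ) : ℝ :=
  (q.1 + q.2 + 1) * exp (-((q.1 + q.2 : ℕ) * ((q.1 + q.2 : ℕ) + 2)) * t)

theorem IsDiscWeight.of_le {c : ℕ × ℕ → ℝ} {t : ℝ} (ht : 0 < t)
    (h : ∀ q, |c q| ≤ (q.1 + q.2 + 1) * exp (-2 * t) ^ (q.1 + q.2)) : IsDiscWeight c := by
  refine Summable.of_nonneg_of_le (fun q => by positivity) (fun q => ?_)
    (summable_disc_geometric (exp_pos (-2 * t)) (exp_lt_one_iff.2 (by linarith)))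
  exact mul_le_mul_of_nonneg_right (h q) (by positivity)

theorem isDiscWeight_pWeight {t : ℝ} (ht : 0 < t) : IsDiscWeight (pWeight t) := by
  refine .of_le ht fun q => ?_
  rw [pWeight, abs_of_pos (by positivity)]
  refine mul_le_mul_of_nonneg_left ?_ (by positivity)
  refine pow_le_pow_of_le_one (exp_pos _).le (exp_lt_one_iff.2 (by linarith)).le ?_
  rw [discLevel]; exact Nat.le_add_right _ _

theorem isDiscWeight_qWeight {t : ℝ} (ht : 0 < t) : IsDiscWeight (qWeight t) := by
  refine .of_le ht fun q => ?_
  rw [qWeight, abs_of_pos (by positivity)]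
  refine mul_le_mul_of_nonneg_left ?_ (by positivity)
  rw [← exp_nat_mul, exp_le_exp]
  have : (0 : ℝ) ≤ (q.1 + q.2 : ℕ) := Nat.cast_nonneg _
  nlinarith [mul_nonneg (mul_nonneg this this) ht.le]

/-! ### The sub-Riemannian kernel as a series of disc polynomials -/

/-- The binomial expansion of `1 - y = 2 - (1 + y)` turns Rodrigues' formula into powers of
`1 + y`. -/
theorem iteratedDeriv_jacobi (n k : ℕ) (x : ℝ) :
    iteratedDeriv k (fun y : ℝ => (1 + y) ^ n * (1 - y ^ 2) ^ k) x =
      ∑ s ∈ Finset.range (k + 1),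
        (-1) ^ (k - s) * (k.choose s * (n + 2 * k - s).descFactorial k : ℕ) * 2 ^ s *
          (1 + x) ^ (n + k - s) := by
  have h1 : (fun y : ℝ => (1 + y) ^ n * (1 - y ^ 2) ^ k) =
      fun y => ∑ s ∈ Finset.range (k + 1),
        ((-1) ^ (k - s) * (k.choose s : ℝ) * 2 ^ s) * (1 + y) ^ (n + 2 * k - s) := by
    funext y
    rw [show (1 - y ^ 2) = (1 + y) * (2 + -(1 + y)) by ring, mul_pow, add_pow 2 (-(1 + y)),
      Finset.mul_sum, Finset.mul_sum]
    refine Finset.sum_congr rfl fun s hs => ?_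
    rw [Finset.mem_range] at hs
    rw [show n + 2 * k - s = n + k + (k - s) by omega, pow_add, pow_add, neg_pow (1 + y)]
    ring
  rw [h1, iteratedDeriv_fun_sum]
  · refine Finset.sum_congr rfl fun s hs => ?_
    rw [Finset.mem_range] at hs
    rw [iteratedDeriv_const_mul_field]
    have := congrFun (iteratedDeriv_comp_const_add k (fun y : ℝ => y ^ (n + 2 * k - s)) 1) x
    rw [this, iteratedDeriv_pow, show n + 2 * k - s - k = n + k - s by omega]
    push_cast
    ring
  · intro s _
    fun_prop

/-- At `b = 0` the quotient by `(2 b) ^ n` in Rodrigues' formula has the value `0`, whence the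
hypothesis. -/
theorem jacobi_eq_radialPoly (n k : ℕ) {b : ℝ} (h : b ≠ 0 ∨ n = 0) :
    jacobi n k (2 * b - 1) = radialPoly n k b := by
  have hb : (b : ℝ) ^ n ≠ 0 := by
    rcases h with h | h
    · exact pow_ne_zero _ h
    · rw [h, pow_zero]; exact one_ne_zero
  rw [jacobi, iteratedDeriv_jacobi, radialPoly, Finset.mul_sum]
  refine Finset.sum_congr rfl fun s hs => ?_
  rw [Finset.mem_range] at hs
  rw [show (1 + (2 * b - 1)) = 2 * b by ring, show n + k - s = n + (k - s) by omega,
    Nat.descFactorial_eq_factorial_mul_choose, mul_pow, mul_pow, pow_add, pow_add]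
  have hf : (k ! : ℝ) ≠ 0 := by positivity
  have h2 : (2 : ℝ) ^ k = 2 ^ (k - s) * 2 ^ s := by rw [← pow_add]; congr 1; omega
  have h3 : (-1 : ℝ) ^ k * (-1) ^ (k - s) = (-1) ^ s := by
    have h4 : (-1 : ℝ) ^ k = (-1) ^ (k - s) * (-1) ^ s := by rw [← pow_add]; congr 1; omega
    have h5 : (-1 : ℝ) ^ (k - s) * (-1) ^ (k - s) = 1 := by rw [← mul_pow]; simp
    rw [h4]; linear_combination (-1 : ℝ) ^ s * h5
  rw [h2, ← h3]
  push_cast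
  field_simp

theorem cos_pow_mul_jacobi (n k : ℕ) (r : ℝ) :
    cos r ^ n * jacobi n k (cos (2 * r)) = cos r ^ n * radialPoly n k (cos r ^ 2) := by
  rcases eq_or_ne n 0 with rfl | hn
  · rw [cos_two_mul, jacobi_eq_radialPoly 0 k (.inr rfl)]
  rcases eq_or_ne (cos r) 0 with h | h
  · rw [h, zero_pow hn, zero_mul, zero_mul]
  · rw [cos_two_mul, jacobi_eq_radialPoly n k (.inl (pow_ne_zero 2 h))]

/-- The pairs `(n, k)` of a frequency `n ∈ ℤ` and a radial index `k` correspond to the indices of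
the disc polynomials. -/
def discIndexEquiv : ℤ × ℕ ≃ ℕ × ℕ where
  toFun p := (p.1.toNat + p.2, (-p.1).toNat + p.2)
  invFun q := ((q.1 : ℤ) - q.2, min q.1 q.2)
  left_inv p := by
    rcases p with ⟨n, k⟩
    ext <;> simp only <;> omega
  right_inv q := by
    rcases q with ⟨i, l⟩
    ext <;> simp only <;> omega

theorem norm_cos_mul_cexp (r θ : ℝ) : ‖(cos r : ℂ) * Complex.exp (θ * Complex.I)‖ = |cos r| := by
  rw [norm_mul, Complex.norm_exp_ofReal_mul_I, mul_one, Complex.norm_real,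
    norm_eq_abs]

theorem subRiemannianKernel_eq_discSum {t : ℝ} (ht : 0 < t) (r θ : ℝ) :
    subRiemannianKernel t r θ =
      discSum (pWeight t) ((cos r : ℂ) * Complex.exp (θ * Complex.I)) := by
  set ζ : ℂ := (cos r : ℂ) * Complex.exp (θ * Complex.I) with hζ
  have hζ1 : ‖ζ‖ ≤ 1 := by rw [norm_cos_mul_cexp]; exact abs_cos_le_one r
  have hconj : starRingEnd ℂ ζ = Complex.exp (-(θ * Complex.I)) * (cos r : ℂ) := by
    rw [hζ, map_mul, Complex.conj_ofReal, ← Complex.exp_conj, map_mul,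
      Complex.conj_ofReal, Complex.conj_I, mul_neg, mul_comm]
  set F : ℕ × ℕ → ℂ := fun q => (pWeight t q : ℂ) * discPoly ζ (starRingEnd ℂ ζ) q.1 q.2 with hF
  have hFs : Summable F := by
    refine Summable.of_norm_bounded (isDiscWeight_pWeight ht) fun q => ?_
    rw [hF, norm_mul, Complex.norm_real, norm_eq_abs]
    exact mul_le_mul_of_nonneg_left (norm_discPoly_le hζ1 _ _) (abs_nonneg _)
  have hpolar : ∀ i l : ℕ, discPoly ζ (starRingEnd ℂ ζ) i l =
      Complex.exp (((i : ℤ) - (l : ℤ) : ℤ) * Complex.I * θ) *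
        discPoly (cos r : ℂ) (cos r : ℂ) i l := by
    intro i l
    rw [hconj, hζ, mul_comm ((cos r : ℂ)), discPoly_smul _ _ (by rw [← Complex.exp_add]; simp),
      ← Complex.exp_nat_mul, ← Complex.exp_nat_mul, ← Complex.exp_add]
    congr 2
    push_cast; ring
  have hrad : ∀ n k : ℕ, discPoly (cos r : ℂ) (cos r : ℂ) (n + k) k =
      ((cos r ^ n * jacobi n k (cos (2 * r)) : ℝ) : ℂ) := by
    intro n k
    rw [discPoly_add, cos_pow_mul_jacobi]
    simp [radialPoly]
    left
    refine Finset.sum_congr rfl fun s _ => ?_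
    ring
  have hterm : ∀ (n : ℤ) (k : ℕ),
    ((((2 * k + n.natAbs + 1) * exp (-(4 * k * (k + n.natAbs + 1) + 2 * n.natAbs) * t) : ℝ) : ℂ) *
      Complex.exp (Complex.I * n * θ) *
      ((cos r ^ n.natAbs * jacobi n.natAbs k (cos (2 * r)) : ℝ) : ℂ)) =
      F (discIndexEquiv (n, k)) := by
    intro n k
    rw [hF]
    simp only [discIndexEquiv, Equiv.coe_fn_mk, pWeight]
    rw [hpolar, ← hrad]
    rcases Int.eq_nat_or_neg n with ⟨m, rfl | rfl⟩
    · simp only [Int.toNat_natCast, Int.natAbs_natCast, Int.toNat_neg_natCast, zero_add, discLevel]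
      rw [← mul_assoc, ← exp_nat_mul]
      congr 1
      congr 1
      · congr 1
        push_cast
        congr 1
        · ring
        · congr 1; ring
      · congr 1; push_cast; ring
    · simp only [neg_neg, Int.toNat_natCast, Int.natAbs_neg, Int.natAbs_natCast,
        Int.toNat_neg_natCast, zero_add, discLevel]
      rw [← mul_assoc, ← exp_nat_mul, discPoly_swap _ _ k]
      congr 1
      congr 1
      · congr 1
        push_cast
        congr 1
        · ring
        · congr 1; ring
      · congr 1; push_cast; ring
  unfold subRiemannianKernel
  simp_rw [hterm]
  have hFe : Summable fun p : ℤ × ℕ => F (discIndexEquiv p) := discIndexEquiv.summable_iff.2 hFs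
  rw [← hFe.tsum_prod (f := fun p : ℤ × ℕ => F (discIndexEquiv p)), discIndexEquiv.tsum_eq F,
    Complex.re_tsum hFs]
  refine tsum_congr fun q => ?_
  rw [hF, Complex.re_ofReal_mul, discVal]

/-! ### The Riemannian kernel as a series of disc polynomials -/

/-- The heat kernel of the three-sphere, as a series of Chebyshev polynomials. -/
def chebyshevSum (t x : ℝ) : ℝ :=
  ∑' m : ℕ, (m + 1) * exp (-(m * (m + 2)) * t) * (Polynomial.Chebyshev.U ℝ (m : ℤ)).eval x

theorem summable_chebyshev {t : ℝ} (ht : 0 < t) :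
    Summable fun m : ℕ => ((m : ℝ) + 1) * exp (-(m * (m + 2)) * t) * (m + 1) := by
  have h := (isDiscWeight_qWeight ht).comp_injective
    (i := fun m : ℕ => (m, 0)) (fun a b h => (Prod.mk.inj h).1)
  refine h.congr fun m => ?_
  simp only [Function.comp_apply, qWeight, Nat.cast_zero, add_zero]
  rw [abs_of_nonneg (by positivity)]

theorem norm_chebyshev_le (t : ℝ) {x : ℝ} (hx : |x| ≤ 1) (m : ℕ) :
    ‖((m : ℝ) + 1) * exp (-(m * (m + 2)) * t) * (Polynomial.Chebyshev.U ℝ (m : ℤ)).eval x‖ ≤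
      ((m : ℝ) + 1) * exp (-(m * (m + 2)) * t) * (m + 1) := by
  rw [norm_mul, norm_eq_abs, norm_eq_abs, abs_of_nonneg (by positivity)]
  exact mul_le_mul_of_nonneg_left (abs_chebyshevU_le hx m) (by positivity)

theorem continuousOn_chebyshevSum {t : ℝ} (ht : 0 < t) :
    ContinuousOn (chebyshevSum t) (Set.Icc (-1) 1) := by
  refine continuousOn_tsum (fun m => ?_) (summable_chebyshev ht)
    (fun m x hx => norm_chebyshev_le t (abs_le.2 hx) m)
  exact (continuous_const.mul (Polynomial.continuous _)).continuousOn

/-- Poisson summation, in the form of the functional equation that relates the odd theta kernel to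
the sine kernel. -/
theorem qFormula_eq_chebyshevSum {t x : ℝ} (ht : 0 < t) (hx : x ∈ Set.Ioo (-1 : ℝ) 1) :
    qFormula t x = chebyshevSum t x := by
  set a := arccos x with ha
  have hcos : cos a = x := cos_arccos hx.1.le hx.2.le
  have hsin : √(1 - x ^ 2) = sin a := (sin_arccos x).symm
  have hpos : 0 < sin a := by
    rw [← hsin]; exact sqrt_pos.2 (by nlinarith [hx.1, hx.2])
  have hX : 0 < π / t := by positivity
  have h1 := HurwitzZeta.hasSum_int_oddKernel (a / (2 * π)) hX
  have h2 := HurwitzZeta.hasSum_nat_sinKernel (a / (2 * π)) (t := t / π) (by positivity)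
  have h3 := HurwitzZeta.oddKernel_functional_equation (a / (2 * π) : ℝ) (π / t)
  rw [one_div_div] at h3
  -- the left-hand side, in terms of the odd theta kernel
  have e1 : ∑' k : ℤ, (a + 2 * k * π) * exp (-(a + 2 * k * π) ^ 2 / (4 * t)) =
      2 * π * HurwitzZeta.oddKernel (a / (2 * π) : ℝ) (π / t) := by
    rw [← h1.tsum_eq, ← tsum_mul_left]
    refine tsum_congr fun k => ?_
    rw [← mul_assoc]
    congr 1
    · field_simp; ring
    · congr 1; field_simp; ring
  -- the right-hand side, in terms of the sine kernel
  have e2 : chebyshevSum t x * sin a =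
      exp t / 2 * HurwitzZeta.sinKernel (a / (2 * π) : ℝ) (t / π) := by
    rw [← h2.tsum_eq, h2.summable.tsum_eq_zero_add, chebyshevSum, ← tsum_mul_right]
    simp only [Nat.cast_zero, mul_zero, zero_mul, zero_add]
    rw [← tsum_mul_left]
    refine tsum_congr fun m => ?_
    have hU := Polynomial.Chebyshev.U_real_cos a (m : ℤ)
    rw [hcos] at hU
    push_cast at hU
    rw [mul_assoc, hU]
    have : exp (-(m * (m + 2)) * t) = exp t * exp (-π * ((m + 1 : ℕ) : ℝ) ^ 2 * (t / π)) := by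
      rw [← exp_add]; congr 1; push_cast; field_simp; ring
    rw [this]
    have : 2 * π * (a / (2 * π)) * ((m + 1 : ℕ) : ℝ) = (m + 1) * a := by push_cast; field_simp
    rw [this]
    push_cast
    ring
  have hpow : (π / t) ^ (3 / 2 : ℝ) = π * √π / t ^ (3 / 2 : ℝ) := by
    rw [div_rpow pi_pos.le ht.le, show (3 / 2 : ℝ) = 1 + 1 / 2 by norm_num,
      rpow_add pi_pos, rpow_one, ← sqrt_eq_rpow]
  have ht' : t ^ (3 / 2 : ℝ) ≠ 0 := (rpow_pos_of_pos ht _).ne'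
  have hpi : √π ≠ 0 := (sqrt_pos.2 pi_pos).ne'
  have hsq : √π * √π = π := mul_self_sqrt pi_pos.le
  rw [← mul_left_inj' hpos.ne', e2, qFormula, ← ha, hsin, e1, h3, hpow]
  field_simp
  ring

theorem qFunction_eq_chebyshevSum {t x : ℝ} (ht : 0 < t) (hx : |x| ≤ 1) :
    qFunction t x = chebyshevSum t x := by
  have hx' := abs_le.1 hx
  have hcl : closure (Set.Ioo (-1 : ℝ) 1) = Set.Icc (-1) 1 := closure_Ioo (by norm_num)
  refine extendFrom_eq (by rw [hcl]; exact hx') ?_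
  refine Tendsto.congr' ?_ (((continuousOn_chebyshevSum ht) x hx').mono Set.Ioo_subset_Icc_self)
  filter_upwards [self_mem_nhdsWithin] with y hy
  exact (qFormula_eq_chebyshevSum ht hy).symm

/-- By the addition theorem the heat kernel of the three-sphere at `Re ζ` is a series of disc
polynomials at `ζ`. -/
theorem chebyshevSum_re {t : ℝ} (ht : 0 < t) {ζ : ℂ} (hζ : ‖ζ‖ ≤ 1) :
    chebyshevSum t ζ.re = discSum (qWeight t) ζ := by
  have h := ((Finset.HasAntidiagonal.sigmaAntidiagonalEquivProd (A := ℕ)).hasSum_iff.2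
    ((isDiscWeight_qWeight ht).hasSum hζ)).sigma fun m => (hasSum_fintype _)
  rw [← h.tsum_eq]
  refine tsum_congr fun m => ?_
  refine Eq.trans ?_ (Finset.sum_coe_sort (Finset.HasAntidiagonal.antidiagonal m)
    (fun q => qWeight t q * discVal q ζ)).symm
  have h1 : ∀ q ∈ Finset.HasAntidiagonal.antidiagonal m, qWeight t q * discVal q ζ =
      (m + 1) * exp (-(m * (m + 2)) * t) * discVal q ζ := by
    intro q hq
    rw [Finset.HasAntidiagonal.mem_antidiagonal] at hq
    rw [qWeight, hq, ← Nat.cast_add, hq]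
  rw [Finset.sum_congr rfl h1, ← Finset.mul_sum]
  congr 1
  have h2 := congrArg Complex.re (sum_antidiagonal_discPoly ζ (starRingEnd ℂ ζ) (ζ.re : ℂ)
    (by rw [Complex.add_conj]; push_cast; ring) m)
  rw [Complex.re_sum, ← Polynomial.Chebyshev.complex_ofReal_eval_U, Complex.ofReal_re] at h2
  exact h2.symm

/-! ### Grouping by levels, and uniqueness of the coefficients -/

theorem hasSum_levelSet {f : ℕ × ℕ → ℝ} {a : ℝ} (h : HasSum f a) :
    HasSum (fun j => ∑ q ∈ levelSet j, f q) a := by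
  refine ((Equiv.sigmaFiberEquiv discLevel).hasSum_iff.2 h).sigma fun j => ?_
  have e : {q // discLevel q = j} ≃ {q // q ∈ levelSet j} :=
    Equiv.subtypeEquivRight fun q => mem_levelSet.symm
  have := (levelSet j).hasSum f
  exact (Equiv.subtypeEquivRight fun q : ℕ × ℕ =>
    (mem_levelSet (j := j) (q := q)).symm).hasSum_iff.2 this

/-- The value of `levelPoly j` at `(ζ, conj ζ)`, which is real. -/
def levelVal (j : ℕ) (ζ : ℂ) : ℝ := ∑ q ∈ levelSet j, (q.1 + q.2 + 1) * discVal q ζ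

/-- A bound for `levelVal j` on the unit disc. -/
def levelBound (j : ℕ) : ℝ := ∑ q ∈ levelSet j, ((q.1 : ℝ) + q.2 + 1) * (q.1 + q.2 + 1)

theorem continuous_levelVal (j : ℕ) : Continuous (levelVal j) := by
  unfold levelVal
  have := continuous_discVal
  fun_prop

theorem levelVal_zero (ζ : ℂ) : levelVal 0 ζ = 1 := by
  have : levelSet 0 = {(0, 0)} := by decide
  simp [levelVal, this, discVal]

theorem levelBound_zero : levelBound 0 = 1 := by
  have : levelSet 0 = {(0, 0)} := by decide
  simp [levelBound, this]

theorem levelVal_one (ζ : ℂ) : levelVal 1 ζ = 4 * ζ.re := by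
  have : levelSet 1 = {(1, 0), (0, 1)} := by decide
  simp [levelVal, this, discVal]
  ring

theorem levelVal_two (ζ : ℂ) : levelVal 2 ζ = 6 * (2 * ζ.re ^ 2 - ‖ζ‖ ^ 2) := by
  have : levelSet 2 = {(2, 0), (0, 2)} := by decide
  rw [Complex.sq_norm, Complex.normSq_apply]
  simp [levelVal, this, discVal, pow_two]
  ring

theorem abs_levelVal_le {ζ : ℂ} (hζ : ‖ζ‖ ≤ 1) (j : ℕ) : |levelVal j ζ| ≤ levelBound j := by
  refine (Finset.abs_sum_le_sum_abs _ _).trans (Finset.sum_le_sum fun q _ => ?_)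
  rw [abs_mul, abs_of_nonneg (by positivity : (0 : ℝ) ≤ q.1 + q.2 + 1)]
  exact mul_le_mul_of_nonneg_left (abs_discVal_le hζ q) (by positivity)

theorem levelPoly_eq_ofReal (j : ℕ) (ζ : ℂ) :
    levelPoly ζ (starRingEnd ℂ ζ) j = (levelVal j ζ : ℂ) := by
  have h : starRingEnd ℂ (levelPoly ζ (starRingEnd ℂ ζ) j) = levelPoly ζ (starRingEnd ℂ ζ) j := by
    rw [map_levelPoly, Complex.conj_conj, levelPoly_swap]
  rw [← Complex.conj_eq_iff_re.1 h, levelPoly, levelVal, Complex.re_sum]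
  congr 1
  refine Finset.sum_congr rfl fun q _ => ?_
  rw [← Complex.ofReal_natCast, Complex.re_ofReal_mul, discVal]
  push_cast; rfl

theorem levelVal_at_one (j : ℕ) : levelVal j 1 = ∑ q ∈ levelSet j, (q.1 + q.2 + 1 : ℝ) := by
  simp [levelVal, discVal, discPoly_one_one]

theorem hasSum_levelVal {t : ℝ} (ht : 0 < t) {ζ : ℂ} (hζ : ‖ζ‖ ≤ 1) :
    HasSum (fun j => exp (-2 * t) ^ j * levelVal j ζ) (discSum (pWeight t) ζ) := by
  have := hasSum_levelSet ((isDiscWeight_pWeight ht).hasSum hζ)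
  refine this.congr_fun fun j => ?_
  rw [levelVal, Finset.mul_sum]
  refine Finset.sum_congr rfl fun q hq => ?_
  rw [mem_levelSet] at hq
  rw [pWeight, hq]; ring

theorem summable_levelBound {t : ℝ} (ht : 0 < t) :
    Summable fun j => exp (-2 * t) ^ j * levelBound j := by
  have := (hasSum_levelSet (Summable.hasSum (isDiscWeight_pWeight ht))).summable
  refine this.congr fun j => ?_
  rw [levelBound, Finset.mul_sum]
  refine Finset.sum_congr rfl fun q hq => ?_
  rw [mem_levelSet] at hq
  rw [pWeight, hq, abs_of_nonneg (by positivity)]; ring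

/-- The coefficient of `v ^ J` is the limit, as `v → 0⁺`, of the normalized remainder of the power
series. -/
theorem tendsto_powerSeries_coeff {a : ℕ → ℝ} {w : ℝ} (hw : 0 < w)
    (hs : Summable fun j => w ^ j * a j) (J : ℕ) :
    Tendsto (fun v => ((∑' j, v ^ j * a j) - ∑ j ∈ Finset.range J, v ^ j * a j) / v ^ J)
      (𝓝[>] 0) (𝓝 (a J)) := by
  have hsJ : Summable fun j => w ^ j * |a (j + J)| := by
    have := ((summable_nat_add_iff J).2 hs.abs).mul_left (w ^ J)⁻¹
    refine this.congr fun j => ?_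
    rw [abs_mul, abs_of_pos (by positivity), pow_add]
    field_simp
  have hcont : ContinuousOn (fun v : ℝ => ∑' j, v ^ j * a (j + J)) (Set.Icc 0 w) := by
    refine continuousOn_tsum (fun j => by fun_prop) hsJ fun j v hv => ?_
    rw [norm_mul, norm_eq_abs, norm_eq_abs, abs_of_nonneg (pow_nonneg hv.1 _)]
    exact mul_le_mul_of_nonneg_right (pow_le_pow_left₀ hv.1 hv.2 j) (abs_nonneg _)
  have h0 := (hcont 0 ⟨le_rfl, hw.le⟩).mono_left
    (nhdsWithin_mono 0 (Set.Ioc_subset_Icc_self (a := 0) (b := w)))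
  have hval : (∑' j, (0 : ℝ) ^ j * a (j + J)) = a J := by
    rw [tsum_eq_single 0 fun j hj => by rw [zero_pow hj, zero_mul]]
    simp
  simp only [hval] at h0
  rw [nhdsWithin_Ioc_eq_nhdsGT hw] at h0
  refine h0.congr' ?_
  filter_upwards [Ioc_mem_nhdsGT hw] with v hv
  have hv0 : v ^ J ≠ 0 := (pow_pos hv.1 J).ne'
  have hsv : Summable fun j => v ^ j * a j := by
    refine Summable.of_norm_bounded hs.abs fun j => ?_
    rw [norm_mul, abs_mul, norm_eq_abs, norm_eq_abs, abs_of_pos (pow_pos hv.1 j),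
      abs_of_pos (pow_pos hw j)]
    exact mul_le_mul_of_nonneg_right (pow_le_pow_left₀ hv.1.le hv.2 j) (abs_nonneg _)
  rw [← hsv.sum_add_tsum_nat_add J, add_sub_cancel_left, eq_div_iff hv0, ← tsum_mul_right]
  refine tsum_congr fun j => ?_
  rw [pow_add]; ring

theorem tendsto_exp_neg_two_mul :
    Tendsto (fun n : ℕ => exp (-2 * ((n : ℝ) + 1))) atTop (𝓝[>] 0) := by
  refine tendsto_nhdsWithin_iff.2 ⟨tendsto_exp_atBot.comp ?_,
    Eventually.of_forall fun n => exp_pos _⟩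
  refine (tendsto_natCast_atTop_atTop.atTop_add tendsto_const_nhds).const_mul_atTop_of_neg
    (by norm_num)

/-- A Dirichlet series in `e^{-2t}` determines its coefficients. -/
theorem coeff_unique {a b : ℕ → ℝ}
    (ha : ∀ t > 0, Summable fun j => exp (-2 * t) ^ j * a j)
    (hb : ∀ t > 0, Summable fun j => exp (-2 * t) ^ j * b j)
    (h : ∀ t > 0, ∑' j, exp (-2 * t) ^ j * a j = ∑' j, exp (-2 * t) ^ j * b j) (j : ℕ) :
    a j = b j := by
  induction j using Nat.strong_induction_on with
  | _ J ih =>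
  have h1 := (tendsto_powerSeries_coeff (exp_pos _) (ha 1 one_pos) J).comp tendsto_exp_neg_two_mul
  have h2 := (tendsto_powerSeries_coeff (exp_pos _) (hb 1 one_pos) J).comp tendsto_exp_neg_two_mul
  refine tendsto_nhds_unique (h1.congr fun n => ?_) h2
  simp only [Function.comp_apply]
  rw [h _ (by positivity), Finset.sum_congr rfl fun i hi => by rw [ih i (Finset.mem_range.1 hi)]]

/-- A series of functions with a summable uniform bound is integrated term by term against a finite
measure. -/
theorem hasSum_integral_of_bounded {X ι : Type*} [MeasurableSpace X] [Countable ι] {ν : Measure X}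
    [IsFiniteMeasure ν] {F : ι → X → ℝ} {G : X → ℝ} {b : ι → ℝ}
    (hm : ∀ i, AEStronglyMeasurable (F i) ν) (hb : Summable b) (hF : ∀ i x, ‖F i x‖ ≤ b i)
    (hG : ∀ x, HasSum (fun i => F i x) (G x)) : HasSum (fun i => ∫ x, F i x ∂ν) (∫ x, G x ∂ν) :=
  hasSum_integral_of_dominated_convergence (fun i _ => b i) hm
    (fun i => Eventually.of_forall (hF i)) (Eventually.of_forall fun _ => hb)
    (integrable_const _) (Eventually.of_forall hG)

theorem hasSum_integral_levelVal {X : Type*} [MeasurableSpace X]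
    {ν : Measure X} [IsFiniteMeasure ν] {f : X → ℂ} (hf : Measurable f) (hf1 : ∀ x, ‖f x‖ ≤ 1)
    {g : X → ℝ} (hg : Measurable g) {C : ℝ} (hC : ∀ x, |g x| ≤ C) {t : ℝ} (ht : 0 < t) :
    HasSum (fun j => exp (-2 * t) ^ j * ∫ x, g x * levelVal j (f x) ∂ν)
      (∫ x, g x * discSum (pWeight t) (f x) ∂ν) := by
  have := hasSum_integral_of_bounded (ν := ν)
    (F := fun j x => exp (-2 * t) ^ j * (g x * levelVal j (f x)))
    (G := fun x => g x * discSum (pWeight t) (f x))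
    (b := fun j => C * (exp (-2 * t) ^ j * levelBound j))
    (fun j => ((hg.mul
      ((continuous_levelVal j).measurable.comp hf)).const_mul _).aestronglyMeasurable)
    ((summable_levelBound ht).mul_left C) (fun j x => ?_) (fun x => ?_)
  · simpa only [integral_const_mul] using this
  · rw [norm_mul, norm_mul, norm_eq_abs, norm_eq_abs, norm_eq_abs, abs_of_pos (by positivity)]
    have h1 := mul_le_mul (hC x) (abs_levelVal_le (hf1 x) j) (abs_nonneg _)
      ((abs_nonneg _).trans (hC x))
    have h2 := mul_le_mul_of_nonneg_left h1 (by positivity : 0 ≤ exp (-2 * t) ^ j)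
    linarith
  · have := (hasSum_levelVal ht (hf1 x)).mul_left (g x)
    refine this.congr_fun fun j => ?_
    ring

/-! ### The complex coordinate of a pair of points -/

section Zeta

variable {M : Type*} [SemimetricPair M]

/-- The point `cos r * e^{iθ}` of the upper half of the unit disc. -/
def zeta (x y : M) : ℂ :=
  (cos (SemimetricPair.r x y) : ℂ) * Complex.exp (SemimetricPair.theta x y * Complex.I)

theorem cos_r_nonneg (x y : M) : 0 ≤ cos (SemimetricPair.r x y) :=
  cos_nonneg_of_mem_Icc ⟨by linarith [SemimetricPair.r_nonneg x y, pi_pos],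
    SemimetricPair.r_le x y⟩

theorem norm_zeta (x y : M) : ‖zeta x y‖ = cos (SemimetricPair.r x y) := by
  rw [zeta, norm_cos_mul_cexp, abs_of_nonneg (cos_r_nonneg x y)]

theorem norm_zeta_le (x y : M) : ‖zeta x y‖ ≤ 1 := by
  rw [norm_zeta]; exact cos_le_one _

theorem zeta_comm (x y : M) : zeta x y = zeta y x := by
  rw [zeta, zeta, SemimetricPair.r_comm, SemimetricPair.theta_comm]

theorem zeta_self (x : M) : zeta x x = 1 := by
  rw [zeta, SemimetricPair.r_self, SemimetricPair.theta_self]; simp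

theorem zeta_pow_re (x y : M) (n : ℕ) : (zeta x y ^ n).re =
    cos (SemimetricPair.r x y) ^ n * cos (n * SemimetricPair.theta x y) := by
  rw [zeta, mul_pow, ← Complex.exp_nat_mul, ← Complex.ofReal_pow, Complex.re_ofReal_mul,
    show (n : ℂ) * (SemimetricPair.theta x y * Complex.I) =
      ((n * SemimetricPair.theta x y : ℝ) : ℂ) * Complex.I by push_cast; ring,
    Complex.exp_ofReal_mul_I_re]

theorem zeta_re (x y : M) : (zeta x y).re = cos (dist x y) := by
  have h := zeta_pow_re x y 1
  have hb : |cos (SemimetricPair.r x y) * cos (SemimetricPair.theta x y)| ≤ 1 := by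
    rw [abs_mul]
    exact mul_le_one₀ (abs_cos_le_one _) (abs_nonneg _) (abs_cos_le_one _)
  simp only [pow_one, Nat.cast_one, one_mul] at h
  rw [h, SemimetricPair.dist_eq, cos_arccos (abs_le.1 hb).1 (abs_le.1 hb).2]

/-- The complex coordinate is a continuous function of `r` and of the distance, although the angle
alone is not continuous where `cos r = 0`. -/
theorem zeta_im (x y : M) : (zeta x y).im =
    √(cos (SemimetricPair.r x y) ^ 2 - cos (dist x y) ^ 2) := by
  have him : 0 ≤ (zeta x y).im := by
    rw [zeta, Complex.im_ofReal_mul, Complex.exp_ofReal_mul_I_im]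
    exact mul_nonneg (cos_r_nonneg x y) (sin_nonneg_of_nonneg_of_le_pi
      (SemimetricPair.theta_nonneg x y) (SemimetricPair.theta_le x y))
  rw [← zeta_re, ← norm_zeta, Complex.sq_norm, Complex.normSq_apply,
    show (zeta x y).re * (zeta x y).re + (zeta x y).im * (zeta x y).im - (zeta x y).re ^ 2 =
      (zeta x y).im ^ 2 by ring, sqrt_sq him]

theorem r_le_dist (x y : M) : SemimetricPair.r x y ≤ dist x y := by
  rw [SemimetricPair.dist_eq]
  conv_lhs => rw [← arccos_cos (SemimetricPair.r_nonneg x y)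
    ((SemimetricPair.r_le x y).trans (by linarith [pi_pos]))]
  exact arccos_le_arccos (mul_le_of_le_one_right (cos_r_nonneg x y) (cos_le_one _))

theorem continuous_r (x : M) : Continuous fun y => SemimetricPair.r x y := by
  refine (LipschitzWith.of_le_add fun y y' => ?_ : LipschitzWith 1 _).continuous
  have h1 := SemimetricPair.r_triangle x y' y
  have h2 := r_le_dist y y'
  rw [SemimetricPair.r_comm] at h2
  linarith

theorem continuous_zeta (x : M) : Continuous fun y => zeta x y := by
  have hr := continuous_r x
  have : (fun y => zeta x y) = fun y => ((cos (dist x y) : ℝ) : ℂ) +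
      ((√(cos (SemimetricPair.r x y) ^ 2 - cos (dist x y) ^ 2) : ℝ) : ℂ) * Complex.I := by
    funext y
    rw [← zeta_im, ← zeta_re, Complex.re_add_im]
  rw [this]
  fun_prop

theorem kernelP_eq {t : ℝ} (ht : 0 < t) (x y : M) :
    kernelP t x y = discSum (pWeight t) (zeta x y) :=
  subRiemannianKernel_eq_discSum ht _ _

theorem kernelQ_eq {t : ℝ} (ht : 0 < t) (x y : M) :
    kernelQ t x y = discSum (qWeight t) (zeta x y) := by
  rw [kernelQ, qFunction_eq_chebyshevSum ht (abs_cos_le_one _), ← zeta_re,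
    chebyshevSum_re ht (norm_zeta_le x y)]

theorem hasSum_kernelP {t : ℝ} (ht : 0 < t) (x y : M) :
    HasSum (fun j => exp (-2 * t) ^ j * levelVal j (zeta x y)) (kernelP t x y) := by
  rw [kernelP_eq ht]; exact hasSum_levelVal ht (norm_zeta_le x y)

/-! ### The spectral decomposition of a heat kernel -/

variable [MeasurableSpace M] {μ : Measure M}

/-- The levels are limits of combinations of the kernels at large times, and inherit their joint
measurability. -/
theorem measurable_levelVal_zeta (hp : IsHeatKernel μ (kernelP (M := M))) (j : ℕ) :
    Measurable fun p : M × M => levelVal j (zeta p.1 p.2) := by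
  induction j using Nat.strong_induction_on with
  | _ J ih =>
  refine measurable_of_tendsto_metrizable (f := fun (n : ℕ) (p : M × M) =>
    (kernelP ((n : ℝ) + 1) p.1 p.2 - ∑ j ∈ Finset.range J,
      exp (-2 * ((n : ℝ) + 1)) ^ j * levelVal j (zeta p.1 p.2)) / exp (-2 * ((n : ℝ) + 1)) ^ J)
    (fun n => ?_) (tendsto_pi_nhds.2 fun p => ?_)
  · refine ((hp.measurable _ (by positivity)).sub
      (Finset.measurable_fun_sum _ fun j hj => ?_)).div_const _
    exact (ih j (Finset.mem_range.1 hj)).const_mul _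
  · have := (tendsto_powerSeries_coeff (exp_pos _)
      (hasSum_kernelP one_pos p.1 p.2).summable J).comp tendsto_exp_neg_two_mul
    refine this.congr fun n => ?_
    simp only [Function.comp_apply]
    rw [(hasSum_kernelP (by positivity) p.1 p.2).tsum_eq]

/-- The joint measurability of `zeta` does not follow from its continuity, since `M` need not be
separable; the levels one and two determine `Re ζ` and `|ζ|`, and `Im ζ ≥ 0`. -/
theorem measurable_zeta (hp : IsHeatKernel μ (kernelP (M := M))) :
    Measurable fun p : M × M => zeta p.1 p.2 := by
  have h1 : Measurable fun p : M × M => (zeta p.1 p.2).re := by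
    have := (measurable_levelVal_zeta hp 1).const_mul (1 / 4)
    simp only [levelVal_one] at this
    convert this using 2
    ring
  have h2 : Measurable fun p : M × M => ‖zeta p.1 p.2‖ ^ 2 := by
    have := ((h1.pow_const 2).const_mul 2).sub
      ((measurable_levelVal_zeta hp 2).const_mul (1 / 6))
    simp only [levelVal_two] at this
    convert this using 2
    simp
  have h3 : Measurable fun p : M × M => (zeta p.1 p.2).im := by
    have := (h2.sub (h1.pow_const 2)).sqrt
    convert this using 2 with p
    simp only [Pi.sub_apply]
    rw [zeta_im, norm_zeta, zeta_re]
  have : (fun p : M × M => zeta p.1 p.2) = fun p =>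
      ((zeta p.1 p.2).re : ℂ) + ((zeta p.1 p.2).im : ℂ) * Complex.I := by
    funext p; rw [Complex.re_add_im]
  rw [this]
  exact (Complex.measurable_ofReal.comp h1).add
    ((Complex.measurable_ofReal.comp h3).mul_const _)

theorem measurable_zeta_right (hp : IsHeatKernel μ (kernelP (M := M))) (x : M) :
    Measurable fun y => zeta x y := by
  have h := (measurable_zeta hp).comp (measurable_prodMk_left (x := x))
  exact h

theorem measurable_zeta_left (hp : IsHeatKernel μ (kernelP (M := M))) (y : M) :
    Measurable fun x => zeta x y := by
  have h := (measurable_zeta hp).comp (measurable_prodMk_right (y := y))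
  exact h

theorem measurable_kernelP_right (hp : IsHeatKernel μ (kernelP (M := M))) {t : ℝ} (ht : 0 < t)
    (x : M) : Measurable fun y => kernelP t x y := by
  have h := (hp.measurable t ht).comp (measurable_prodMk_left (x := x))
  exact h

-- unification must not compare these by unfolding them
attribute [irreducible] zeta levelVal

end Zeta

/-! ### Orthogonality of the levels and the law of the complex coordinate -/

/-- The evaluation of a polynomial in `z, w` at `(ζ, conj ζ)`. -/
def discEval (ζ : ℂ) : DiscRing →ₐ[ℝ] ℂ := MvPolynomial.aeval ![ζ, starRingEnd ℂ ζ]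

theorem discEval_monomial (ζ : ℂ) (a b : ℕ) :
    discEval ζ (dz ^ a * dw ^ b) = ζ ^ a * starRingEnd ℂ ζ ^ b := by
  simp [discEval]

theorem discEval_discPoly (ζ : ℂ) (i l : ℕ) :
    discEval ζ (discPoly dz dw i l) = discPoly ζ (starRingEnd ℂ ζ) i l := by
  have := map_discPoly dz dw (discEval ζ : DiscRing →+* ℂ) i l
  simpa [discEval] using this

theorem discEval_levelPoly (ζ : ℂ) (j : ℕ) :
    discEval ζ (levelPoly dz dw j) = (levelVal j ζ : ℂ) := by
  have := map_levelPoly dz dw (discEval ζ : DiscRing →+* ℂ) j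
  rw [← levelPoly_eq_ofReal]
  simpa [discEval] using this

theorem continuous_discEval (P : DiscRing) : Continuous fun ζ => discEval ζ P := by
  induction P using MvPolynomial.induction_on with
  | C a => simpa [discEval] using continuous_const
  | add p q hp hq =>
    simp only [map_add]
    exact hp.add hq
  | mul_X p i hp =>
    simp only [map_mul]
    refine hp.mul ?_
    fin_cases i
    · simpa [discEval] using continuous_id'
    · simpa [discEval] using Complex.continuous_conj

theorem exists_bound_of_continuous {f : ℂ → ℝ} (hf : Continuous f) :
    ∃ C, ∀ ζ : ℂ, ‖ζ‖ ≤ 1 → |f ζ| ≤ C := by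
  obtain ⟨C, hC⟩ := (isCompact_closedBall (0 : ℂ) 1).exists_bound_of_continuousOn hf.continuousOn
  exact ⟨C, fun ζ hζ => hC ζ (by simpa using hζ)⟩

theorem integrable_comp_disc {X : Type*} [MeasurableSpace X] {ν : Measure X} [IsFiniteMeasure ν]
    {f : X → ℂ} (hf : Measurable f) (hf1 : ∀ x, ‖f x‖ ≤ 1) {g : ℂ → ℝ} (hg : Continuous g) :
    Integrable (fun x => g (f x)) ν := by
  obtain ⟨C, hC⟩ := exists_bound_of_continuous hg
  exact Integrable.of_bound (hg.measurable.comp hf).aestronglyMeasurable C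
    (Eventually.of_forall fun x => hC _ (hf1 x))

/-- The functional `P ↦ ∫ Re P(f, conj f) dν` on `ℝ[z, w]`. -/
def momentFunctional {X : Type*} [MeasurableSpace X] (ν : Measure X) [IsFiniteMeasure ν]
    (f : X → ℂ) (hf : Measurable f) (hf1 : ∀ x, ‖f x‖ ≤ 1) : DiscRing →ₗ[ℝ] ℝ where
  toFun P := ∫ x, (discEval (f x) P).re ∂ν
  map_add' P Q := by
    simp only [map_add, Complex.add_re]
    exact integral_add
      (integrable_comp_disc hf hf1 (Complex.continuous_re.comp (continuous_discEval P)))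
      (integrable_comp_disc hf hf1 (Complex.continuous_re.comp (continuous_discEval Q)))
  map_smul' c P := by
    simp only [map_smul, Complex.real_smul, Complex.re_ofReal_mul, integral_const_mul,
      RingHom.id_apply, smul_eq_mul]

/-- `f` has the moments of the uniform distribution on the unit disc, as far as they are invariant
under conjugation. -/
def HasDiscMoments {X : Type*} [MeasurableSpace X] (ν : Measure X) (f : X → ℂ) : Prop :=
  ∀ P : DiscRing, ∫ x, (discEval (f x) P).re ∂ν = discIntegral P

/-- The orthogonality of the levels determines the law of `f` up to conjugation. -/
theorem hasDiscMoments_of_orthogonal {X : Type*} [MeasurableSpace X] {ν : Measure X}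
    [IsFiniteMeasure ν] {f : X → ℂ} (hf : Measurable f) (hf1 : ∀ x, ‖f x‖ ≤ 1)
    (h : ∀ i j, ∫ x, levelVal i (f x) * levelVal j (f x) ∂ν = if i = j then levelVal i 1 else 0) :
    HasDiscMoments ν f := by
  have key : momentFunctional ν f hf hf1 = discIntegral := by
    refine eq_discIntegral (fun a b => ?_) fun a b => ?_
    · change ∫ x, _ ∂ν = ∫ x, _ ∂ν
      refine integral_congr_ae (Eventually.of_forall fun x => ?_)
      simp only
      rw [discEval_monomial, discEval_monomial, ← Complex.conj_re, map_mul, map_pow, map_pow,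
        Complex.conj_conj, mul_comm]
    · change ∫ x, _ ∂ν = _
      rw [← levelVal_at_one, ← h a b]
      refine integral_congr_ae (Eventually.of_forall fun x => ?_)
      simp only
      rw [map_mul, discEval_levelPoly, discEval_levelPoly, ← Complex.ofReal_mul, Complex.ofReal_re]
  intro P
  exact congrArg (fun L : DiscRing →ₗ[ℝ] ℝ => L P) key

theorem discVal_self_eq (k : ℕ) (ζ : ℂ) :
    discPoly ζ (starRingEnd ℂ ζ) k k = (discVal (k, k) ζ : ℂ) :=
  (Complex.conj_eq_iff_re.1 (conj_discPoly ζ k k)).symm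

section Moments

variable {X : Type*} [MeasurableSpace X] {ν : Measure X} {f : X → ℂ}

theorem HasDiscMoments.norm_pow_mul (h : HasDiscMoments ν f) (m : ℕ) (q : ℕ × ℕ) :
    ∫ x, ‖f x‖ ^ (2 * m) * discVal q (f x) ∂ν =
      if q.1 = q.2 then (m.descFactorial q.1 * m ! : ℕ) / ((m + q.1 + 1)! : ℝ) else 0 := by
  have h1 := h (discPoly dz dw q.1 q.2 * (dz ^ m * dw ^ m))
  rw [discIntegral_discPoly_mul] at h1
  simp only [add_left_inj] at h1
  by_cases hq : q.1 = q.2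
  · rw [if_pos hq] at h1 ⊢
    rw [add_comm m, ← show m.descFactorial q.2 = m.descFactorial q.1 by rw [hq], ← h1]
    refine integral_congr_ae (Eventually.of_forall fun x => ?_)
    simp only
    rw [map_mul, discEval_discPoly, discEval_monomial, ← mul_pow, Complex.mul_conj',
      ← Complex.ofReal_pow, ← Complex.ofReal_pow, Complex.re_mul_ofReal, discVal, pow_mul, mul_comm]
  · rw [if_neg hq] at h1 ⊢
    rw [← h1]
    refine integral_congr_ae (Eventually.of_forall fun x => ?_)
    simp only
    rw [map_mul, discEval_discPoly, discEval_monomial, ← mul_pow, Complex.mul_conj',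
      ← Complex.ofReal_pow, ← Complex.ofReal_pow, Complex.re_mul_ofReal, discVal, pow_mul, mul_comm]

theorem HasDiscMoments.norm_pow (h : HasDiscMoments ν f) (m : ℕ) :
    ∫ x, ‖f x‖ ^ (2 * m) ∂ν = 1 / (m + 1) := by
  have h1 := h.norm_pow_mul m (0, 0)
  simp only [discVal, discPoly_zero_right, pow_zero, Complex.one_re, mul_one, if_true,
    Nat.descFactorial_zero, one_mul, add_zero, Nat.factorial_succ] at h1
  rw [h1]
  have : (m ! : ℝ) ≠ 0 := by positivity
  push_cast
  field_simp

/-- The weights `(m + 1) |z|^{2m}` see only the disc polynomials with equal indices. -/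
theorem HasDiscMoments.norm_pow_mul_le (h : HasDiscMoments ν f) (m : ℕ) (q : ℕ × ℕ) :
    (m + 1) * ∫ x, ‖f x‖ ^ (2 * m) * discVal q (f x) ∂ν ≤ if q.1 = q.2 then 1 else 0 := by
  rw [h.norm_pow_mul]
  split_ifs with hq
  · have h1 : (m + 1)! * (m.descFactorial q.1) ≤ (m + q.1 + 1)! := by
      refine (Nat.mul_le_mul_left _ (Nat.descFactorial_le_pow m q.1)).trans ?_
      refine (Nat.mul_le_mul_left _ (Nat.pow_le_pow_left (by omega : m ≤ m + 1 + 1) q.1)).trans ?_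
      rw [show m + q.1 + 1 = (m + 1) + q.1 by ring]
      exact Nat.factorial_mul_pow_le_factorial
    rw [Nat.factorial_succ] at h1
    rw [← mul_div_assoc, div_le_one (by positivity)]
    have h2 : (((m + 1) * m ! * m.descFactorial q.1 : ℕ) : ℝ) ≤ ((m + q.1 + 1)! : ℕ) := by
      exact_mod_cast h1
    push_cast at h2 ⊢
    linarith
  · simp

theorem HasDiscMoments.orthogonal (h : HasDiscMoments ν f) (k : ℕ) (q : ℕ × ℕ) :
    ∫ x, discVal (k, k) (f x) * discVal q (f x) ∂ν =
      if q = (k, k) then 1 / (2 * k + 1 : ℝ) else 0 := by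
  have h1 := h (discPoly dz dw k k * discPoly dz dw q.1 q.2)
  rw [discIntegral_discPoly_mul_discPoly] at h1
  have h2 : ∫ x, discVal (k, k) (f x) * discVal q (f x) ∂ν =
      ∫ x, (discEval (f x) (discPoly dz dw k k * discPoly dz dw q.1 q.2)).re ∂ν := by
    refine integral_congr_ae (Eventually.of_forall fun x => ?_)
    simp only
    rw [map_mul, discEval_discPoly, discEval_discPoly, discVal_self_eq, Complex.re_ofReal_mul]
    rfl
  rw [h2, h1]
  by_cases hq : q = (k, k)
  · subst hq
    rw [if_pos ⟨rfl, rfl⟩, if_pos rfl]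
    congr 1; ring
  · rw [if_neg hq, if_neg]
    rintro ⟨h3, h4⟩
    exact hq (Prod.ext h4.symm h3.symm)

/-- The uniform law does not charge the centre of the disc: `∫ (1 - |z|²)^m = 1 / (m + 1)`. -/
theorem HasDiscMoments.ae_ne_zero [IsFiniteMeasure ν] (h : HasDiscMoments ν f) (hf : Measurable f)
    (hf1 : ∀ x, ‖f x‖ ≤ 1) : ∀ᵐ x ∂ν, f x ≠ 0 := by
  have hint : ∀ a m : ℕ, Integrable (fun x => ‖f x‖ ^ (2 * a) * (1 - ‖f x‖ ^ 2) ^ m) ν :=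
    fun a m => integrable_comp_disc hf hf1 (g := fun ζ => ‖ζ‖ ^ (2 * a) * (1 - ‖ζ‖ ^ 2) ^ m)
      (by fun_prop)
  have beta : ∀ m a : ℕ, ∫ x, ‖f x‖ ^ (2 * a) * (1 - ‖f x‖ ^ 2) ^ m ∂ν =
      (a ! * m ! : ℝ) / ((a + m + 1)! : ℝ) := by
    intro m
    induction m with
    | zero =>
      intro a
      simp only [pow_zero, mul_one, h.norm_pow, add_zero, Nat.factorial_zero, Nat.cast_one]
      rw [Nat.factorial_succ]
      have : (a ! : ℝ) ≠ 0 := by positivity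
      push_cast
      field_simp
    | succ m ih =>
      intro a
      have h1 : ∀ x, ‖f x‖ ^ (2 * a) * (1 - ‖f x‖ ^ 2) ^ (m + 1) =
          ‖f x‖ ^ (2 * a) * (1 - ‖f x‖ ^ 2) ^ m -
            ‖f x‖ ^ (2 * (a + 1)) * (1 - ‖f x‖ ^ 2) ^ m := fun x => by ring
      simp_rw [h1]
      rw [integral_sub (hint _ _) (hint _ _), ih, ih,
        show a + 1 + m + 1 = a + m + 1 + 1 by ring, show a + (m + 1) + 1 = a + m + 1 + 1 by ring,
        Nat.factorial_succ (a + m + 1), Nat.factorial_succ a, Nat.factorial_succ m]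
      have : ((a + m + 1)! : ℝ) ≠ 0 := by positivity
      push_cast
      field_simp
      ring
  have hmeas : MeasurableSet {x | f x = 0} := hf (measurableSet_singleton 0)
  have hle : ∀ m : ℕ, ν.real {x | f x = 0} ≤ 1 / ((m : ℝ) + 1) := by
    intro m
    have h1 := beta m 0
    have hm : (m ! : ℝ) ≠ 0 := by positivity
    simp only [mul_zero, pow_zero, one_mul, Nat.factorial_zero, Nat.cast_one, zero_add,
      Nat.factorial_succ] at h1
    rw [show 1 / ((m : ℝ) + 1) = (m ! : ℝ) / ((m + 1) * m ! : ℕ) by push_cast; field_simp, ← h1,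
      ← integral_indicator_one hmeas]
    refine integral_mono ((integrable_const 1).indicator hmeas) (by simpa using hint 0 m)
      fun x => ?_
    by_cases hx : f x = 0
    · simp [hx]
    · simp only [Set.indicator, Set.mem_ofPred_eq, hx, if_false]
      have := hf1 x
      exact pow_nonneg (by nlinarith [norm_nonneg (f x)]) m
  have h0 : ν.real {x | f x = 0} ≤ 0 :=
    ge_of_tendsto' tendsto_one_div_add_atTop_nhds_zero_nat hle
  rw [ae_iff]
  simp only [ne_eq, not_not]
  exact (measureReal_eq_zero_iff).1 (le_antisymm h0 measureReal_nonneg)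

end Moments

section Spectral

variable {M : Type*} [SemimetricPair M] [MeasurableSpace M] {μ : Measure M}

/-- The kernel is bounded below at large times, so that `μ` is finite; then the term of exponent
zero in `∫ p_t(x, y) dμ(y) = 1` is the total mass. -/
theorem isProbabilityMeasure_of_isHeatKernel (hp : IsHeatKernel μ (kernelP (M := M))) (hμ : μ ≠ 0) :
    IsProbabilityMeasure μ := by
  have : (ae μ).NeBot := ae_neBot.2 hμ
  obtain ⟨x, hx⟩ := hp.conservative.exists
  have hzm : Measurable fun y => zeta x y := measurable_zeta_right hp x
  -- for large times the kernel is close to its constant term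
  obtain ⟨n, hn⟩ : ∃ n : ℕ, ∑' j, exp (-2 * ((n : ℝ) + 1)) ^ j * levelBound j < 3 / 2 := by
    have h := (tendsto_powerSeries_coeff (exp_pos _) (summable_levelBound one_pos) 0).comp
      tendsto_exp_neg_two_mul
    rw [levelBound_zero] at h
    obtain ⟨n, hn⟩ := (h.eventually (gt_mem_nhds (by norm_num : (1 : ℝ) < 3 / 2))).exists
    exact ⟨n, by simpa using hn⟩
  have ht : (0 : ℝ) < n + 1 := by positivity
  have hlow : ∀ y, 1 / 2 ≤ kernelP ((n : ℝ) + 1) x y := by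
    intro y
    have h1 := hasSum_kernelP ht x y
    have h2 := summable_levelBound ht
    have h3 := h1.summable.tsum_eq_zero_add
    have h4 := h2.tsum_eq_zero_add
    rw [h1.tsum_eq, levelVal_zero] at h3
    rw [levelBound_zero] at h4
    have h5 : ‖∑' j, exp (-2 * ((n : ℝ) + 1)) ^ (j + 1) * levelVal (j + 1) (zeta x y)‖ ≤
        ∑' j, exp (-2 * ((n : ℝ) + 1)) ^ (j + 1) * levelBound (j + 1) := by
      refine tsum_of_norm_bounded ((summable_nat_add_iff 1).2 h2).hasSum fun j => ?_
      rw [norm_mul, norm_eq_abs, norm_eq_abs, abs_of_pos (by positivity)]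
      exact mul_le_mul_of_nonneg_left (abs_levelVal_le (norm_zeta_le x y) _) (by positivity)
    rw [norm_eq_abs, abs_le] at h5
    simp only [pow_zero, one_mul] at h3 h4
    linarith [h5.1]
  have hfin : IsFiniteMeasure μ := by
    have h1 := (hx _ ht).1.measure_ge_lt_top (by norm_num : (0 : ℝ) < 1 / 2)
    refine ⟨?_⟩
    convert h1 using 2
    ext y
    exact ⟨fun _ => hlow y, fun _ => trivial⟩
  have huniq := coeff_unique (a := fun j => ∫ y, levelVal j (zeta x y) ∂μ)
    (b := fun j => if j = 0 then 1 else 0) (fun t ht => ?_) (fun t ht => ?_) (fun t ht => ?_) 0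
  · simp only [levelVal_zero, if_true, integral_const, smul_eq_mul, mul_one] at huniq
    refine ⟨?_⟩
    rw [← ENNReal.toReal_eq_one_iff]
    exact huniq
  · have := hasSum_integral_levelVal (ν := μ) hzm (norm_zeta_le x) measurable_const (C := 1)
      (g := fun _ => 1) (by simp) ht
    simpa using this.summable
  · exact summable_of_ne_finset_zero (s := {0}) fun j hj => by simp at hj; simp [hj]
  · have := hasSum_integral_levelVal (ν := μ) hzm (norm_zeta_le x) measurable_const (C := 1)
      (g := fun _ => 1) (by simp) ht
    simp only [one_mul] at this
    rw [this.tsum_eq, tsum_eq_single 0 (fun j hj => by simp [hj])]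
    simp only [← kernelP_eq ht, (hx t ht).2]
    simp

variable [IsProbabilityMeasure μ]

/-- The levels are orthogonal projections. -/
theorem ae_integral_levelVal_mul (hp : IsHeatKernel μ (kernelP (M := M))) :
    ∀ᵐ z ∂(μ.prod μ), ∀ i j, ∫ w, levelVal i (zeta z.1 w) * levelVal j (zeta w z.2) ∂μ =
      if i = j then levelVal i (zeta z.1 z.2) else 0 := by
  filter_upwards [hp.semigroup] with z hz
  obtain ⟨x, y⟩ := z
  simp only at hz ⊢
  have hzx : Measurable fun w => zeta x w := measurable_zeta_right hp x
  have hzy : Measurable fun w => zeta w y := measurable_zeta_left hp y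
  have hlm : ∀ j, Measurable (levelVal j) := fun j => (continuous_levelVal j).measurable
  have step1 : ∀ s > 0, ∀ j, ∫ w, kernelP s x w * levelVal j (zeta w y) ∂μ =
      exp (-2 * s) ^ j * levelVal j (zeta x y) := by
    intro s hs j
    have hpm : Measurable fun w => kernelP s x w := measurable_kernelP_right hp hs x
    have hsum : ∀ t > 0, HasSum (fun j => exp (-2 * t) ^ j *
        ∫ w, kernelP s x w * levelVal j (zeta w y) ∂μ) (kernelP (s + t) x y) := by
      intro t ht
      have := hasSum_integral_levelVal (ν := μ) hzy (fun w => norm_zeta_le w y) hpm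
        (C := ∑' q : ℕ × ℕ, |pWeight s q| * (q.1 + q.2 + 1)) (fun w => by
          rw [kernelP_eq hs]; exact (isDiscWeight_pWeight hs).abs_discSum_le (norm_zeta_le x w)) ht
      rw [(hz s hs t ht).2]
      simpa only [← kernelP_eq ht] using this
    have hsum2 : ∀ t > 0, HasSum (fun j => exp (-2 * t) ^ j *
        (exp (-2 * s) ^ j * levelVal j (zeta x y))) (kernelP (s + t) x y) := by
      intro t ht
      refine (hasSum_kernelP (by positivity : 0 < s + t) x y).congr_fun fun j => ?_
      rw [← mul_assoc, ← mul_pow, ← exp_add]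
      congr 3; ring
    exact coeff_unique (fun t ht => (hsum t ht).summable) (fun t ht => (hsum2 t ht).summable)
      (fun t ht => (hsum t ht).tsum_eq.trans (hsum2 t ht).tsum_eq.symm) j
  intro i j
  obtain ⟨C, hC⟩ := exists_bound_of_continuous (continuous_levelVal j)
  have hsum : ∀ s > 0, HasSum (fun i => exp (-2 * s) ^ i *
      ∫ w, levelVal j (zeta w y) * levelVal i (zeta x w) ∂μ)
      (exp (-2 * s) ^ j * levelVal j (zeta x y)) := by
    intro s hs
    have := hasSum_integral_levelVal (ν := μ) hzx (norm_zeta_le x) ((hlm j).comp hzy) (C := C)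
      (fun w => hC _ (norm_zeta_le w y)) hs
    rw [← step1 s hs j]
    simpa only [← kernelP_eq hs, mul_comm, Function.comp_apply] using this
  have hsum2 : ∀ s > 0, HasSum (fun i => exp (-2 * s) ^ i *
      (if i = j then levelVal i (zeta x y) else 0)) (exp (-2 * s) ^ j * levelVal j (zeta x y)) := by
    intro s _
    have := hasSum_single (f := fun i => exp (-2 * s) ^ i *
      (if i = j then levelVal i (zeta x y) else 0)) j (fun i hi => by simp [hi])
    simpa using this
  have := coeff_unique (fun t ht => (hsum t ht).summable) (fun t ht => (hsum2 t ht).summable)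
    (fun t ht => (hsum t ht).tsum_eq.trans (hsum2 t ht).tsum_eq.symm) i
  simpa only [mul_comm] using this

/-- By continuity on the support of `μ`, the orthogonality of the levels also holds on the diagonal;
hence the law of `zeta x` is known. -/
theorem ae_hasDiscMoments [BorelSpace M] [μ.Regular] (hp : IsHeatKernel μ (kernelP (M := M))) :
    ∀ᵐ x ∂μ, HasDiscMoments μ (zeta x) := by
  filter_upwards [Measure.ae_ae_of_ae_prod (ae_integral_levelVal_mul hp),
    Measure.support_mem_ae_of_regular (μ := μ)] with x hx hsupp
  have hzx : Measurable (zeta x) := measurable_zeta_right hp x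
  refine hasDiscMoments_of_orthogonal hzx (norm_zeta_le x) fun i j => ?_
  have hclosed : IsClosed {y | ∫ w, levelVal i (zeta x w) * levelVal j (zeta w y) ∂μ =
      if i = j then levelVal i (zeta x y) else 0} := by
    refine isClosed_eq ?_ ?_
    · obtain ⟨C, hC⟩ := exists_bound_of_continuous (continuous_levelVal i)
      obtain ⟨D, hD⟩ := exists_bound_of_continuous (continuous_levelVal j)
      refine continuous_of_dominated (bound := fun _ => C * D) (fun y => ?_) (fun y => ?_)
        (integrable_const _) (Eventually.of_forall fun w => ?_)
      · exact (((continuous_levelVal i).measurable.comp hzx).mul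
          ((continuous_levelVal j).measurable.comp
            (measurable_zeta_left hp y))).aestronglyMeasurable
      · refine Eventually.of_forall fun w => ?_
        rw [norm_mul]
        exact mul_le_mul (hC _ (norm_zeta_le _ _)) (hD _ (norm_zeta_le _ _)) (norm_nonneg _)
          ((abs_nonneg _).trans (hC 0 (by simp)))
      · exact continuous_const.mul ((continuous_levelVal j).comp (continuous_zeta w))
    · split_ifs
      · exact (continuous_levelVal i).comp (continuous_zeta x)
      · exact continuous_const
  have hmem := Measure.support_subset_of_isClosed hclosed (by
    filter_upwards [hx] with y hy
    exact hy i j) hsupp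
  simp only [Set.mem_ofPred_eq, zeta_self] at hmem
  rw [← hmem]
  simp_rw [zeta_comm x]

end Spectral

/-! ### Disintegrations over the base -/

section Disintegration

variable {M : Type*} [SemimetricPair M]

open ProbabilityTheory

theorem integrable_of_abs_le {X : Type*} [MeasurableSpace X] {ν : Measure X} [IsFiniteMeasure ν]
    {f : X → ℝ} (hf : Measurable f) {C : ℝ} (hC : ∀ x, |f x| ≤ C) : Integrable f ν :=
  Integrable.of_bound hf.aestronglyMeasurable C (Eventually.of_forall hC)

theorem abs_integral_le_of_abs_le {X : Type*} [MeasurableSpace X] {ν : Measure X}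
    [IsProbabilityMeasure ν] {f : X → ℝ} {C : ℝ} (hC : ∀ x, |f x| ≤ C) : |∫ x, f x ∂ν| ≤ C := by
  have := norm_integral_le_of_norm_le_const (μ := ν) (f := f) (Eventually.of_forall hC)
  simpa using this

theorem dist_proj (x y : M) : dist (Base.proj x) (Base.proj y) = SemimetricPair.r x y := rfl

theorem norm_zeta_eq_cos_dist (x y : M) :
    ‖zeta x y‖ = cos (dist (Base.proj x) (Base.proj y)) := norm_zeta x y

theorem continuous_proj : Continuous (Base.proj (M := M)) :=
  (LipschitzWith.of_dist_le_mul (K := 1) fun x y => by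
    rw [dist_proj, NNReal.coe_one, one_mul]; exact r_le_dist x y).continuous

/-- The kernels `(m + 1) cos^{2m} r`, an approximate identity of the base. -/
def baseApprox (m : ℕ) (p : M × M) : ℝ := (m + 1) * ‖zeta p.1 p.2‖ ^ (2 * m)

theorem baseApprox_nonneg (m : ℕ) (p : M × M) : 0 ≤ baseApprox m p := by
  unfold baseApprox; positivity

theorem baseApprox_le (m : ℕ) (p : M × M) : |baseApprox m p| ≤ m + 1 := by
  rw [abs_of_nonneg (baseApprox_nonneg m p)]
  exact mul_le_of_le_one_right (by positivity)
    (pow_le_one₀ (norm_nonneg _) (norm_zeta_le _ _))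

theorem baseApprox_swap (m : ℕ) (p : M × M) : baseApprox m p.swap = baseApprox m p := by
  unfold baseApprox; rw [Prod.fst_swap, Prod.snd_swap, zeta_comm]

theorem abs_baseApprox_mul_le {m : ℕ} {F : M × M → ℝ} {C : ℝ} (hC : ∀ p, |F p| ≤ C) (p : M × M) :
    |baseApprox m p * F p| ≤ (m + 1) * C := by
  rw [abs_mul]
  exact mul_le_mul (baseApprox_le m p) (hC p) (abs_nonneg _) (by positivity)

variable [MeasurableSpace M] {μ : Measure M}

variable {κ : Base M → Measure M}

/-- A disintegration as a Markov kernel. -/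
def IsDisintegration.kernel (h : IsDisintegration μ κ) : Kernel (Base M) M :=
  ⟨κ, Measure.measurable_of_measurable_coe _ h.measurable⟩

theorem IsDisintegration.kernel_apply (h : IsDisintegration μ κ) (b : Base M) :
    h.kernel b = κ b := rfl

instance (h : IsDisintegration μ κ) : IsMarkovKernel h.kernel := ⟨h.isProbabilityMeasure⟩

/-- The disintegration formula, as an equality of measures: since almost every `κ b` is carried by
its fibre, the restriction to the fibre may be dropped. -/
theorem IsDisintegration.comp_eq (h : IsDisintegration μ κ) : h.kernel ∘ₘ baseMeasure μ = μ := by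
  ext A hA
  have h1 := h.lintegral_eq (A.indicator 1) (measurable_one.indicator hA)
  rw [lintegral_indicator_one hA] at h1
  rw [Measure.bind_apply hA h.kernel.measurable.aemeasurable, h1]
  refine lintegral_congr_ae ?_
  filter_upwards [h.fiber] with b hb
  have hr : (κ b).restrict (Base.proj ⁻¹' {b}) = κ b :=
    Measure.restrict_eq_self_of_ae_mem (mem_ae_iff.2 hb)
  rw [hr, lintegral_indicator_one hA, h.kernel_apply]

theorem IsDisintegration.ae_proj_eq (h : IsDisintegration μ κ) :
    ∀ᵐ b ∂(baseMeasure μ), ∀ᵐ x ∂(κ b), Base.proj x = b := by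
  filter_upwards [h.fiber] with b hb
  rw [ae_iff]
  exact hb

instance [SFinite μ] : SFinite (baseMeasure μ) := by unfold baseMeasure; infer_instance

/-- A property that holds almost everywhere on `M × X` holds almost everywhere on almost all
fibres. -/
theorem IsDisintegration.ae_prod_left [SFinite μ] (h : IsDisintegration μ κ) {X : Type*}
    [MeasurableSpace X] {ρ : Measure X} [SFinite ρ] {P : M → X → Prop}
    (hP : ∀ᵐ z ∂(μ.prod ρ), P z.1 z.2) :
    ∀ᵐ z ∂((baseMeasure μ).prod ρ), ∀ᵐ x ∂(κ z.1), P x z.2 := by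
  rw [← h.comp_eq, Measure.prod_comp_left] at hP
  filter_upwards [Measure.ae_ae_of_ae_comp hP] with z hz
  rw [Kernel.parallelComp_apply, Kernel.id_apply, Measure.prod_dirac, h.kernel_apply] at hz
  exact ae_of_ae_map (by fun_prop) hz

theorem IsDisintegration.ae_prod_right [SFinite μ] (h : IsDisintegration μ κ) {X : Type*}
    [MeasurableSpace X] {ρ : Measure X} [SFinite ρ] {P : X → M → Prop}
    (hP : ∀ᵐ z ∂(ρ.prod μ), P z.1 z.2) :
    ∀ᵐ z ∂(ρ.prod (baseMeasure μ)), ∀ᵐ y ∂(κ z.2), P z.1 y := by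
  rw [← h.comp_eq, Measure.prod_comp_right] at hP
  filter_upwards [Measure.ae_ae_of_ae_comp hP] with z hz
  rw [Kernel.parallelComp_apply, Kernel.id_apply, Measure.dirac_prod, h.kernel_apply] at hz
  exact ae_of_ae_map measurable_prodMk_left.aemeasurable hz

/-- A property that holds at `(w, π x)` almost everywhere holds at `(w, b)` almost everywhere. The
set where it holds need not be measurable; the fibre measures replace the measurability. -/
theorem IsDisintegration.ae_of_ae_proj [SFinite μ] (h : IsDisintegration μ κ) {X : Type*}
    [MeasurableSpace X] {ρ : Measure X} [SFinite ρ] {P : X → Base M → Prop}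
    (hP : ∀ᵐ z ∂(ρ.prod μ), P z.1 (Base.proj z.2)) :
    ∀ᵐ z ∂(ρ.prod (baseMeasure μ)), P z.1 z.2 := by
  filter_upwards [h.ae_prod_right (P := fun w x => P w (Base.proj x)) hP,
    Measure.quasiMeasurePreserving_snd.ae h.ae_proj_eq] with z hz hz2
  have := h.isProbabilityMeasure z.2
  obtain ⟨x, hx1, hx2⟩ := (hz.and hz2).exists
  rwa [hx2] at hx1

theorem IsDisintegration.measurable_integral (h : IsDisintegration μ κ) {X : Type*}
    [MeasurableSpace X] {F : X × M → ℝ} (hF : Measurable F) :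
    Measurable fun p : X × Base M => ∫ y, F (p.1, y) ∂(κ p.2) := by
  have := (StronglyMeasurable.integral_kernel_prod_right'
    (κ := h.kernel.comap (Prod.snd : X × Base M → Base M) measurable_snd)
    (f := fun p : (X × Base M) × M => F (p.1.1, p.2))
    (hF.comp (by fun_prop)).stronglyMeasurable).measurable
  exact this

theorem measurable_baseApprox (hp : IsHeatKernel μ (kernelP (M := M))) (m : ℕ) :
    Measurable (baseApprox (M := M) m) :=
  ((measurable_zeta hp).norm.pow_const _).const_mul _

theorem measurable_proj [BorelSpace M] : Measurable (Base.proj (M := M)) :=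
  continuous_proj.measurable

theorem IsDisintegration.integral_eq (h : IsDisintegration μ κ) {f : M → ℝ}
    (hf : Integrable f μ) : ∫ x, f x ∂μ = ∫ b, ∫ x, f x ∂(κ b) ∂(baseMeasure μ) := by
  rw [← h.comp_eq, Measure.comp_eq_comp_const_apply] at hf
  conv_lhs => rw [← h.comp_eq, Measure.comp_eq_comp_const_apply]
  rw [Kernel.integral_comp hf, Kernel.const_apply]
  rfl

variable [BorelSpace M]

/-- Averaging over the fibres is self-adjoint with respect to functions of the base point. -/
theorem IsDisintegration.integral_mul_average [IsProbabilityMeasure μ] (h : IsDisintegration μ κ)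
    {F G : M → ℝ} (hF : Measurable F) {C D : ℝ} (hC : ∀ x, |F x| ≤ C) (hG : Measurable G)
    (hD : ∀ x, |G x| ≤ D) (hG' : ∀ x x', Base.proj x = Base.proj x' → G x = G x') :
    ∫ x, G x * F x ∂μ = ∫ x, G x * ∫ y, F y ∂(κ (Base.proj x)) ∂μ := by
  have hE : Measurable fun b => ∫ y, F y ∂(κ b) :=
    (h.measurable_integral (X := Unit) (F := fun p => F p.2) (hF.comp measurable_snd)).comp
      (measurable_const.prodMk measurable_id : Measurable fun b => ((), b))
  have hEC : ∀ b, |∫ y, F y ∂(κ b)| ≤ C := fun b => by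
    have := h.isProbabilityMeasure b
    exact abs_integral_le_of_abs_le hC
  have hint : ∀ H : M → ℝ, Measurable H → (∀ x, |H x| ≤ C) → Integrable (fun x => G x * H x) μ :=
    fun H hH hHC => integrable_of_abs_le (hG.mul hH) (C := D * C) fun x => by
      rw [abs_mul]
      exact mul_le_mul (hD x) (hHC x) (abs_nonneg _) ((abs_nonneg _).trans (hD x))
  have e1 := h.integral_eq (hint _ (hE.comp measurable_proj) fun x => hEC _)
  simp only [Function.comp_apply] at e1
  rw [h.integral_eq (hint F hF hC), e1]
  refine integral_congr_ae ?_
  filter_upwards [h.ae_proj_eq] with b hb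
  have := h.isProbabilityMeasure b
  obtain ⟨x₀, hx₀⟩ := hb.exists
  have h1 : ∫ x, G x * F x ∂(κ b) = ∫ x, G x₀ * F x ∂(κ b) := by
    refine integral_congr_ae ?_
    filter_upwards [hb] with x hx
    rw [hG' x x₀ (hx.trans hx₀.symm)]
  have h2 : ∫ x, G x * ∫ y, F y ∂(κ (Base.proj x)) ∂(κ b) =
      ∫ _, G x₀ * ∫ y, F y ∂(κ b) ∂(κ b) := by
    refine integral_congr_ae ?_
    filter_upwards [hb] with x hx
    rw [hG' x x₀ (hx.trans hx₀.symm), hx]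
  rw [h1, h2, integral_const_mul, integral_const]
  simp

/-! ### An approximate identity on the base -/

variable [IsProbabilityMeasure μ] [μ.Regular]

theorem ae_integral_baseApprox (hp : IsHeatKernel μ (kernelP (M := M))) :
    ∀ᵐ x ∂μ, ∀ m, ∫ y, baseApprox m (x, y) ∂μ = 1 := by
  filter_upwards [ae_hasDiscMoments hp] with x hx m
  unfold baseApprox
  simp only
  rw [integral_const_mul, hx.norm_pow]
  field_simp

theorem integral_baseApprox_mul_fst (hp : IsHeatKernel μ (kernelP (M := M))) (m : ℕ) {G : M → ℝ}
    (hG : Measurable G) {C : ℝ} (hC : ∀ x, |G x| ≤ C) :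
    ∫ p, baseApprox m p * G p.1 ∂(μ.prod μ) = ∫ x, G x ∂μ := by
  have hint : Integrable (fun p : M × M => baseApprox m p * G p.1) (μ.prod μ) :=
    integrable_of_abs_le ((measurable_baseApprox hp m).mul (hG.comp measurable_fst))
      (abs_baseApprox_mul_le (F := fun p => G p.1) fun p => hC _)
  rw [integral_prod _ hint]
  refine integral_congr_ae ?_
  filter_upwards [ae_integral_baseApprox hp] with x hx
  rw [integral_mul_const, hx, one_mul]

theorem integral_baseApprox_mul_snd (hp : IsHeatKernel μ (kernelP (M := M))) (m : ℕ) {G : M → ℝ}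
    (hG : Measurable G) {C : ℝ} (hC : ∀ x, |G x| ≤ C) :
    ∫ p, baseApprox m p * G p.2 ∂(μ.prod μ) = ∫ x, G x ∂μ := by
  rw [← integral_baseApprox_mul_fst hp m hG hC,
    ← integral_prod_swap (f := fun p : M × M => baseApprox m p * G p.1)]
  simp only [baseApprox_swap, Prod.fst_swap]

/-- The kernels `(m + 1) cos^{2m} r` concentrate near `r = 0`. -/
theorem tendsto_baseApprox_continuous (hp : IsHeatKernel μ (kernelP (M := M))) {g : Base M → ℝ}
    (hg : Continuous g) {C : ℝ} (hC : ∀ b, |g b| ≤ C) :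
    Tendsto (fun m => ∫ p, baseApprox m p * (g (Base.proj p.1) - g (Base.proj p.2)) ^ 2 ∂(μ.prod μ))
      atTop (𝓝 0) := by
  have hgm : Measurable fun x : M => g (Base.proj x) := hg.measurable.comp measurable_proj
  have hD : ∀ b b' : Base M, |(g b - g b') ^ 2| ≤ 4 * C ^ 2 := by
    intro b b'
    have h1 := abs_le.1 (hC b)
    have h2 := abs_le.1 (hC b')
    rw [abs_of_nonneg (sq_nonneg _)]
    nlinarith
  have hmeas : ∀ m, Measurable fun p : M × M =>
      baseApprox m p * (g (Base.proj p.1) - g (Base.proj p.2)) ^ 2 := fun m =>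
    (measurable_baseApprox hp m).mul
      (((hgm.comp measurable_fst).sub (hgm.comp measurable_snd)).pow_const 2)
  have hint : ∀ m, ∫ p, baseApprox m p * (g (Base.proj p.1) - g (Base.proj p.2)) ^ 2 ∂(μ.prod μ) =
      ∫ x, ∫ y, baseApprox m (x, y) * (g (Base.proj x) - g (Base.proj y)) ^ 2 ∂μ ∂μ := fun m =>
    integral_prod _ (integrable_of_abs_le (hmeas m)
      (abs_baseApprox_mul_le (F := fun p => (g (Base.proj p.1) - g (Base.proj p.2)) ^ 2)
        fun p => hD _ _))
  simp_rw [hint]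
  rw [show (0 : ℝ) = ∫ _ : M, (0 : ℝ) ∂μ by simp]
  have hKint : ∀ m x, Integrable (fun y => baseApprox m (x, y)) μ := fun m x =>
    integrable_of_abs_le (((measurable_baseApprox hp m)).comp
      (measurable_prodMk_left (x := x))) fun y => baseApprox_le m (x, y)
  have hKint2 : ∀ m x, Integrable
      (fun y => baseApprox m (x, y) * (g (Base.proj x) - g (Base.proj y)) ^ 2) μ := fun m x =>
    integrable_of_abs_le ((hmeas m).comp (measurable_prodMk_left (x := x))) fun y =>
      abs_baseApprox_mul_le (F := fun p => (g (Base.proj p.1) - g (Base.proj p.2)) ^ 2)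
        (fun p => hD _ _) (x, y)
  refine tendsto_integral_of_dominated_convergence (fun _ => 4 * C ^ 2) (fun m => ?_)
    (integrable_const _) (fun m => ?_) ?_
  · exact (hmeas m).stronglyMeasurable.integral_prod_right.aestronglyMeasurable
  · filter_upwards [ae_integral_baseApprox hp] with x hx
    rw [norm_eq_abs, abs_of_nonneg (integral_nonneg fun y =>
      mul_nonneg (baseApprox_nonneg _ _) (sq_nonneg _))]
    calc ∫ y, baseApprox m (x, y) * (g (Base.proj x) - g (Base.proj y)) ^ 2 ∂μ
        ≤ ∫ y, baseApprox m (x, y) * (4 * C ^ 2) ∂μ := by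
          refine integral_mono (hKint2 m x) ((hKint m x).mul_const _) fun y => ?_
          exact mul_le_mul_of_nonneg_left ((le_abs_self _).trans (hD _ _)) (baseApprox_nonneg _ _)
      _ = 4 * C ^ 2 := by rw [integral_mul_const, hx m, one_mul]
  · filter_upwards [ae_integral_baseApprox hp] with x hx
    -- the integral is at most `η + 4 C² (m + 1) cos^{2m} δ`
    rw [Metric.tendsto_atTop]
    intro ε hε
    obtain ⟨δ, hδ, hδg⟩ := Metric.continuous_iff.1 hg (Base.proj x) (√(ε / 2)) (by positivity)
    set δ' := min δ (π / 2) with hδ'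
    have hδ'0 : 0 < δ' := lt_min hδ (by positivity)
    have hδ'1 : δ' ≤ π / 2 := min_le_right _ _
    set c := cos δ' ^ 2 with hc
    have hcos0 : 0 ≤ cos δ' := cos_nonneg_of_mem_Icc ⟨by linarith [pi_pos], hδ'1⟩
    have hc0 : 0 ≤ c := sq_nonneg _
    have hc1 : c < 1 := by
      have : cos δ' < 1 := by
        rw [← cos_zero]
        exact cos_lt_cos_of_nonneg_of_le_pi le_rfl (by linarith [pi_pos]) hδ'0
      rw [hc]; nlinarith
    have hlim : Tendsto (fun m : ℕ => ((m : ℝ) + 1) * c ^ m * (4 * C ^ 2)) atTop (𝓝 0) := by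
      have h1 := (tendsto_self_mul_const_pow_of_lt_one hc0 hc1).add
        (tendsto_pow_atTop_nhds_zero_of_lt_one hc0 hc1)
      have h2 := h1.mul_const (4 * C ^ 2)
      simp only [add_zero, zero_mul] at h2
      refine h2.congr fun m => ?_
      ring
    obtain ⟨N, hN⟩ := (Metric.tendsto_atTop.1 hlim) (ε / 2) (by positivity)
    refine ⟨N, fun m hm => ?_⟩
    have hNm := hN m hm
    rw [dist_zero_right, norm_eq_abs, abs_of_nonneg (by positivity)] at hNm
    rw [dist_zero_right, norm_eq_abs, abs_of_nonneg (integral_nonneg fun y =>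
      mul_nonneg (baseApprox_nonneg _ _) (sq_nonneg _))]
    have hpt : ∀ y, baseApprox m (x, y) * (g (Base.proj x) - g (Base.proj y)) ^ 2 ≤
        baseApprox m (x, y) * (ε / 2) + ((m : ℝ) + 1) * c ^ m * (4 * C ^ 2) := by
      intro y
      rcases lt_or_ge (dist (Base.proj y) (Base.proj x)) δ' with hy | hy
      · have h1 := hδg (Base.proj y) (hy.trans_le (min_le_left _ _))
        have h2 : (g (Base.proj x) - g (Base.proj y)) ^ 2 ≤ ε / 2 := by
          rw [Real.dist_eq, abs_lt] at h1
          have h3 := sq_sqrt (by positivity : 0 ≤ ε / 2)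
          nlinarith
        have h3 := mul_le_mul_of_nonneg_left h2 (baseApprox_nonneg m (x, y))
        have h4 : 0 ≤ ((m : ℝ) + 1) * c ^ m * (4 * C ^ 2) := by positivity
        linarith
      · have h1 : ‖zeta x y‖ ≤ cos δ' := by
          rw [norm_zeta_eq_cos_dist, dist_comm]
          refine cos_le_cos_of_nonneg_of_le_pi hδ'0.le ?_ hy
          rw [dist_proj]
          linarith [SemimetricPair.r_le y x, pi_pos]
        have h2 : baseApprox m (x, y) ≤ (m + 1) * c ^ m := by
          unfold baseApprox
          rw [pow_mul, hc]
          gcongr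
        have h3 := mul_le_mul h2 ((le_abs_self _).trans (hD (Base.proj x) (Base.proj y)))
          (sq_nonneg _) (by positivity)
        have h4 : 0 ≤ baseApprox m (x, y) * (ε / 2) :=
          mul_nonneg (baseApprox_nonneg _ _) (by positivity)
        linarith
    calc ∫ y, baseApprox m (x, y) * (g (Base.proj x) - g (Base.proj y)) ^ 2 ∂μ
        ≤ ∫ y, (baseApprox m (x, y) * (ε / 2) + ((m : ℝ) + 1) * c ^ m * (4 * C ^ 2)) ∂μ :=
          integral_mono (hKint2 m x) (((hKint m x).mul_const _).add (integrable_const _)) hpt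
      _ = ε / 2 + ((m : ℝ) + 1) * c ^ m * (4 * C ^ 2) := by
          rw [integral_add ((hKint m x).mul_const _) (integrable_const _), integral_mul_const, hx m]
          simp
      _ < ε := by linarith

/-- By the density of the bounded continuous functions in `L²` the approximate identity works for
bounded measurable functions. -/
theorem tendsto_baseApprox_sub_sq (hp : IsHeatKernel μ (kernelP (M := M))) {f : Base M → ℝ}
    (hf : Measurable f) {C : ℝ} (hC : ∀ b, |f b| ≤ C) :
    Tendsto (fun m => ∫ p, baseApprox m p * (f (Base.proj p.1) - f (Base.proj p.2)) ^ 2 ∂(μ.prod μ))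
      atTop (𝓝 0) := by
  have : IsProbabilityMeasure (baseMeasure μ) :=
    Measure.isProbabilityMeasure_map measurable_proj.aemeasurable
  rw [Metric.tendsto_atTop]
  intro ε hε
  have hfL : MemLp f (ENNReal.ofReal 2) (baseMeasure μ) :=
    MemLp.of_bound hf.aestronglyMeasurable C (Eventually.of_forall hC)
  obtain ⟨g, hg, -⟩ := hfL.exists_boundedContinuous_integral_rpow_sub_le two_pos
    (by positivity : 0 < ε / 12)
  have hgC : ∀ b, |g b| ≤ ‖g‖ := g.norm_coe_le_norm
  obtain ⟨N, hN⟩ := Metric.tendsto_atTop.1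
    (tendsto_baseApprox_continuous hp g.continuous hgC) (ε / 12) (by positivity)
  refine ⟨N, fun m hm => ?_⟩
  have hNm := hN m hm
  have hnn : ∀ u : Base M → ℝ, 0 ≤ ∫ p : M × M,
      baseApprox m p * (u (Base.proj p.1) - u (Base.proj p.2)) ^ 2 ∂(μ.prod μ) := fun u =>
    integral_nonneg fun p => mul_nonneg (baseApprox_nonneg _ _) (sq_nonneg _)
  rw [dist_zero_right, norm_eq_abs, abs_of_nonneg (hnn _)] at hNm ⊢
  set D : M → ℝ := fun x => (f (Base.proj x) - g (Base.proj x)) ^ 2 with hDdef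
  have hfm : Measurable fun x : M => f (Base.proj x) := hf.comp measurable_proj
  have hgm : Measurable fun x : M => g (Base.proj x) := g.continuous.measurable.comp measurable_proj
  have hDm : Measurable D := (hfm.sub hgm).pow_const 2
  have hsq : ∀ u v A B : ℝ, |u| ≤ A → |v| ≤ B → |(u - v) ^ 2| ≤ (A + B) ^ 2 := by
    intro u v A B hu hv
    rw [abs_pow]
    exact pow_le_pow_left₀ (abs_nonneg _) ((abs_sub _ _).trans (add_le_add hu hv)) 2
  have hDC : ∀ x, |D x| ≤ (C + ‖g‖) ^ 2 := fun x => hsq _ _ _ _ (hC _) (hgC _)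
  have hDint : ∫ x, D x ∂μ ≤ ε / 12 := by
    refine le_trans (le_of_eq ?_) hg
    have hm : Measurable fun b : Base M => ‖f b - g b‖ ^ (2 : ℝ) :=
      (hf.sub g.continuous.measurable).norm.pow_const _
    rw [baseMeasure, integral_map measurable_proj.aemeasurable hm.aestronglyMeasurable]
    simp [hDdef]
  have i1 := integral_baseApprox_mul_fst hp m hDm hDC
  have i2 := integral_baseApprox_mul_snd hp m hDm hDC
  have hKm := measurable_baseApprox hp m
  have int1 : Integrable (fun p : M × M => baseApprox m p * D p.1) (μ.prod μ) :=
    integrable_of_abs_le (hKm.mul (hDm.comp measurable_fst))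
      (abs_baseApprox_mul_le (F := fun p => D p.1) fun p => hDC _)
  have int2 : Integrable (fun p : M × M => baseApprox m p * D p.2) (μ.prod μ) :=
    integrable_of_abs_le (hKm.mul (hDm.comp measurable_snd))
      (abs_baseApprox_mul_le (F := fun p => D p.2) fun p => hDC _)
  have int3 : ∀ u : Base M → ℝ, Measurable u → ∀ A, (∀ b, |u b| ≤ A) → Integrable
      (fun p : M × M => baseApprox m p * (u (Base.proj p.1) - u (Base.proj p.2)) ^ 2)
      (μ.prod μ) := fun u hu A hA =>
    integrable_of_abs_le (hKm.mul ((((hu.comp measurable_proj).comp measurable_fst).sub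
      ((hu.comp measurable_proj).comp measurable_snd)).pow_const 2))
      (abs_baseApprox_mul_le (F := fun p => (u (Base.proj p.1) - u (Base.proj p.2)) ^ 2)
        fun p => hsq _ _ _ _ (hA _) (hA _))
  have int3g := int3 g g.continuous.measurable _ hgC
  calc ∫ p : M × M, baseApprox m p * (f (Base.proj p.1) - f (Base.proj p.2)) ^ 2 ∂(μ.prod μ)
      ≤ ∫ p : M × M, 3 * (baseApprox m p * D p.1 + (baseApprox m p * D p.2 +
          baseApprox m p * (g (Base.proj p.1) - g (Base.proj p.2)) ^ 2)) ∂(μ.prod μ) := by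
        refine integral_mono (int3 f hf _ hC) ((int1.add (int2.add int3g)).const_mul 3) fun p => ?_
        have h0 := baseApprox_nonneg m p
        simp only [hDdef]
        rw [← mul_add, ← mul_add, mul_left_comm]
        refine mul_le_mul_of_nonneg_left ?_ h0
        set a := f (Base.proj p.1) - g (Base.proj p.1)
        set b := f (Base.proj p.2) - g (Base.proj p.2)
        set c := g (Base.proj p.1) - g (Base.proj p.2)
        have : f (Base.proj p.1) - f (Base.proj p.2) = a + c - b := by ring
        rw [this]
        nlinarith [sq_nonneg (a - c), sq_nonneg (a + b), sq_nonneg (b + c)]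
    _ = 3 * (∫ x, D x ∂μ + (∫ x, D x ∂μ +
          ∫ p : M × M, baseApprox m p * (g (Base.proj p.1) - g (Base.proj p.2)) ^ 2
            ∂(μ.prod μ))) := by
        rw [integral_const_mul]
        congr 1
        refine (integral_add int1 (int2.add int3g)).trans ?_
        rw [i1]
        congr 1
        refine (integral_add int2 int3g).trans ?_
        rw [i2]
    _ < ε := by linarith

theorem tendsto_baseApprox (hp : IsHeatKernel μ (kernelP (M := M))) {f : Base M → ℝ}
    (hf : Measurable f) {C : ℝ} (hC : ∀ b, |f b| ≤ C) :
    Tendsto (fun m => ∫ p, baseApprox m p * (f (Base.proj p.1) * f (Base.proj p.2)) ∂(μ.prod μ))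
      atTop (𝓝 (∫ x, f (Base.proj x) ^ 2 ∂μ)) := by
  have h := (tendsto_baseApprox_sub_sq hp hf hC).const_mul (-1 / 2)
  rw [mul_zero] at h
  have h' := h.add_const (∫ x, f (Base.proj x) ^ 2 ∂μ)
  rw [zero_add] at h'
  refine h'.congr fun m => ?_
  have hfm : Measurable fun x : M => f (Base.proj x) := hf.comp measurable_proj
  have hF2 : Measurable fun x : M => f (Base.proj x) ^ 2 := hfm.pow_const 2
  have hF2C : ∀ x : M, |f (Base.proj x) ^ 2| ≤ C ^ 2 := fun x => by
    rw [abs_pow]; exact pow_le_pow_left₀ (abs_nonneg _) (hC _) 2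
  have hKm := measurable_baseApprox hp m
  have i1 := integral_baseApprox_mul_fst hp m hF2 hF2C
  have i2 := integral_baseApprox_mul_snd hp m hF2 hF2C
  have int1 : Integrable (fun p : M × M => baseApprox m p * f (Base.proj p.1) ^ 2) (μ.prod μ) :=
    integrable_of_abs_le (hKm.mul (hF2.comp measurable_fst))
      (abs_baseApprox_mul_le (F := fun p => f (Base.proj p.1) ^ 2) fun p => hF2C _)
  have int2 : Integrable (fun p : M × M => baseApprox m p * f (Base.proj p.2) ^ 2) (μ.prod μ) :=
    integrable_of_abs_le (hKm.mul (hF2.comp measurable_snd))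
      (abs_baseApprox_mul_le (F := fun p => f (Base.proj p.2) ^ 2) fun p => hF2C _)
  have int3 : Integrable (fun p : M × M =>
      baseApprox m p * (f (Base.proj p.1) * f (Base.proj p.2))) (μ.prod μ) :=
    integrable_of_abs_le (hKm.mul ((hfm.comp measurable_fst).mul (hfm.comp measurable_snd)))
      (abs_baseApprox_mul_le (F := fun p => f (Base.proj p.1) * f (Base.proj p.2))
        (C := C * C) fun p => by
          rw [abs_mul]
          exact mul_le_mul (hC _) (hC _) (abs_nonneg _) ((abs_nonneg _).trans (hC (Base.proj p.1))))
  have e : ∀ p : M × M, baseApprox m p * (f (Base.proj p.1) - f (Base.proj p.2)) ^ 2 =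
      baseApprox m p * f (Base.proj p.1) ^ 2 + baseApprox m p * f (Base.proj p.2) ^ 2 -
        2 * (baseApprox m p * (f (Base.proj p.1) * f (Base.proj p.2))) := fun p => by ring
  have e2 := (integral_congr_ae (Eventually.of_forall e)).trans
    (integral_sub (int1.add int2) (int3.const_mul 2))
  have e3 : ∫ p : M × M, (baseApprox m p * f (Base.proj p.1) ^ 2 +
      baseApprox m p * f (Base.proj p.2) ^ 2) ∂(μ.prod μ) = _ := integral_add int1 int2
  rw [integral_const_mul, e3, i1, i2] at e2
  rw [e2]
  ring

end Disintegration

/-! ### Laws with vanishing angular moments -/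

section AngularMoments

/-- The part of `levelVal j` that depends on the modulus only. -/
def diagVal (j : ℕ) (ζ : ℂ) : ℝ :=
  ∑ q ∈ levelSet j, if q.1 = q.2 then (q.1 + q.2 + 1) * discVal q ζ else 0

/-- The squared norm of `diagVal j` for the uniform distribution on the disc. -/
def diagNorm (j : ℕ) : ℝ := ∑ q ∈ levelSet j, if q.1 = q.2 then ((q.1 : ℝ) + q.2 + 1) else 0

theorem levelVal_eq (j : ℕ) (ζ : ℂ) :
    levelVal j ζ = ∑ q ∈ levelSet j, (q.1 + q.2 + 1) * discVal q ζ := by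
  rw [levelVal]

theorem continuous_diagVal (j : ℕ) : Continuous (diagVal j) := by
  unfold diagVal
  refine continuous_finsetSum _ fun q _ => ?_
  split_ifs
  · exact (continuous_discVal q).const_mul _
  · exact continuous_const

theorem discVal_self_eq_of_norm_eq (k : ℕ) {ζ ξ : ℂ} (h : ‖ζ‖ = ‖ξ‖) :
    discVal (k, k) ζ = discVal (k, k) ξ := by
  have h1 := discVal_add 0 k ζ
  have h2 := discVal_add 0 k ξ
  rw [zero_add] at h1 h2
  rw [h1, h2, h, pow_zero, pow_zero]

theorem diagVal_eq_of_norm_eq (j : ℕ) {ζ ξ : ℂ} (h : ‖ζ‖ = ‖ξ‖) : diagVal j ζ = diagVal j ξ := by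
  refine Finset.sum_congr rfl fun q _ => ?_
  split_ifs with hq
  · obtain ⟨a, b⟩ := q
    obtain rfl : a = b := hq
    rw [discVal_self_eq_of_norm_eq a h]
  · rfl

variable {X : Type*} [MeasurableSpace X] {ν : Measure X} {f : X → ℂ}

/-- `diagVal j` is the orthogonal projection of `levelVal j` on the functions of the modulus. -/
theorem HasDiscMoments.integral_diagVal_mul [IsFiniteMeasure ν] (h : HasDiscMoments ν f)
    (hf : Measurable f) (hf1 : ∀ x, ‖f x‖ ≤ 1) (j : ℕ) {c : ℕ × ℕ → ℝ}
    (hc : ∀ k, c (k, k) = 2 * k + 1) :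
    ∫ x, diagVal j (f x) * ∑ q ∈ levelSet j, c q * discVal q (f x) ∂ν = diagNorm j := by
  have hi : ∀ q q', Integrable (fun x => discVal q (f x) * discVal q' (f x)) ν := fun q q' =>
    integrable_comp_disc hf hf1 ((continuous_discVal q).mul (continuous_discVal q'))
  have hi2 : ∀ q, Integrable (fun x =>
      (if q.1 = q.2 then (q.1 + q.2 + 1) * discVal q (f x) else 0) *
        ∑ q ∈ levelSet j, c q * discVal q (f x)) ν := fun q => by
    refine integrable_comp_disc hf hf1 (g := fun ζ =>
      (if q.1 = q.2 then (q.1 + q.2 + 1) * discVal q ζ else 0) *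
        ∑ q ∈ levelSet j, c q * discVal q ζ) (Continuous.mul ?_ ?_)
    · split_ifs
      · exact (continuous_discVal q).const_mul _
      · exact continuous_const
    · exact continuous_finsetSum _ fun q _ => (continuous_discVal q).const_mul _
  simp only [diagVal, Finset.sum_mul]
  rw [integral_finsetSum _ fun q _ => hi2 q, diagNorm]
  refine Finset.sum_congr rfl fun q hq => ?_
  split_ifs with hqq
  · obtain ⟨a, b⟩ := q
    obtain rfl : a = b := hqq
    have e : ∀ x, ((a : ℝ) + a + 1) * discVal (a, a) (f x) *
        ∑ q ∈ levelSet j, c q * discVal q (f x) =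
        ∑ q ∈ levelSet j, ((a + a + 1) * c q) * (discVal (a, a) (f x) * discVal q (f x)) := by
      intro x
      rw [Finset.mul_sum]
      exact Finset.sum_congr rfl fun q _ => by ring
    simp_rw [e]
    rw [integral_finsetSum _ fun q _ => (hi _ _).const_mul _]
    simp_rw [integral_const_mul, h.orthogonal]
    rw [Finset.sum_eq_single_of_mem _ hq fun q _ hne => by rw [if_neg hne, mul_zero], if_pos rfl,
      hc]
    have : (2 * a + 1 : ℝ) ≠ 0 := by positivity
    field_simp
  · simp

theorem HasDiscMoments.integral_diagVal_mul_levelVal [IsFiniteMeasure ν] (h : HasDiscMoments ν f)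
    (hf : Measurable f) (hf1 : ∀ x, ‖f x‖ ≤ 1) (j : ℕ) :
    ∫ x, diagVal j (f x) * levelVal j (f x) ∂ν = diagNorm j := by
  simp only [levelVal_eq]
  exact h.integral_diagVal_mul hf hf1 j (c := fun q => q.1 + q.2 + 1) fun k => by ring

theorem HasDiscMoments.integral_diagVal_sq [IsFiniteMeasure ν] (h : HasDiscMoments ν f)
    (hf : Measurable f) (hf1 : ∀ x, ‖f x‖ ≤ 1) (j : ℕ) :
    ∫ x, diagVal j (f x) ^ 2 ∂ν = diagNorm j := by
  rw [← h.integral_diagVal_mul hf hf1 j (c := fun q => if q.1 = q.2 then q.1 + q.2 + 1 else 0)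
    fun k => by simp; ring]
  refine integral_congr_ae (Eventually.of_forall fun x => ?_)
  simp only [pow_two, ite_mul, zero_mul]
  rfl

/-- The integral of a disc polynomial when the modulus is constant and the angular moments of order
less than `N` vanish. -/
theorem integral_discVal_of_moments [IsProbabilityMeasure ν] {ξ : ℂ}
    (hn : ∀ᵐ y ∂ν, ‖f y‖ = ‖ξ‖) {N : ℕ} (h0 : ∀ n, n ≠ 0 → n < N → ∫ y, (f y ^ n).re ∂ν = 0)
    {q : ℕ × ℕ} (hq : q.1 < q.2 + N) (hq' : q.2 < q.1 + N) :
    ∫ y, discVal q (f y) ∂ν = if q.1 = q.2 then discVal q ξ else 0 := by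
  have key : ∀ n k, n ≠ 0 → n < N → ∫ y, discVal (n + k, k) (f y) ∂ν = 0 := by
    intro n k hn0 hnN
    have : ∫ y, discVal (n + k, k) (f y) ∂ν =
        ∫ y, (f y ^ n).re * radialPoly n k (‖ξ‖ ^ 2) ∂ν := by
      refine integral_congr_ae ?_
      filter_upwards [hn] with y hy
      rw [discVal_add, hy]
    rw [this, integral_mul_const, h0 n hn0 hnN, zero_mul]
  obtain ⟨a, b⟩ := q
  simp only at hq hq' ⊢
  rcases lt_trichotomy a b with hab | rfl | hab
  · rw [if_neg hab.ne]
    obtain ⟨n, rfl⟩ := Nat.exists_eq_add_of_lt hab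
    rw [← key (n + 1) a (by omega) (by omega)]
    refine integral_congr_ae (Eventually.of_forall fun y => ?_)
    simp only
    rw [← discVal_swap, Prod.swap_prod_mk]
    congr 2; omega
  · rw [if_pos rfl]
    have : ∫ y, discVal (a, a) (f y) ∂ν = ∫ _, discVal (a, a) ξ ∂ν := by
      refine integral_congr_ae ?_
      filter_upwards [hn] with y hy
      rw [discVal_self_eq_of_norm_eq a hy]
    rw [this]; simp
  · rw [if_neg hab.ne']
    obtain ⟨n, rfl⟩ := Nat.exists_eq_add_of_lt hab
    rw [← key (n + 1) b (by omega) (by omega)]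
    refine integral_congr_ae (Eventually.of_forall fun y => ?_)
    simp only
    congr 2; omega

/-- If every level averages to its radial part, then all angular moments vanish: the level `n`
contains `z ^ n`, its conjugate, and polynomials of smaller angular frequency. -/
theorem integral_pow_re_eq_zero [IsProbabilityMeasure ν] (hf : Measurable f)
    (hf1 : ∀ x, ‖f x‖ ≤ 1) {ξ : ℂ} (hn : ∀ᵐ y ∂ν, ‖f y‖ = ‖ξ‖)
    (h : ∀ j, ∫ y, levelVal j (f y) ∂ν = diagVal j ξ) (n : ℕ) (hn0 : n ≠ 0) :
    ∫ y, (f y ^ n).re ∂ν = 0 := by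
  induction n using Nat.strong_induction_on with
  | _ n ih =>
  obtain ⟨j, rfl⟩ := Nat.exists_eq_succ_of_ne_zero hn0
  have hi : ∀ q, Integrable (fun y => ((q.1 : ℝ) + q.2 + 1) * discVal q (f y)) ν := fun q =>
    (integrable_comp_disc hf hf1 (continuous_discVal q)).const_mul _
  have h1 := h (j + 1)
  simp only [levelVal_eq] at h1
  rw [integral_finsetSum _ fun q _ => hi q, diagVal] at h1
  simp only [integral_const_mul] at h1
  rw [sum_levelSet_succ, sum_levelSet_succ] at h1
  have h2 : ∀ q ∈ (levelSet (j + 1)).filter (fun q => q.1 ≠ 0 ∧ q.2 ≠ 0),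
      ((q.1 : ℝ) + q.2 + 1) * ∫ y, discVal q (f y) ∂ν =
        if q.1 = q.2 then (q.1 + q.2 + 1) * discVal q ξ else 0 := by
    intro q hq
    have hlt := degree_lt_of_mem_levelSet hq
    rw [integral_discVal_of_moments (N := j + 1) hn (fun n hn hnj => ih n hnj hn) (by omega)
      (by omega)]
    split_ifs <;> simp
  rw [Finset.sum_congr rfl h2] at h1
  have h3 : ∀ ζ, discVal (0, j + 1) ζ = discVal (j + 1, 0) ζ := fun ζ => discVal_swap (j + 1, 0) ζ
  have h4 : ∀ ζ, discVal (j + 1, 0) ζ = (ζ ^ (j + 1)).re := fun ζ => by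
    simp [discVal]
  simp only [h3, h4] at h1
  simp only [Nat.succ_eq_add_one, Nat.cast_zero, show ¬ (j + 1 = 0) by omega,
    show ¬ (0 = j + 1) by omega, if_false] at h1 ⊢
  have h5 : (0 : ℝ) < ((j + 1 : ℕ) : ℝ) + 0 + 1 := by positivity
  have h6 : (((j + 1 : ℕ) : ℝ) + 0 + 1) * (2 * ∫ y, (f y ^ (j + 1)).re ∂ν) = 0 := by linarith
  have := (mul_eq_zero.1 h6).resolve_left h5.ne'
  linarith

/-- Averaging over the angles leaves only the diagonal part of a series of disc polynomials. -/
theorem hasSum_integral_discSum [IsProbabilityMeasure ν] (hf : Measurable f)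
    (hf1 : ∀ x, ‖f x‖ ≤ 1) {ξ : ℂ} (hn : ∀ᵐ y ∂ν, ‖f y‖ = ‖ξ‖)
    (h0 : ∀ n, n ≠ 0 → ∫ y, (f y ^ n).re ∂ν = 0) {c : ℕ × ℕ → ℝ} (hc : IsDiscWeight c) :
    HasSum (fun k : ℕ => c (k, k) * discVal (k, k) ξ) (∫ y, discSum c (f y) ∂ν) := by
  have h1 := hasSum_integral_of_bounded (ν := ν) (F := fun q y => c q * discVal q (f y))
    (G := fun y => discSum c (f y)) (b := fun q => |c q| * (q.1 + q.2 + 1))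
    (fun q => (((continuous_discVal q).measurable.comp hf).const_mul _).aestronglyMeasurable)
    hc (fun q y => norm_mul_discVal_le c (hf1 y) q) (fun y => hc.hasSum (hf1 y))
  have h2 : ∀ q : ℕ × ℕ, ∫ y, c q * discVal q (f y) ∂ν =
      if q.1 = q.2 then c q * discVal q ξ else 0 := by
    intro q
    rw [integral_const_mul, integral_discVal_of_moments (N := q.1 + q.2 + 1) hn
      (fun n hn _ => h0 n hn) (by omega) (by omega)]
    split_ifs <;> simp
  simp only [h2] at h1
  have hinj : Function.Injective fun k : ℕ => (k, k) := fun a b hab => (Prod.ext_iff.1 hab).1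
  rw [← hinj.hasSum_iff] at h1
  · simpa [Function.comp_def] using h1
  · rintro ⟨a, b⟩ hab
    simp only
    rw [if_neg]
    rintro rfl
    exact hab ⟨a, rfl⟩

end AngularMoments

/-! ### Averages of the levels over the fibres -/

section Averages

variable {M : Type*} [SemimetricPair M] [MeasurableSpace M] {μ : Measure M}
  {κ : Base M → Measure M}

theorem measurable_comp_zeta (hp : IsHeatKernel μ (kernelP (M := M))) {g : ℂ → ℝ}
    (hg : Measurable g) : Measurable fun p : M × M => g (zeta p.1 p.2) :=
  hg.comp (measurable_zeta hp)

/-- The average of a function over the fibres, as a function on the base. -/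
def fiberAverage (κ : Base M → Measure M) (F : M → ℝ) (b : Base M) : ℝ := ∫ y, F y ∂(κ b)

theorem IsDisintegration.measurable_fiberAverage (h : IsDisintegration μ κ) {F : M → ℝ}
    (hF : Measurable F) : Measurable (fiberAverage κ F) :=
  (h.measurable_integral (X := Unit) (F := fun p => F p.2) (hF.comp measurable_snd)).comp
    (measurable_const.prodMk measurable_id : Measurable fun b => ((), b))

theorem IsDisintegration.abs_fiberAverage_le (h : IsDisintegration μ κ) {F : M → ℝ} {C : ℝ}
    (hC : ∀ x, |F x| ≤ C) (b : Base M) : |fiberAverage κ F b| ≤ C := by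
  have := h.isProbabilityMeasure b
  exact abs_integral_le_of_abs_le hC

theorem integral_baseApprox_mul_comm [SFinite μ] (m : ℕ) (F G : M → ℝ) :
    ∫ p, baseApprox m p * (F p.1 * G p.2) ∂(μ.prod μ) =
      ∫ p, baseApprox m p * (G p.1 * F p.2) ∂(μ.prod μ) := by
  rw [← integral_prod_swap (f := fun p : M × M => baseApprox m p * (F p.1 * G p.2))]
  simp only [baseApprox_swap, Prod.fst_swap, Prod.snd_swap]
  exact integral_congr_ae (Eventually.of_forall fun p => by simp only; ring)

variable [BorelSpace M] [IsProbabilityMeasure μ]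

/-- Paired with the approximate identity, a level has at most the mass of its diagonal part. -/
theorem integral_baseApprox_levelVal_le [μ.Regular] (hp : IsHeatKernel μ (kernelP (M := M)))
    (m j : ℕ) :
    ∫ p, baseApprox m p * levelVal j (zeta p.1 p.2) ∂(μ.prod μ) ≤ diagNorm j := by
  obtain ⟨C, hC⟩ := exists_bound_of_continuous (continuous_levelVal j)
  have hlm := measurable_comp_zeta hp (continuous_levelVal j).measurable
  have hint : Integrable (fun p : M × M => baseApprox m p * levelVal j (zeta p.1 p.2))
      (μ.prod μ) := integrable_of_abs_le ((measurable_baseApprox hp m).mul hlm)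
    (abs_baseApprox_mul_le (F := fun p => levelVal j (zeta p.1 p.2))
      fun p => hC _ (norm_zeta_le _ _))
  rw [integral_prod _ hint, show diagNorm j = ∫ _, diagNorm j ∂μ by simp]
  refine integral_mono_ae hint.integral_prod_left (integrable_const _) ?_
  filter_upwards [ae_hasDiscMoments hp] with x hx
  have hi : ∀ q, Integrable (fun y => ((q.1 : ℝ) + q.2 + 1) * ((m + 1) *
      (‖zeta x y‖ ^ (2 * m) * discVal q (zeta x y)))) μ := fun q =>
    ((integrable_comp_disc (measurable_zeta_right hp x) (norm_zeta_le x)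
      (g := fun ζ => ‖ζ‖ ^ (2 * m) * discVal q ζ)
      ((continuous_norm.pow _).mul (continuous_discVal q))).const_mul _).const_mul _
  have e : ∀ y, baseApprox m (x, y) * levelVal j (zeta x y) =
      ∑ q ∈ levelSet j, ((q.1 : ℝ) + q.2 + 1) * ((m + 1) *
        (‖zeta x y‖ ^ (2 * m) * discVal q (zeta x y))) := by
    intro y
    rw [levelVal_eq, baseApprox, Finset.mul_sum]
    exact Finset.sum_congr rfl fun q _ => by ring
  simp only [e]
  rw [integral_finsetSum _ fun q _ => hi q]
  refine Finset.sum_le_sum fun q _ => ?_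
  rw [integral_const_mul, integral_const_mul]
  refine (mul_le_mul_of_nonneg_left (hx.norm_pow_mul_le m q) (by positivity)).trans (le_of_eq ?_)
  split_ifs <;> simp

/-- The approximate identity depends on the base points only, so that a factor may be averaged over
the fibres. -/
theorem IsDisintegration.integral_baseApprox_mul_average
    (hp : IsHeatKernel μ (kernelP (M := M))) (h : IsDisintegration μ κ) (m : ℕ) {F G : M → ℝ}
    (hF : Measurable F) {C : ℝ} (hC : ∀ x, |F x| ≤ C) (hG : Measurable G) {D : ℝ}
    (hD : ∀ x, |G x| ≤ D) :
    ∫ p, baseApprox m p * (F p.1 * G p.2) ∂(μ.prod μ) =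
      ∫ p, baseApprox m p * (F p.1 * fiberAverage κ G (Base.proj p.2)) ∂(μ.prod μ) := by
  have hint : ∀ H : M → ℝ, Measurable H → (∀ x, |H x| ≤ D) → Integrable
      (fun p : M × M => baseApprox m p * (F p.1 * H p.2)) (μ.prod μ) := fun H hH hHD =>
    integrable_of_abs_le ((measurable_baseApprox hp m).mul
      ((hF.comp measurable_fst).mul (hH.comp measurable_snd)))
      (abs_baseApprox_mul_le (F := fun p => F p.1 * H p.2) (C := C * D) fun p => by
        rw [abs_mul]
        exact mul_le_mul (hC _) (hHD _) (abs_nonneg _) ((abs_nonneg _).trans (hC p.1)))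
  have hE : Measurable fun x => fiberAverage κ G (Base.proj x) :=
    (h.measurable_fiberAverage hG).comp measurable_proj
  rw [integral_prod _ (hint G hG hD),
    integral_prod _ (hint _ hE fun x => h.abs_fiberAverage_le hD _)]
  refine integral_congr_ae (Eventually.of_forall fun x => ?_)
  have hK : Measurable fun y => baseApprox m (x, y) := by
    have := (measurable_baseApprox hp m).comp (measurable_prodMk_left (x := x))
    exact this
  have h1 := h.integral_mul_average hG hD hK (fun y => baseApprox_le m (x, y)) fun y y' hy => by
    unfold baseApprox
    rw [norm_zeta_eq_cos_dist, norm_zeta_eq_cos_dist, hy]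
  have e : ∀ H : M → ℝ, ∫ y, baseApprox m (x, y) * (F x * H y) ∂μ =
      F x * ∫ y, baseApprox m (x, y) * H y ∂μ := fun H => by
    rw [← integral_const_mul]
    exact integral_congr_ae (Eventually.of_forall fun y => by simp only; ring)
  simp only
  rw [e, e fun y => fiberAverage κ G (Base.proj y), h1]
  rfl

theorem IsDisintegration.integral_baseApprox_mul_self
    (hp : IsHeatKernel μ (kernelP (M := M))) (h : IsDisintegration μ κ) (m : ℕ) {F : M → ℝ}
    (hF : Measurable F) {C : ℝ} (hC : ∀ x, |F x| ≤ C) :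
    ∫ p, baseApprox m p * (F p.1 * F p.2) ∂(μ.prod μ) = ∫ p, baseApprox m p *
      (fiberAverage κ F (Base.proj p.1) * fiberAverage κ F (Base.proj p.2)) ∂(μ.prod μ) := by
  have hE : Measurable fun x => fiberAverage κ F (Base.proj x) :=
    (h.measurable_fiberAverage hF).comp measurable_proj
  rw [h.integral_baseApprox_mul_average hp m hF hC hF hC,
    integral_baseApprox_mul_comm m F fun x => fiberAverage κ F (Base.proj x),
    h.integral_baseApprox_mul_average hp m hE (fun x => h.abs_fiberAverage_le hC _) hF hC]

end Averages

/-! ### The levels average to their radial parts -/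

section RadialParts

variable {M : Type*} [SemimetricPair M] [MeasurableSpace M] {μ : Measure M}
  {κ : Base M → Measure M}

/-- The average of `levelVal j (zeta w ·)` over the fibre of `x`. -/
def levelAverage (κ : Base M → Measure M) (j : ℕ) (w x : M) : ℝ :=
  fiberAverage κ (fun y => levelVal j (zeta w y)) (Base.proj x)

theorem exists_abs_levelVal_zeta_le (M : Type*) [SemimetricPair M] (j : ℕ) :
    ∃ C, ∀ x y : M, |levelVal j (zeta x y)| ≤ C := by
  obtain ⟨C, hC⟩ := exists_bound_of_continuous (continuous_levelVal j)
  exact ⟨C, fun x y => hC _ (norm_zeta_le x y)⟩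

variable [BorelSpace M]

theorem IsDisintegration.measurable_levelAverage (hp : IsHeatKernel μ (kernelP (M := M)))
    (h : IsDisintegration μ κ) (j : ℕ) :
    Measurable fun z : M × M => levelAverage κ j z.1 z.2 := by
  have h1 := (h.measurable_integral (X := M)
    (measurable_comp_zeta hp (continuous_levelVal j).measurable)).comp
    (measurable_fst.prodMk (measurable_proj.comp measurable_snd) :
      Measurable fun z : M × M => (z.1, Base.proj z.2))
  exact h1

variable [IsProbabilityMeasure μ] [μ.Regular]

/-- The levels are idempotent, `∫ Φ_j(x, w) Φ_j(w, y) dμ(w) = Φ_j(x, y)`, and the approximate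
identity does not distinguish a level from its fibre average. -/
theorem IsDisintegration.integral_baseApprox_levelAverage_le
    (hp : IsHeatKernel μ (kernelP (M := M))) (h : IsDisintegration μ κ) (m j : ℕ) :
    ∫ w, ∫ p, baseApprox m p * (levelAverage κ j w p.1 * levelAverage κ j w p.2) ∂(μ.prod μ) ∂μ ≤
      diagNorm j := by
  obtain ⟨C, hC⟩ := exists_abs_levelVal_zeta_le M j
  have hlm := measurable_comp_zeta hp (continuous_levelVal j).measurable
  refine le_trans (le_of_eq ?_) (integral_baseApprox_levelVal_le hp m j)
  have h1 : ∀ w, ∫ p, baseApprox m p * (levelAverage κ j w p.1 * levelAverage κ j w p.2) ∂(μ.prod μ)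
      = ∫ p, baseApprox m p * (levelVal j (zeta p.1 w) * levelVal j (zeta w p.2)) ∂(μ.prod μ) := by
    intro w
    have hw : Measurable fun y => levelVal j (zeta w y) :=
      (continuous_levelVal j).measurable.comp (measurable_zeta_right hp w)
    have := h.integral_baseApprox_mul_self hp m hw (hC w)
    simp_rw [zeta_comm _ w]
    exact this.symm
  simp_rw [h1]
  have hm : Measurable fun q : (M × M) × M =>
      baseApprox m q.1 * (levelVal j (zeta q.1.1 q.2) * levelVal j (zeta q.2 q.1.2)) := by
    refine ((measurable_baseApprox hp m).comp measurable_fst).mul (Measurable.mul ?_ ?_)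
    · have := hlm.comp ((measurable_fst.comp measurable_fst).prodMk measurable_snd :
        Measurable fun q : (M × M) × M => (q.1.1, q.2))
      exact this
    · have := hlm.comp (measurable_snd.prodMk (measurable_snd.comp measurable_fst) :
        Measurable fun q : (M × M) × M => (q.2, q.1.2))
      exact this
  have hint : Integrable (Function.uncurry fun (p : M × M) (w : M) =>
      baseApprox m p * (levelVal j (zeta p.1 w) * levelVal j (zeta w p.2)))
      ((μ.prod μ).prod μ) :=
    integrable_of_abs_le hm (C := (m + 1) * (C * C)) fun q => by
      refine abs_baseApprox_mul_le (F := fun p => levelVal j (zeta p.1 q.2) *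
        levelVal j (zeta q.2 p.2)) (fun p => ?_) q.1
      rw [abs_mul]
      exact mul_le_mul (hC _ _) (hC _ _) (abs_nonneg _) ((abs_nonneg _).trans (hC p.1 p.1))
  rw [← integral_integral_swap hint]
  refine integral_congr_ae ?_
  filter_upwards [ae_integral_levelVal_mul hp] with p hpp
  rw [integral_const_mul, hpp j j, if_pos rfl]

theorem IsDisintegration.integral_levelAverage_sq_le
    (hp : IsHeatKernel μ (kernelP (M := M))) (h : IsDisintegration μ κ) (j : ℕ) :
    ∫ w, ∫ x, levelAverage κ j w x ^ 2 ∂μ ∂μ ≤ diagNorm j := by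
  obtain ⟨C, hC⟩ := exists_abs_levelVal_zeta_le M j
  have hE := h.measurable_levelAverage hp j
  have hEC : ∀ w x, |levelAverage κ j w x| ≤ C := fun w x => h.abs_fiberAverage_le (hC w) _
  refine le_of_tendsto' (f := fun m => ∫ w, ∫ p, baseApprox m p *
    (levelAverage κ j w p.1 * levelAverage κ j w p.2) ∂(μ.prod μ) ∂μ) (x := atTop) ?_
    fun m => h.integral_baseApprox_levelAverage_le hp m j
  have hwm : ∀ w, Measurable fun x => levelAverage κ j w x := fun w => by
    have := hE.comp (measurable_prodMk_left (x := w))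
    exact this
  have hm : ∀ m, Measurable fun q : M × (M × M) =>
      baseApprox m q.2 * (levelAverage κ j q.1 q.2.1 * levelAverage κ j q.1 q.2.2) := by
    intro m
    refine ((measurable_baseApprox hp m).comp measurable_snd).mul (Measurable.mul ?_ ?_)
    · have := hE.comp (measurable_fst.prodMk (measurable_fst.comp measurable_snd) :
        Measurable fun q : M × (M × M) => (q.1, q.2.1))
      exact this
    · have := hE.comp (measurable_fst.prodMk (measurable_snd.comp measurable_snd) :
        Measurable fun q : M × (M × M) => (q.1, q.2.2))
      exact this
  refine tendsto_integral_of_dominated_convergence (fun _ => C * C) (fun m => ?_)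
    (integrable_const _) (fun m => Eventually.of_forall fun w => ?_)
    (Eventually.of_forall fun w => ?_)
  · exact (hm m).stronglyMeasurable.integral_prod_right.aestronglyMeasurable
  · have h1 := integral_baseApprox_mul_fst hp m (G := fun _ => C * C) measurable_const
      (C := |C * C|) (fun _ => le_rfl)
    simp only [integral_const, probReal_univ, one_smul] at h1
    rw [← h1]
    refine norm_integral_le_of_norm_le ?_ (Eventually.of_forall fun p => ?_)
    · exact integrable_of_abs_le ((measurable_baseApprox hp m).mul measurable_const)
        (abs_baseApprox_mul_le (F := fun _ => C * C) fun _ => le_rfl)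
    · rw [norm_mul, norm_mul, norm_eq_abs, abs_of_nonneg (baseApprox_nonneg m p)]
      refine mul_le_mul_of_nonneg_left ?_ (baseApprox_nonneg m p)
      exact mul_le_mul (hEC _ _) (hEC _ _) (abs_nonneg _) ((abs_nonneg _).trans (hC w w))
  · exact tendsto_baseApprox hp (h.measurable_fiberAverage
      ((continuous_levelVal j).measurable.comp (measurable_zeta_right hp w)))
      (h.abs_fiberAverage_le (hC w))

/-- The average of a level over the fibres is its radial part. The approximate identity bounds the
norm of the average by the norm of the radial part, which is its projection. -/
theorem IsDisintegration.ae_levelAverage_eq (hp : IsHeatKernel μ (kernelP (M := M)))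
    (h : IsDisintegration μ κ) :
    ∀ᵐ z ∂(μ.prod μ), ∀ j, levelAverage κ j z.1 z.2 = diagVal j (zeta z.1 z.2) := by
  rw [ae_all_iff]
  intro j
  obtain ⟨C, hC⟩ := exists_abs_levelVal_zeta_le M j
  obtain ⟨D, hD⟩ := exists_bound_of_continuous (continuous_diagVal j)
  have hE := h.measurable_levelAverage hp j
  have hEC : ∀ w x, |levelAverage κ j w x| ≤ C := fun w x => h.abs_fiberAverage_le (hC w) _
  have hN := measurable_comp_zeta hp (continuous_diagVal j).measurable
  have hND : ∀ w x : M, |diagVal j (zeta w x)| ≤ D := fun w x => hD _ (norm_zeta_le w x)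
  have hsq : ∀ a b : ℝ, |a| ≤ C → |b| ≤ D → |(a - b) ^ 2| ≤ (C + D) ^ 2 := by
    intro a b ha hb
    rw [abs_pow]
    exact pow_le_pow_left₀ (abs_nonneg _) ((abs_sub _ _).trans (add_le_add ha hb)) 2
  have iE : Integrable (fun z : M × M => levelAverage κ j z.1 z.2 ^ 2) (μ.prod μ) :=
    integrable_of_abs_le (hE.pow_const 2) (C := C ^ 2) fun z => by
      rw [abs_pow]; exact pow_le_pow_left₀ (abs_nonneg _) (hEC _ _) 2
  have iN : Integrable (fun z : M × M => diagVal j (zeta z.1 z.2) ^ 2) (μ.prod μ) :=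
    integrable_of_abs_le (hN.pow_const 2) (C := D ^ 2) fun z => by
      rw [abs_pow]; exact pow_le_pow_left₀ (abs_nonneg _) (hND _ _) 2
  have iNE : Integrable (fun z : M × M => diagVal j (zeta z.1 z.2) * levelAverage κ j z.1 z.2)
      (μ.prod μ) :=
    integrable_of_abs_le (hN.mul hE) (C := D * C) fun z => by
      rw [abs_mul]
      exact mul_le_mul (hND _ _) (hEC _ _) (abs_nonneg _) ((abs_nonneg _).trans (hND z.1 z.1))
  have iD : Integrable (fun z : M × M => (levelAverage κ j z.1 z.2 - diagVal j (zeta z.1 z.2)) ^ 2)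
      (μ.prod μ) :=
    integrable_of_abs_le ((hE.sub hN).pow_const 2) fun z => hsq _ _ (hEC _ _) (hND _ _)
  have vE : ∫ z : M × M, levelAverage κ j z.1 z.2 ^ 2 ∂(μ.prod μ) ≤ diagNorm j := by
    rw [integral_prod _ iE]; exact h.integral_levelAverage_sq_le hp j
  have vN : ∫ z : M × M, diagVal j (zeta z.1 z.2) ^ 2 ∂(μ.prod μ) = diagNorm j := by
    rw [integral_prod _ iN, show diagNorm j = ∫ _, diagNorm j ∂μ by simp]
    refine integral_congr_ae ?_
    filter_upwards [ae_hasDiscMoments hp] with x hx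
    exact hx.integral_diagVal_sq (measurable_zeta_right hp x) (norm_zeta_le x) j
  have vNE : ∫ z : M × M, diagVal j (zeta z.1 z.2) * levelAverage κ j z.1 z.2 ∂(μ.prod μ) =
      diagNorm j := by
    rw [integral_prod _ iNE, show diagNorm j = ∫ _, diagNorm j ∂μ by simp]
    refine integral_congr_ae ?_
    filter_upwards [ae_hasDiscMoments hp] with w hw
    have hzw := measurable_zeta_right hp w
    have h1 := h.integral_mul_average (F := fun y => levelVal j (zeta w y))
      (G := fun y => diagVal j (zeta w y)) ((continuous_levelVal j).measurable.comp hzw) (hC w)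
      ((continuous_diagVal j).measurable.comp hzw) (hND w) fun x x' hx => by
        refine diagVal_eq_of_norm_eq j ?_
        rw [norm_zeta_eq_cos_dist, norm_zeta_eq_cos_dist, hx]
    rw [hw.integral_diagVal_mul_levelVal hzw (norm_zeta_le w) j] at h1
    exact h1.symm
  have v0 : ∫ z : M × M, (levelAverage κ j z.1 z.2 - diagVal j (zeta z.1 z.2)) ^ 2 ∂(μ.prod μ) =
      0 := by
    refine le_antisymm ?_ (integral_nonneg fun z => sq_nonneg _)
    have e : ∀ z : M × M, (levelAverage κ j z.1 z.2 - diagVal j (zeta z.1 z.2)) ^ 2 =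
        levelAverage κ j z.1 z.2 ^ 2 - (2 * (diagVal j (zeta z.1 z.2) * levelAverage κ j z.1 z.2) -
          diagVal j (zeta z.1 z.2) ^ 2) := fun z => by ring
    have e1 := (integral_congr_ae (Eventually.of_forall e)).trans
      (integral_sub iE ((iNE.const_mul 2).sub iN))
    have e2 : ∫ z : M × M, (2 * (diagVal j (zeta z.1 z.2) * levelAverage κ j z.1 z.2) -
        diagVal j (zeta z.1 z.2) ^ 2) ∂(μ.prod μ) = _ := integral_sub (iNE.const_mul 2) iN
    rw [integral_const_mul, vN, vNE] at e2
    rw [e1]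
    have e3 : ∫ z : M × M, ((fun z : M × M => 2 * (diagVal j (zeta z.1 z.2) *
      levelAverage κ j z.1 z.2)) - fun z : M × M => diagVal j (zeta z.1 z.2) ^ 2) z ∂(μ.prod μ) =
        _ := e2
    linarith
  have h0 := (integral_eq_zero_iff_of_nonneg (fun z => sq_nonneg _) iD).1 v0
  filter_upwards [h0] with z hz
  have : (levelAverage κ j z.1 z.2 - diagVal j (zeta z.1 z.2)) ^ 2 = 0 := hz
  have := pow_eq_zero_iff two_ne_zero |>.1 this
  linarith

/-- Pairs of a point `x` and a fibre `b` for which the angles from `x` to the points of `b` are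
defined and have vanishing moments. -/
structure IsAngularlyUniform (κ : Base M → Measure M) (x : M) (b : Base M) : Prop where
  fiber : ∀ᵐ y ∂(κ b), Base.proj y = b
  moments : ∀ n, n ≠ 0 → ∫ y, (zeta x y ^ n).re ∂(κ b) = 0
  cos_ne_zero : cos (dist (Base.proj x) b) ≠ 0

theorem IsDisintegration.ae_isAngularlyUniform (hp : IsHeatKernel μ (kernelP (M := M)))
    (h : IsDisintegration μ κ) :
    ∀ᵐ z ∂(μ.prod (baseMeasure μ)), IsAngularlyUniform κ z.1 z.2 := by
  refine h.ae_of_ae_proj ?_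
  have h1 : ∀ᵐ x ∂μ, ∀ᵐ y ∂(κ (Base.proj x)), Base.proj y = Base.proj x :=
    ae_of_ae_map measurable_proj.aemeasurable h.ae_proj_eq
  have h2 : ∀ᵐ z ∂(μ.prod μ), zeta z.1 z.2 ≠ 0 := by
    refine (Measure.ae_prod_iff_ae_ae ?_).2 ?_
    · exact (measurable_zeta hp (measurableSet_singleton 0)).compl
    · filter_upwards [ae_hasDiscMoments hp] with x hx
      exact hx.ae_ne_zero (measurable_zeta_right hp x) (norm_zeta_le x)
  filter_upwards [h.ae_levelAverage_eq hp, Measure.quasiMeasurePreserving_snd.ae h1, h2] with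
    z hz hz1 hz2
  have := h.isProbabilityMeasure (Base.proj z.2)
  refine ⟨hz1, fun n hn => ?_, ?_⟩
  · refine integral_pow_re_eq_zero (measurable_zeta_right hp z.1) (norm_zeta_le z.1)
      (ξ := zeta z.1 z.2) ?_ (fun j => hz j) n hn
    filter_upwards [hz1] with y hy
    rw [norm_zeta_eq_cos_dist, norm_zeta_eq_cos_dist, hy]
  · rw [← norm_zeta_eq_cos_dist]
    exact norm_ne_zero_iff.2 hz2

end RadialParts

/-! ### The radial kernel -/

section RadialKernel

/-- The weights of `pWeight t` on the diagonal. -/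
def diagWeight (t : ℝ) (q : ℕ × ℕ) : ℝ := if q.1 = q.2 then pWeight t q else 0

theorem isDiscWeight_diagWeight {t : ℝ} (ht : 0 < t) : IsDiscWeight (diagWeight t) := by
  refine Summable.of_nonneg_of_le (fun q => by positivity) (fun q => ?_) (isDiscWeight_pWeight ht)
  refine mul_le_mul_of_nonneg_right ?_ (by positivity)
  unfold diagWeight
  split_ifs
  · rfl
  · rw [abs_zero]; exact abs_nonneg _

theorem pWeight_self (t : ℝ) (k : ℕ) :
    pWeight t (k, k) = exp (-(4 * k * (k + 1)) * t) * (2 * k + 1) := by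
  rw [pWeight, discLevel, ← exp_nat_mul, mul_comm]
  congr 1
  · congr 1; push_cast; ring
  · push_cast; ring

theorem qWeight_self (t : ℝ) (k : ℕ) : qWeight t (k, k) = pWeight t (k, k) := by
  rw [pWeight_self, qWeight, mul_comm]
  congr 1
  · congr 1; push_cast; ring
  · push_cast; ring

/-- The kernel `∑ e^{-4k(k+1)t} (2k+1) P_k^{0,0}(cos 2r)` with `r = dist a b`, written as a series
of disc polynomials at `cos r` (see `hasSum_radialKernel`). -/
def radialKernel {B : Type*} [Dist B] (t : ℝ) (a b : B) : ℝ :=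
  discSum (diagWeight t) (cos (dist a b) : ℂ)

theorem hasSum_discSum_diagWeight {t : ℝ} (ht : 0 < t) {ξ : ℂ} (hξ : ‖ξ‖ ≤ 1) :
    HasSum (fun k : ℕ => pWeight t (k, k) * discVal (k, k) ξ) (discSum (diagWeight t) ξ) := by
  have h1 := (isDiscWeight_diagWeight ht).hasSum hξ
  have hinj : Function.Injective fun k : ℕ => (k, k) := fun a b hab => (Prod.ext_iff.1 hab).1
  rw [← hinj.hasSum_iff] at h1
  · simpa [Function.comp_def, diagWeight] using h1
  · rintro ⟨a, b⟩ hab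
    simp only [diagWeight]
    rw [if_neg, zero_mul]
    rintro rfl
    exact hab ⟨a, rfl⟩

theorem discVal_self_eq_jacobi (k : ℕ) (r : ℝ) :
    discVal (k, k) (cos r : ℂ) = jacobi 0 k (cos (2 * r)) := by
  have h := discVal_add 0 k (cos r : ℂ)
  rw [zero_add] at h
  rw [h, cos_two_mul, jacobi_eq_radialPoly 0 k (Or.inr rfl),
    Complex.norm_real, norm_eq_abs, sq_abs, pow_zero, Complex.one_re, one_mul]

theorem norm_ofReal_cos_le (r : ℝ) : ‖(cos r : ℂ)‖ ≤ 1 := by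
  rw [Complex.norm_real]; exact abs_cos_le_one r

variable {B : Type*}

theorem hasSum_radialKernel [Dist B] {t : ℝ} (ht : 0 < t) (a b : B) :
    HasSum (fun k : ℕ => exp (-(4 * k * (k + 1)) * t) * ((2 * k + 1) *
      jacobi 0 k (cos (2 * dist a b)))) (radialKernel t a b) := by
  refine (hasSum_discSum_diagWeight ht (norm_ofReal_cos_le _)).congr_fun fun k => ?_
  rw [discVal_self_eq_jacobi, pWeight_self]; ring

theorem radialKernel_comm [PseudoMetricSpace B] (t : ℝ) (a b : B) :
    radialKernel t a b = radialKernel t b a := by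
  rw [radialKernel, radialKernel, dist_comm]

theorem exists_abs_radialKernel_le (B : Type*) [Dist B] {t : ℝ} (ht : 0 < t) :
    ∃ C, ∀ a b : B, |radialKernel t a b| ≤ C :=
  ⟨_, fun _ _ => (isDiscWeight_diagWeight ht).abs_discSum_le (norm_ofReal_cos_le _)⟩

theorem measurable_radialKernel [PseudoMetricSpace B] [MeasurableSpace B] [OpensMeasurableSpace B]
    (t : ℝ) (a : B) : Measurable fun b => radialKernel t a b := by
  have : Continuous fun b : B => (cos (dist a b) : ℂ) := by fun_prop
  exact (measurable_discSum _).comp this.measurable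

end RadialKernel

/-! ### Fibre averages of the kernels -/

section FiberAverages

variable {M : Type*} [SemimetricPair M] [MeasurableSpace M] {μ : Measure M}
  {κ : Base M → Measure M}

theorem exists_abs_kernelP_le (M : Type*) [SemimetricPair M] {t : ℝ} (ht : 0 < t) :
    ∃ C, ∀ x y : M, |kernelP t x y| ≤ C :=
  ⟨_, fun x y => by
    rw [kernelP_eq ht]; exact (isDiscWeight_pWeight ht).abs_discSum_le (norm_zeta_le x y)⟩

theorem exists_abs_kernelQ_le (M : Type*) [SemimetricPair M] {t : ℝ} (ht : 0 < t) :
    ∃ C, ∀ x y : M, |kernelQ t x y| ≤ C :=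
  ⟨_, fun x y => by
    rw [kernelQ_eq ht]; exact (isDiscWeight_qWeight ht).abs_discSum_le (norm_zeta_le x y)⟩

theorem measurable_kernelQ (hp : IsHeatKernel μ (kernelP (M := M))) {t : ℝ} (ht : 0 < t) :
    Measurable fun z : M × M => kernelQ t z.1 z.2 := by
  simp only [kernelQ_eq ht]
  exact measurable_comp_zeta hp (measurable_discSum _)

/-- The fibre average of a kernel depends only on its diagonal weights. The kernels `p` and `q` have
the same diagonal weights, hence the same fibre averages. -/
theorem IsAngularlyUniform.integral_discSum (hp : IsHeatKernel μ (kernelP (M := M)))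
    (h : IsDisintegration μ κ) {x : M} {b : Base M} (hu : IsAngularlyUniform κ x b) {t : ℝ}
    (ht : 0 < t) {c : ℕ × ℕ → ℝ} (hc : IsDiscWeight c) (hcp : ∀ k, c (k, k) = pWeight t (k, k)) :
    ∫ y, discSum c (zeta x y) ∂(κ b) = radialKernel t (Base.proj x) b := by
  have := h.isProbabilityMeasure b
  have h1 := hasSum_integral_discSum (ν := κ b) (f := fun y => zeta x y)
    (ξ := (cos (dist (Base.proj x) b) : ℂ)) (measurable_zeta_right hp x) (norm_zeta_le x) (by
      filter_upwards [hu.fiber] with y hy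
      rw [norm_zeta_eq_cos_dist, hy, Complex.norm_real, norm_eq_abs,
        abs_of_nonneg]
      rw [← hy, ← norm_zeta_eq_cos_dist]
      exact norm_nonneg _) hu.moments hc
  simp only [hcp] at h1
  exact h1.unique (hasSum_discSum_diagWeight ht (norm_ofReal_cos_le _))

theorem IsAngularlyUniform.integral_kernelP (hp : IsHeatKernel μ (kernelP (M := M)))
    (h : IsDisintegration μ κ) {x : M} {b : Base M} (hu : IsAngularlyUniform κ x b) {t : ℝ}
    (ht : 0 < t) : ∫ y, kernelP t x y ∂(κ b) = radialKernel t (Base.proj x) b := by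
  simp only [kernelP_eq ht]
  exact hu.integral_discSum hp h ht (isDiscWeight_pWeight ht) fun k => rfl

theorem IsAngularlyUniform.integral_kernelQ (hp : IsHeatKernel μ (kernelP (M := M)))
    (h : IsDisintegration μ κ) {x : M} {b : Base M} (hu : IsAngularlyUniform κ x b) {t : ℝ}
    (ht : 0 < t) : ∫ y, kernelQ t x y ∂(κ b) = radialKernel t (Base.proj x) b := by
  simp only [kernelQ_eq ht]
  exact hu.integral_discSum hp h ht (isDiscWeight_qWeight ht) (qWeight_self t)

theorem IsAngularlyUniform.integral_cos_eq_zero {x : M} {b : Base M}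
    (hu : IsAngularlyUniform κ x b) {n : ℕ} (hn : n ≠ 0) :
    ∫ y, cos (n * SemimetricPair.theta x y) ∂(κ b) = 0 := by
  have h1 : ∫ y, (zeta x y ^ n).re ∂(κ b) =
      ∫ y, cos (dist (Base.proj x) b) ^ n * cos (n * SemimetricPair.theta x y) ∂(κ b) := by
    refine integral_congr_ae ?_
    filter_upwards [hu.fiber] with y hy
    rw [zeta_pow_re, ← dist_proj, hy]
  rw [hu.moments n hn, integral_const_mul] at h1
  exact (mul_eq_zero.1 h1.symm).resolve_left (pow_ne_zero n hu.cos_ne_zero)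

/-- A property of `π x` that holds for almost all `x` holds almost everywhere on the base, whether
or not it is measurable. -/
theorem IsDisintegration.ae_base_of_ae (h : IsDisintegration μ κ) {P : Base M → Prop}
    (hP : ∀ᵐ x ∂μ, P (Base.proj x)) : ∀ᵐ b ∂(baseMeasure μ), P b := by
  rw [← h.comp_eq] at hP
  filter_upwards [Measure.ae_ae_of_ae_comp hP, h.ae_proj_eq] with b hb hb'
  have := h.isProbabilityMeasure b
  obtain ⟨x, hx1, hx2⟩ := (show ∀ᵐ x ∂(κ b), P (Base.proj x) from hb).and hb' |>.exists
  rwa [hx2] at hx1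

theorem IsDisintegration.ae_base_prod_of_ae [SFinite μ] (h : IsDisintegration μ κ) {X : Type*}
    [MeasurableSpace X] {ρ : Measure X} [SFinite ρ] {P : Base M → X → Prop}
    (hP : ∀ᵐ z ∂(μ.prod ρ), P (Base.proj z.1) z.2) :
    ∀ᵐ z ∂((baseMeasure μ).prod ρ), P z.1 z.2 := by
  filter_upwards [h.ae_prod_left (P := fun x w => P (Base.proj x) w) hP,
    Measure.quasiMeasurePreserving_fst.ae h.ae_proj_eq] with z hz hz2
  have := h.isProbabilityMeasure z.1
  obtain ⟨x, hx1, hx2⟩ := (hz.and hz2).exists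
  rwa [hx2] at hx1

theorem IsDisintegration.measurable_averagedKernelQ (hp : IsHeatKernel μ (kernelP (M := M)))
    (h : IsDisintegration μ κ) {t : ℝ} (ht : 0 < t) :
    Measurable fun z : Base M × Base M => averagedKernelQ κ t z.1 z.2 := by
  have h1 := h.measurable_integral (X := M) (measurable_kernelQ hp ht)
  have h2 := h.measurable_integral (X := Base M)
    (F := fun p => ∫ y, kernelQ t p.2 y ∂(κ p.1)) (h1.comp measurable_swap)
  exact h2.comp measurable_swap

variable [BorelSpace M] [IsProbabilityMeasure μ] [μ.Regular]

theorem IsDisintegration.ae_base_isAngularlyUniform (hp : IsHeatKernel μ (kernelP (M := M)))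
    (h : IsDisintegration μ κ) : ∀ᵐ z ∂((baseMeasure μ).prod (baseMeasure μ)),
      ∀ᵐ x ∂(κ z.1), Base.proj x = z.1 ∧ IsAngularlyUniform κ x z.2 := by
  filter_upwards [h.ae_prod_left (h.ae_isAngularlyUniform hp),
    Measure.quasiMeasurePreserving_fst.ae h.ae_proj_eq] with z hz1 hz2
  exact hz2.and hz1

theorem IsDisintegration.ae_averagedKernelQ_eq (hp : IsHeatKernel μ (kernelP (M := M)))
    (h : IsDisintegration μ κ) : ∀ᵐ z ∂((baseMeasure μ).prod (baseMeasure μ)), ∀ t > 0,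
      averagedKernelQ κ t z.1 z.2 = radialKernel t z.1 z.2 := by
  filter_upwards [h.ae_base_isAngularlyUniform hp] with z hz t ht
  have := h.isProbabilityMeasure z.1
  have h1 : averagedKernelQ κ t z.1 z.2 = ∫ _, radialKernel t z.1 z.2 ∂(κ z.1) := by
    refine integral_congr_ae ?_
    filter_upwards [hz] with x hx
    rw [hx.2.integral_kernelQ hp h ht, hx.1]
  rw [h1]; simp

theorem IsDisintegration.ae_averagedTheta₂_eq (hp : IsHeatKernel μ (kernelP (M := M)))
    (h : IsDisintegration μ κ) : ∀ᵐ z ∂((baseMeasure μ).prod (baseMeasure μ)), ∀ n : ℕ,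
      averagedTheta₂ κ n z.1 z.2 = if n = 0 then 1 else 0 := by
  filter_upwards [h.ae_base_isAngularlyUniform hp] with z hz n
  unfold averagedTheta₂
  split_ifs with hn
  · rfl
  · have h1 : ∫ x, ∫ y, cos (n * SemimetricPair.theta x y) ∂(κ z.2) ∂(κ z.1) =
        ∫ _, (0 : ℝ) ∂(κ z.1) := by
      refine integral_congr_ae ?_
      filter_upwards [hz] with x hx
      exact hx.2.integral_cos_eq_zero hn
    rw [h1]; simp

theorem IsDisintegration.ae_averagedTheta_eq (hp : IsHeatKernel μ (kernelP (M := M)))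
    (h : IsDisintegration μ κ) : ∀ᵐ z ∂(μ.prod (baseMeasure μ)), ∀ n : ℕ,
      averagedTheta κ n z.1 z.2 = if n = 0 then 1 else 0 := by
  filter_upwards [h.ae_isAngularlyUniform hp] with z hz n
  unfold averagedTheta
  split_ifs with hn
  · rfl
  · rw [hz.integral_cos_eq_zero hn, mul_zero]

/-! ### The radial kernel is a heat kernel of the base -/

theorem IsDisintegration.ae_radialKernel_nonneg (hp : IsHeatKernel μ (kernelP (M := M)))
    (h : IsDisintegration μ κ) : ∀ᵐ z ∂((baseMeasure μ).prod (baseMeasure μ)), ∀ t > 0,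
      0 ≤ radialKernel t z.1 z.2 := by
  refine h.ae_base_prod_of_ae (P := fun a b => ∀ t > 0, 0 ≤ radialKernel t a b) ?_
  filter_upwards [h.ae_isAngularlyUniform hp,
    h.ae_prod_right (P := fun x y => ∀ t > 0, 0 ≤ kernelP t x y) hp.nonneg] with z hz hz1 t ht
  rw [← hz.integral_kernelP hp h ht]
  refine integral_nonneg_of_ae ?_
  filter_upwards [hz1] with y hy using hy t ht

/-- Against functions of the base point, the kernel `p` acts as the radial kernel of the base. -/
theorem IsDisintegration.integral_mul_radialKernel (hp : IsHeatKernel μ (kernelP (M := M)))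
    (h : IsDisintegration μ κ) : ∀ᵐ x ∂μ, ∀ f : Base M → ℝ, ∀ t > 0,
      Integrable (fun y => f (Base.proj y) * kernelP t x y) μ →
        ∫ b, f b * radialKernel t (Base.proj x) b ∂(baseMeasure μ) =
          ∫ y, f (Base.proj y) * kernelP t x y ∂μ := by
  filter_upwards [Measure.ae_ae_of_ae_prod (h.ae_isAngularlyUniform hp)] with x hx f t ht hint
  rw [h.integral_eq hint]
  refine integral_congr_ae ?_
  filter_upwards [hx] with b hb
  rw [← hb.integral_kernelP hp h ht, ← integral_const_mul]
  refine integral_congr_ae ?_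
  filter_upwards [hb.fiber] with y hy
  rw [hy]

theorem IsDisintegration.ae_integral_radialKernel (hp : IsHeatKernel μ (kernelP (M := M)))
    (h : IsDisintegration μ κ) :
    ∀ᵐ a ∂(baseMeasure μ), ∀ t > 0, ∫ b, radialKernel t a b ∂(baseMeasure μ) = 1 := by
  refine h.ae_base_of_ae (P := fun a => ∀ t > 0, ∫ b, radialKernel t a b ∂(baseMeasure μ) = 1) ?_
  filter_upwards [h.integral_mul_radialKernel hp, hp.conservative] with x hx hx1 t ht
  have := hx (fun _ => 1) t ht (by simpa using (hx1 t ht).1)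
  simp only [one_mul] at this
  rw [this, (hx1 t ht).2]

/-- The fibre average over `y` of the semigroup property of `p_t(x, y)`. -/
theorem IsDisintegration.ae_radialKernel_semigroup (hp : IsHeatKernel μ (kernelP (M := M)))
    (h : IsDisintegration μ κ) : ∀ᵐ z ∂((baseMeasure μ).prod (baseMeasure μ)),
      ∀ s > 0, ∀ t > 0, radialKernel (s + t) z.1 z.2 =
        ∫ c, radialKernel s z.1 c * radialKernel t c z.2 ∂(baseMeasure μ) := by
  refine h.ae_base_prod_of_ae (P := fun a b => ∀ s > 0, ∀ t > 0, radialKernel (s + t) a b =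
    ∫ c, radialKernel s a c * radialKernel t c b ∂(baseMeasure μ)) ?_
  have hu := h.ae_isAngularlyUniform hp
  have hu' : ∀ᵐ b ∂(baseMeasure μ), ∀ᵐ w ∂μ, IsAngularlyUniform κ w b :=
    Measure.ae_ae_of_ae_prod (p := fun z : Base M × M => IsAngularlyUniform κ z.2 z.1)
      (Measure.measurePreserving_swap.quasiMeasurePreserving.ae hu)
  filter_upwards [hu, Measure.quasiMeasurePreserving_snd.ae hu',
    Measure.quasiMeasurePreserving_fst.ae (h.integral_mul_radialKernel hp),
    h.ae_prod_right (P := fun x y => ∀ s > 0, ∀ t > 0,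
      Integrable (fun w => kernelP s x w * kernelP t w y) μ ∧
      kernelP (s + t) x y = ∫ w, kernelP s x w * kernelP t w y ∂μ) hp.semigroup] with
    z hz hzb hzx hzs s hs t ht
  obtain ⟨x, b⟩ := z
  simp only at hz hzb hzx hzs ⊢
  have := h.isProbabilityMeasure b
  obtain ⟨C, hC⟩ := exists_abs_kernelP_le M hs
  obtain ⟨D, hD⟩ := exists_abs_kernelP_le M ht
  obtain ⟨E, hE⟩ := exists_abs_radialKernel_le (Base M) ht
  have hmx : Measurable fun w => kernelP s x w := measurable_kernelP_right hp hs x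
  have hint : Integrable (Function.uncurry fun y w => kernelP s x w * kernelP t w y)
      ((κ b).prod μ) := by
    refine integrable_of_abs_le (C := C * D) ?_ fun p => ?_
    · have h1 := (hmx.comp measurable_snd).mul ((hp.measurable t ht).comp
        (measurable_swap : Measurable (Prod.swap : M × M → M × M)))
      exact h1
    · simp only [Function.uncurry]
      rw [abs_mul]
      exact mul_le_mul (hC _ _) (hD _ _) (abs_nonneg _) ((abs_nonneg _).trans (hC x x))
  have hint2 : Integrable (fun w => radialKernel t (Base.proj w) b * kernelP s x w) μ := by
    refine integrable_of_abs_le (C := E * C) ?_ fun w => ?_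
    · simp only [radialKernel_comm t _ b]
      exact ((measurable_radialKernel t b).comp measurable_proj).mul hmx
    · rw [abs_mul]
      exact mul_le_mul (hE _ _) (hC _ _) (abs_nonneg _) ((abs_nonneg _).trans (hE b b))
  calc radialKernel (s + t) (Base.proj x) b = ∫ y, kernelP (s + t) x y ∂(κ b) :=
        (hz.integral_kernelP hp h (by positivity)).symm
    _ = ∫ y, ∫ w, kernelP s x w * kernelP t w y ∂μ ∂(κ b) := by
        refine integral_congr_ae ?_
        filter_upwards [hzs] with y hy using (hy s hs t ht).2
    _ = ∫ w, ∫ y, kernelP s x w * kernelP t w y ∂(κ b) ∂μ := integral_integral_swap hint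
    _ = ∫ w, radialKernel t (Base.proj w) b * kernelP s x w ∂μ := by
        refine integral_congr_ae ?_
        filter_upwards [hzb] with w hw
        rw [integral_const_mul, hw.integral_kernelP hp h ht, mul_comm]
    _ = ∫ c, radialKernel t c b * radialKernel s (Base.proj x) c ∂(baseMeasure μ) :=
        (hzx (fun c => radialKernel t c b) s hs hint2).symm
    _ = _ := by simp only [mul_comm]

/-- Almost everywhere the averaged kernel is the radial kernel, which inherits the properties of
`p`. The measurability concerns all points and comes from the averaged kernel itself. -/
theorem IsDisintegration.isHeatKernel_averagedKernelQ (hp : IsHeatKernel μ (kernelP (M := M)))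
    (h : IsDisintegration μ κ) : IsHeatKernel (baseMeasure μ) (averagedKernelQ κ) := by
  have : IsProbabilityMeasure (baseMeasure μ) :=
    Measure.isProbabilityMeasure_map measurable_proj.aemeasurable
  have hav := h.ae_averagedKernelQ_eq hp
  have hav1 := Measure.ae_ae_of_ae_prod hav
  have hav' := Measure.measurePreserving_swap.quasiMeasurePreserving.ae hav
  have hav2 := Measure.ae_ae_of_ae_prod hav'
  have hav0 : ∀ a, ∀ t > 0, ∃ C, ∀ b, |averagedKernelQ κ t a b| ≤ C := by
    intro a t ht
    obtain ⟨C, hC⟩ := exists_abs_kernelQ_le M ht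
    refine ⟨C, fun b => ?_⟩
    have := h.isProbabilityMeasure a
    have := h.isProbabilityMeasure b
    exact abs_integral_le_of_abs_le fun x => abs_integral_le_of_abs_le (hC x)
  have havm : ∀ a, ∀ t > 0, Measurable fun b => averagedKernelQ κ t a b := by
    intro a t ht
    have := (h.measurable_averagedKernelQ hp ht).comp (measurable_prodMk_left (x := a))
    exact this
  have havm' : ∀ b, ∀ t > 0, Measurable fun a => averagedKernelQ κ t a b := by
    intro b t ht
    have := (h.measurable_averagedKernelQ hp ht).comp (measurable_prodMk_right (y := b))
    exact this
  refine ⟨fun t ht => h.measurable_averagedKernelQ hp ht, ?_, ?_, ?_, ?_, fun f hf => ⟨?_, ?_⟩⟩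
  · filter_upwards [hav, h.ae_radialKernel_nonneg hp] with z hz hz1 t ht
    rw [hz t ht]; exact hz1 t ht
  · filter_upwards [hav, hav'] with z hz hz1 t ht
    rw [hz t ht, radialKernel_comm]
    exact (hz1 t ht).symm
  · filter_upwards [hav1, h.ae_integral_radialKernel hp] with a ha ha1 t ht
    obtain ⟨C, hC⟩ := hav0 a t ht
    refine ⟨integrable_of_abs_le (havm a t ht) hC, ?_⟩
    rw [← ha1 t ht]
    refine integral_congr_ae ?_
    filter_upwards [ha] with b hb using hb t ht
  · filter_upwards [hav, h.ae_radialKernel_semigroup hp,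
      Measure.quasiMeasurePreserving_fst.ae hav1, Measure.quasiMeasurePreserving_snd.ae hav2]
      with z hz hz1 hz2 hz3 s hs t ht
    obtain ⟨C, hC⟩ := hav0 z.1 s hs
    obtain ⟨D, hD⟩ := exists_abs_kernelQ_le M ht
    refine ⟨?_, ?_⟩
    · refine integrable_of_abs_le (C := C * D) ((havm z.1 s hs).mul (havm' z.2 t ht)) fun c => ?_
      have := h.isProbabilityMeasure c
      have := h.isProbabilityMeasure z.2
      rw [abs_mul]
      exact mul_le_mul (hC c) (abs_integral_le_of_abs_le fun x => abs_integral_le_of_abs_le (hD x))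
        (abs_nonneg _) ((abs_nonneg _).trans (hC c))
    · rw [hz _ (by positivity), hz1 s hs t ht]
      refine integral_congr_ae ?_
      filter_upwards [hz2, hz3] with c hc hc1
      have e1 : averagedKernelQ κ t c z.2 = radialKernel t c z.2 := hc1 t ht
      rw [hc s hs, e1]
  · intro t ht
    refine Eventually.of_forall fun a => ?_
    obtain ⟨C, hC⟩ := hav0 a t ht
    exact (hf.integrable one_le_two).mul_bdd (havm a t ht).aestronglyMeasurable
      (Eventually.of_forall hC)
  · have hg : MemLp (fun x => f (Base.proj x)) 2 μ :=
      (memLp_map_measure_iff hf.1 measurable_proj.aemeasurable).1 hf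
    obtain ⟨hg1, hg2⟩ := hp.approx_identity _ hg
    refine hg2.congr' ?_
    filter_upwards [self_mem_nhdsWithin] with t (ht : 0 < t)
    have hm : AEStronglyMeasurable (fun a => (∫ b, f b * averagedKernelQ κ t a b ∂(baseMeasure μ))
        - f a) (baseMeasure μ) := by
      refine AEStronglyMeasurable.sub ?_ hf.1
      exact AEStronglyMeasurable.integral_prod_right'
        (f := fun z : Base M × Base M => f z.2 * averagedKernelQ κ t z.1 z.2)
        (hf.1.comp_snd.mul (h.measurable_averagedKernelQ hp ht).aestronglyMeasurable)
    rw [show baseMeasure μ = μ.map Base.proj from rfl] at hm ⊢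
    rw [eLpNorm_map_measure hm measurable_proj.aemeasurable]
    refine eLpNorm_congr_ae ?_
    filter_upwards [hg1 t ht, h.integral_mul_radialKernel hp,
      ae_of_ae_map measurable_proj.aemeasurable hav1] with x hx hx1 hx2
    simp only [Function.comp_apply]
    rw [← hx1 f t ht hx]
    congr 1
    refine integral_congr_ae ?_
    filter_upwards [hx2] with b hb
    rw [← hb t ht]

end FiberAverages

/-! ### Existence of a disintegration -/

section Existence

open ProbabilityTheory

/-- A regular probability measure is carried by a closed separable set. -/
theorem exists_isClosed_isSeparable_measure_compl_eq_zero {X : Type*} [MetricSpace X]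
    [MeasurableSpace X] [BorelSpace X] (μ : Measure X) [IsProbabilityMeasure μ] [μ.Regular] :
    ∃ T : Set X, IsClosed T ∧ TopologicalSpace.IsSeparable T ∧ μ Tᶜ = 0 := by
  have h1 : ∀ n : ℕ, ∃ K : Set X, IsCompact K ∧ μ Set.univ < μ K + ((n : ℝ≥0∞) + 1)⁻¹ := by
    intro n
    obtain ⟨K, -, hK, h⟩ := MeasurableSet.univ.exists_isCompact_lt_add (μ := μ)
      (measure_ne_top μ _) (ε := ((n : ℝ≥0∞) + 1)⁻¹) (by simp)
    exact ⟨K, hK, h⟩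
  choose K hK hKμ using h1
  refine ⟨closure (⋃ n, K n), isClosed_closure,
    (TopologicalSpace.isSeparable_iUnion.2 fun n => (hK n).isSeparable).closure, ?_⟩
  have h2 : ∀ n : ℕ, μ (closure (⋃ n, K n))ᶜ ≤ ((n : ℝ≥0∞) + 1)⁻¹ := by
    intro n
    refine (measure_mono (Set.compl_subset_compl.2
      ((Set.subset_iUnion K n).trans subset_closure))).trans ?_
    rw [measure_compl (hK n).measurableSet (measure_ne_top μ _)]
    exact tsub_le_iff_left.2 (hKμ n).le
  refine le_antisymm
    (ge_of_tendsto' (x := atTop) (f := fun n : ℕ => ((n : ℝ≥0∞) + 1)⁻¹) ?_ h2) bot_le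
  have := (tendsto_add_atTop_iff_nat 1).2 ENNReal.tendsto_inv_nat_nhds_zero
  simpa using this

variable {M : Type*} [SemimetricPair M] [MeasurableSpace M] [BorelSpace M]

theorem exists_isDisintegration_zero : ∃ κ : Base M → Measure M, IsDisintegration 0 κ := by
  rcases isEmpty_or_nonempty M with hM | ⟨⟨x⟩⟩
  · have : IsEmpty (Base M) := ⟨fun b => Quotient.inductionOn b fun x => hM.elim x⟩
    exact ⟨fun _ => 0, fun b => isEmptyElim b, fun A _ => measurable_const, by simp [baseMeasure],
      fun f _ => by simp [baseMeasure]⟩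
  · exact ⟨fun _ => Measure.dirac x, fun b => inferInstance, fun A _ => measurable_const,
      by simp [baseMeasure], fun f _ => by simp [baseMeasure]⟩

/-- A disintegration is the conditional law of `x` given `π x`. The completeness of `M` makes the
closed separable set that carries `μ` a Polish space, on which conditional laws exist. -/
theorem exists_isDisintegration [CompleteSpace M] (μ : Measure M) [IsProbabilityMeasure μ]
    [μ.Regular] : ∃ κ : Base M → Measure M, IsDisintegration μ κ := by
  obtain ⟨T, hTc, hTs, hT0⟩ := exists_isClosed_isSeparable_measure_compl_eq_zero μ
  have hTm : MeasurableSet T := hTc.measurableSet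
  have : CompleteSpace T := hTc.completeSpace_coe
  have : TopologicalSpace.SeparableSpace T := hTs.separableSpace
  have : SecondCountableTopology T := UniformSpace.secondCountable_of_separable T
  have hνμ : (μ.comap ((↑) : T → M)).map (↑) = μ := by
    rw [map_comap_subtype_coe hTm]
    exact Measure.restrict_eq_self_of_ae_mem (mem_ae_iff.2 hT0)
  set ν : Measure T := μ.comap (↑) with hν
  have hcoe : Measurable ((↑) : T → M) := measurable_subtype_coe
  have hνp : IsProbabilityMeasure ν := by
    refine ⟨?_⟩
    rw [← Set.preimage_univ (f := ((↑) : T → M)), ← Measure.map_apply hcoe MeasurableSet.univ, hνμ,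
      measure_univ]
  have : Nonempty T := nonempty_of_isProbabilityMeasure ν
  have hpc : Measurable fun x : T => Base.proj (x : M) := measurable_proj.comp hcoe
  have hgm : Measurable fun x : T => (Base.proj (x : M), x) := hpc.prodMk measurable_id
  set ρ : Measure (Base M × T) := ν.map fun x : T => (Base.proj (x : M), x) with hρ
  have : IsProbabilityMeasure ρ := Measure.isProbabilityMeasure_map hgm.aemeasurable
  have hfst : ρ.fst = baseMeasure μ := by
    rw [Measure.fst, hρ, Measure.map_map measurable_fst hgm, baseMeasure, ← hνμ,
      Measure.map_map measurable_proj hcoe]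
    rfl
  have hdis : baseMeasure μ ⊗ₘ ρ.condKernel = ρ := by
    rw [← hfst]; exact ρ.disintegrate ρ.condKernel
  have : IsProbabilityMeasure (baseMeasure μ) :=
    Measure.isProbabilityMeasure_map measurable_proj.aemeasurable
  have hfib : ∀ᵐ b ∂(baseMeasure μ), ∀ᵐ x : T ∂(ρ.condKernel b), b = Base.proj (x : M) := by
    refine Measure.ae_ae_of_ae_compProd (p := fun p : Base M × T => p.1 = Base.proj (p.2 : M)) ?_
    rw [hdis, hρ, ae_map_iff hgm.aemeasurable]
    · exact Eventually.of_forall fun _ => rfl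
    · -- the base need not be separable, but `T` is
      have h1 : Measurable (Function.uncurry fun (x : T) (b : Base M) =>
          dist b (Base.proj (x : M))) :=
        measurable_uncurry_of_continuous_of_measurable
          (fun b => continuous_const.dist (continuous_proj.comp continuous_subtype_val))
          fun x => (continuous_id.dist continuous_const).measurable
      have h2 := (h1.comp measurable_swap) (measurableSet_singleton (0 : ℝ))
      convert h2 using 1
      ext p
      simp [Function.uncurry]
  have hprob : ∀ b, IsProbabilityMeasure ((ρ.condKernel b).map ((↑) : T → M)) := fun b =>
    Measure.isProbabilityMeasure_map hcoe.aemeasurable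
  have hfiber : ∀ᵐ b ∂(baseMeasure μ),
      (ρ.condKernel b).map ((↑) : T → M) (Base.proj ⁻¹' {b})ᶜ = 0 := by
    filter_upwards [hfib] with b hb
    have hm : MeasurableSet (Base.proj ⁻¹' {b} : Set M) :=
      measurable_proj (measurableSet_singleton b)
    rw [Measure.map_apply hcoe hm.compl]
    refine (ae_iff (p := fun x : T => b = Base.proj (x : M))).1 hb |> fun h => ?_
    refine (congrArg _ ?_).trans h
    ext x
    simp [eq_comm]
  refine ⟨fun b => (ρ.condKernel b).map (↑), hprob, fun A hA => ?_, hfiber, fun f hf => ?_⟩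
  · simp only [Measure.map_apply hcoe hA]
    exact ρ.condKernel.measurable_coe (hcoe hA)
  · have h1 : ∫⁻ x, f x ∂μ = ∫⁻ b, ∫⁻ x : T, f x ∂(ρ.condKernel b) ∂(baseMeasure μ) := by
      conv_lhs => rw [← hνμ]
      rw [lintegral_map hf hcoe]
      have hfm : Measurable fun p : Base M × T => f (p.2 : M) := hf.comp (hcoe.comp measurable_snd)
      have h2 : ∫⁻ p, f (p.2 : M) ∂ρ = ∫⁻ x : T, f x ∂ν := by
        rw [hρ, lintegral_map hfm hgm]
      rw [← h2]
      conv_lhs => rw [← hdis]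
      rw [Measure.lintegral_compProd hfm]
    rw [h1]
    refine lintegral_congr_ae ?_
    filter_upwards [hfiber] with b hb
    have hr : ((ρ.condKernel b).map ((↑) : T → M)).restrict (Base.proj ⁻¹' {b}) =
        (ρ.condKernel b).map ((↑) : T → M) :=
      Measure.restrict_eq_self_of_ae_mem (mem_ae_iff.2 hb)
    rw [hr, lintegral_map hf hcoe]

end Existence

end

theorem mainTheorem5 {M : Type*} [SemimetricPair M] [CompleteSpace M]
    [MeasurableSpace M] [BorelSpace M] (μ : Measure M) [μ.Regular] [SigmaFinite μ]
    (hp : IsHeatKernel μ (kernelP (M := M))) :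
    (∃ κ : Base M → Measure M, IsDisintegration μ κ) ∧
    ∀ κ : Base M → Measure M, IsDisintegration μ κ →
      IsHeatKernel (baseMeasure μ) (averagedKernelQ κ) ∧
      (∀ᵐ z ∂(μ.prod (baseMeasure μ)), ∀ n : ℕ,
        averagedTheta κ n z.1 z.2 = if n = 0 then 1 else 0) ∧
      (∀ᵐ z ∂((baseMeasure μ).prod (baseMeasure μ)), ∀ n : ℕ,
        averagedTheta₂ κ n z.1 z.2 = if n = 0 then 1 else 0) ∧
      (∀ᵐ z ∂((baseMeasure μ).prod (baseMeasure μ)), ∀ t > 0,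
        HasSum (fun k : ℕ => exp (-(4 * k * (k + 1)) * t) * ((2 * k + 1) *
          jacobi 0 k (cos (2 * Base.r z.1 z.2)))) (averagedKernelQ κ t z.1 z.2)) := by
  rcases eq_or_ne μ 0 with rfl | hμ
  · have hb : baseMeasure (0 : Measure M) = 0 := Measure.map_zero _
    refine ⟨exists_isDisintegration_zero, fun κ h => ⟨?_, by simp, by simp [hb], by simp [hb]⟩⟩
    rw [hb]
    exact ⟨fun t ht => h.measurable_averagedKernelQ hp ht, by simp, by simp, by simp, by simp,
      fun f _ => by simp⟩
  · have := isProbabilityMeasure_of_isHeatKernel hp hμ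
    refine ⟨exists_isDisintegration μ, fun κ h => ⟨h.isHeatKernel_averagedKernelQ hp,
      h.ae_averagedTheta_eq hp, h.ae_averagedTheta₂_eq hp, ?_⟩⟩
    filter_upwards [h.ae_averagedKernelQ_eq hp] with z hz t ht
    rw [hz t ht]
    exact hasSum_radialKernel ht z.1 z.2
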